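/- **Theorem 1.** Consider a finite dynamic set $S$ of records (natural numbers, each fitting in one memory cell) in which every record $v\in S$ has a probability $p(v)\in[0,1]$, and put $\mu_S=\sum_{v\in S}p(v)$. The operations are: *query*, which returns a random subset $X\subseteq S$; *update*$(v,x)$ for $v\in S$, which sets $p(v)$ to $x\in[0,1]$; *insert*$(v,x)$ for $v\notin S$, which adds $v$ to $S$ with $p(v)=x\in[0,1]$; and *delete*$(v)$ for $v\in S$, which removes $v$ from $S$. The model of computation is the Real RAM: memory cells hold real numbers, and accessing a memory cell, drawing a fresh random number from the uniform distribution on $[0,1]$, and each of addition, subtraction, multiplication, division, comparison, truncation, $\exp$ and $\log$ take one unit of time. There are a data structure (Real RAM programs for its construction and for the four operations) and a constant $C$ such that the following holds for every initial instance $(S_0,p_0)$ for which the data structure is constructed, and for every sequence of valid operations, fixed independently of the random choices, that is then carried out. 1. *Space.* Almost surely, the construction and all operations halt, and during the construction and during every operation, as well as after it, all memory cells except possibly the first $C(1+|S|)$ ones are blank, where $S$ is the set after the operation (respectively $S_0$); thus the space is $O(|S|)$. 2. *Correctness.* If the queries among the first $n$ operations return $X_1,\dots,X_r$, and $S_i$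 and $p_i$ are the set and the probabilities at the time of the $i$-th query, then for all $T_i\subseteq S_i$, $$\Pr[X_1=T_1,\dots,X_r=T_r]=\prod_{i=1}^{r}\Big(\prod_{v\in T_i}p_i(v)\Big)\Big(\prod_{v\in S_i\setminus T_i}(1-p_i(v))\Big).$$ That is, each query samples every record $v$ independently with probability $p(v)$, and the answers to different queries are independent. 3. *Query time.* The expected time of each query is at most $C(1+\mu_S)$, where $S$ is the set at the time of the query. 4. *Modification time.* Update, insert and delete take $O(1)$ amortized expected time: the expected total time of the updates, insertions and deletions among the first $n$ operations is at most $C$ times their number, for every $n$. 5. *Construction time.* The data structure is constructed in expected time at most $C(1+|S_0|)$. -/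

import Mathlib

open MeasureTheory

noncomputable section

/-! ### The Real RAM

Memory cells, registers, input and output hold real numbers. A program is a fixed finite structured
program; a register that is named by it can be used directly, the memory is addressed indirectly. -/

namespace RealRAM

/-- Arithmetic terms over the registers: addition, subtraction, multiplication, division,
comparison (with value `1` or `0`), truncation, `exp` and `log`. Literals are integers. -/
inductive Term where
  | const (z : ℤ)
  | reg (i : ℕ)
  | add (a b : Term)
  | sub (a b : Term)
  | mul (a b : Term)
  | div (a b : Term)
  | le (a b : Term)
  | floor (a : Term)
  | exp (a : Term)
  | log (a : Term)

/-- The value of a term. -/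
def Term.value (r : ℕ → ℝ) : Term → ℝ
  | .const z => (z : ℝ)
  | .reg i => r i
  | .add a b => a.value r + b.value r
  | .sub a b => a.value r - b.value r
  | .mul a b => a.value r * b.value r
  | .div a b => a.value r / b.value r
  | .le a b => if a.value r ≤ b.value r then 1 else 0
  | .floor a => (⌊a.value r⌋ : ℝ)
  | .exp a => Real.exp (a.value r)
  | .log a => Real.log (a.value r)

/-- The number of elementary operations in a term, each of which takes one unit of time. -/
def Term.cost : Term → ℕ
  | .const _ => 1
  | .reg _ => 1
  | .add a b => a.cost + b.cost + 1
  | .sub a b => a.cost + b.cost + 1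
  | .mul a b => a.cost + b.cost + 1
  | .div a b => a.cost + b.cost + 1
  | .le a b => a.cost + b.cost + 1
  | .floor a => a.cost + 1
  | .exp a => a.cost + 1
  | .log a => a.cost + 1

/-- Programs. -/
inductive Program where
  /-- `reg i := e` -/
  | assign (i : ℕ) (e : Term)
  /-- `reg i := ` a fresh random number from the uniform distribution on `[0, 1]` -/
  | rand (i : ℕ)
  /-- `reg i := mem[e]` -/
  | load (i : ℕ) (e : Term)
  /-- `mem[e] := e'` -/
  | store (e e' : Term)
  /-- `reg i := ` the next number of the input -/
  | read (i : ℕ)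
  /-- report the value of `e` as an item of the output -/
  | write (e : Term)
  /-- do nothing -/
  | skip
  /-- run `c`, then `c'` -/
  | seq (c c' : Program)
  /-- if `e ≠ 0` then run `c`, else run `c'` -/
  | ite (e : Term) (c c' : Program)
  /-- as long as `e ≠ 0`, run `c` -/
  | while (e : Term) (c : Program)

/-- The machine state, without the program that remains to be executed. -/
structure State where
  reg : ℕ → ℝ
  mem : ℕ → ℝ
  input : List ℝ
  output : List ℝ
  /-- the time spent so far -/
  clock : ℕ

/-- The state in which all registers and all memory cells are blank. -/
def State.blank : State where
  reg := fun _ => 0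
  mem := fun _ => 0
  input := []
  output := []
  clock := 0

/-- Registers and memory are kept, the input is supplied, output and clock are reset. -/
def State.start (s : State) (input : List ℝ) : State :=
  { s with input := input, output := [], clock := 0 }

/-- `n` units of time pass. -/
def State.tick (s : State) (n : ℕ) : State := { s with clock := s.clock + n }

/-- Register `i` gets the value `x`. -/
def State.setReg (s : State) (i : ℕ) (x : ℝ) : State := { s with reg := Function.update s.reg i x }

/-- A configuration: the stack of programs that remain to be executed, and the state. -/
abbrev Config := List Program × State

/-- One step of the machine, in which the random number `u` is used if the step is a `rand`
instruction. An address is obtained from a real number by truncation. Every step takes one unit of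
time for itself plus one for each elementary operation in the terms that it evaluates. -/
def step (u : ℝ) : Config → Config
  | ([], s) => ([], s)
  | (.assign i e :: k, s) => (k, (s.setReg i (e.value s.reg)).tick (1 + e.cost))
  | (.rand i :: k, s) => (k, (s.setReg i u).tick 1)
  | (.load i e :: k, s) => (k, (s.setReg i (s.mem ⌊e.value s.reg⌋₊)).tick (1 + e.cost))
  | (.store e e' :: k, s) =>
      (k, ({ s with mem := Function.update s.mem ⌊e.value s.reg⌋₊ (e'.value s.reg) } : State).tick
        (1 + e.cost + e'.cost))
  | (.read i :: k, s) =>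
      (k, (({ s with input := s.input.tail } : State).setReg i (s.input.headD 0)).tick 1)
  | (.write e :: k, s) =>
      (k, ({ s with output := e.value s.reg :: s.output } : State).tick (1 + e.cost))
  | (.skip :: k, s) => (k, s.tick 1)
  | (.seq c c' :: k, s) => (c :: c' :: k, s.tick 1)
  | (.ite e c c' :: k, s) => ((if e.value s.reg ≠ 0 then c else c') :: k, s.tick (1 + e.cost))
  | (.while e c :: k, s) =>
      (if e.value s.reg ≠ 0 then c :: .while e c :: k else k, s.tick (1 + e.cost))

/-- The configuration after `t` steps of program `c`, started in state `s`, where `ω t` is the random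
number that is available in step `t`. Each of them is used at most once. -/
def run (c : Program) (ω : ℕ → ℝ) (s : State) : ℕ → Config
  | 0 => ([c], s)
  | t + 1 => step (ω t) (run c ω s t)

open Classical in
/-- The state in which program `c` halts, and `none` if it does not halt. -/
def exec (c : Program) (ω : ℕ → ℝ) (s : State) : Option State :=
  if h : ∃ t, (run c ω s t).1 = [] then some (run c ω s (Nat.find h)).2 else none

/-- The uniform distribution on `[0, 1]`. -/
def uniform01 : Measure ℝ := volume.restrict (Set.Icc 0 1)

instance : IsProbabilityMeasure uniform01 := ⟨by simp [uniform01]⟩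

/-- The randomness of a sequence of program calls: `ω k t` is available in step `t` of call `k`,
and all these numbers are independent and uniformly distributed on `[0, 1]`. -/
def randomness : Measure (ℕ → ℕ → ℝ) :=
  Measure.infinitePi fun _ : ℕ => Measure.infinitePi fun _ : ℕ => uniform01

/-- A call: a program with its input. -/
abbrev Call := Program × List ℝ

/-- The state before call number `k` in a sequence of calls that share registers and memory, all of
which are blank in the beginning; `none` if an earlier call does not halt. -/
def stateBefore (calls : ℕ → Call) (ω : ℕ → ℕ → ℝ) : ℕ → Option State
  | 0 => some State.blank
  | k + 1 => (stateBefore calls ω k).bind fun s => exec (calls k).1 (ω k) (s.start (calls k).2)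

/-- The time that call number `k` takes; `⊤` if it is not reached or does not halt. -/
def time (calls : ℕ → Call) (ω : ℕ → ℕ → ℝ) (k : ℕ) : ENNReal :=
  match stateBefore calls ω (k + 1) with
  | some s => (s.clock : ENNReal)
  | none => ⊤

/-- Call number `k` halts, and at all times while it runs, and when it has halted, all memory cells
except possibly the first `N` ones are blank. -/
def HaltsInSpace (calls : ℕ → Call) (ω : ℕ → ℕ → ℝ) (k N : ℕ) : Prop :=
  (stateBefore calls ω (k + 1)).isSome ∧
    ∃ s, stateBefore calls ω k = some s ∧
      ∀ t a, N ≤ a → (run (calls k).1 (ω k) (s.start (calls k).2) t).2.mem a = 0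

/-- Call number `k` halts, and its output consists of the elements of `T`, each reported exactly
once, in some order. -/
def Outputs (calls : ℕ → Call) (ω : ℕ → ℕ → ℝ) (k : ℕ) (T : Finset ℕ) : Prop :=
  ∃ s, stateBefore calls ω (k + 1) = some s ∧
    (s.output : Multiset ℝ) = T.val.map (fun v => (v : ℝ))

end RealRAM

/-! ### Dynamic subset sampling -/

namespace SubsetSampling

open RealRAM

/-- A set `S` of records, which are natural numbers, with the probabilities `p`. The values of `p`
outside `S` are irrelevant. -/
structure Instance where
  S : Finset ℕ
  p : ℕ → ℝ

/-- The expected size `μ_S` of a sample. -/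
def Instance.mu (I : Instance) : ℝ := ∑ v ∈ I.S, I.p v

/-- The probability with which the sample has to be `T`. -/
def Instance.sampleProb (I : Instance) (T : Finset ℕ) : ℝ :=
  (∏ v ∈ T, I.p v) * ∏ v ∈ I.S \ T, (1 - I.p v)

/-- The operations. -/
inductive Op where
  | query
  | update (v : ℕ) (x : ℝ)
  | insert (v : ℕ) (x : ℝ)
  | delete (v : ℕ)

/-- The operation is a query. -/
def Op.IsQuery : Op → Prop
  | .query => True
  | _ => False

instance : DecidablePred Op.IsQuery := fun o => by cases o <;> unfold Op.IsQuery <;> infer_instance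

/-- The operation can be applied to the instance. -/
def Op.Valid (I : Instance) : Op → Prop
  | .query => True
  | .update v x => v ∈ I.S ∧ x ∈ Set.Icc 0 1
  | .insert v x => v ∉ I.S ∧ x ∈ Set.Icc 0 1
  | .delete v => v ∈ I.S

/-- The effect of an operation on the instance. -/
def Op.apply (I : Instance) : Op → Instance
  | .query => I
  | .update v x => ⟨I.S, Function.update I.p v x⟩
  | .insert v x => ⟨Insert.insert v I.S, Function.update I.p v x⟩
  | .delete v => ⟨I.S.erase v, I.p⟩

/-- The instance after the first `k` operations. -/
def instanceAfter (I : Instance) (ops : ℕ → Op) : ℕ → Instance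
  | 0 => I
  | k + 1 => (ops k).apply (instanceAfter I ops k)

/-- A data structure on the Real RAM: one program for its construction and one for each kind of
operation. They communicate through the registers and the memory only. -/
structure DataStructure where
  build : Program
  query : Program
  update : Program
  insert : Program
  delete : Program

/-- The call that performs an operation. -/
def DataStructure.opCall (D : DataStructure) : Op → Call
  | .query => (D.query, [])
  | .update v x => (D.update, [(v : ℝ), x])
  | .insert v x => (D.insert, [(v : ℝ), x])
  | .delete v => (D.delete, [(v : ℝ)])

/-- The calls that construct the data structure for the records in the list `l` (with the input
`n, v₁, p(v₁), …, vₙ, p(vₙ)`) and then perform the operations: call `0` is the construction, and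
call `k + 1` is operation `k`. -/
def DataStructure.calls (D : DataStructure) (l : List ℕ) (p : ℕ → ℝ) (ops : ℕ → Op) : ℕ → Call
  | 0 => (D.build, (l.length : ℝ) :: l.flatMap fun v : ℕ => [(v : ℝ), p v])
  | k + 1 => D.opCall (ops k)

end SubsetSampling

end

/-! A register holds an arbitrary integer, and `exp`, `log`, division and truncation form powers and
cut out digits in constant time. So the whole index fits into a few registers, and the memory only
needs to hold the records `1, …, n` with their probabilities, which gives the space bound. For a
capacity `M ≥ n` and the base `b = (M + 2)²` the registers hold a dictionary, whose digit at
position `v` is the index of record `v`; the string of weights; the string of slots; and a binary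
number that marks the heavy records.

Records with `p > 1/2` are heavy. There are at most `2μ` of them; a query finds each as the top bit
of the binary number and tosses a coin for it. A light record owns `w = ⌊2(M+1)p⌋ + 1` consecutive
slots. Imagine every slot to be hit independently with probability `1 - exp(-1/(M+1))`. Some slot of
the record is hit with probability `1 - exp(-w/(M+1))`, which is at least `p` (`prob_le_hitProb`),
so a hit record can be accepted with the quotient of the two probabilities and is then reported with
probability exactly `p`. The number of slots before the next hit is geometric and is obtained as
`⌊-(M+1) log u⌋`. A query thus jumps from hit to hit, reads the record as a digit of the slot string
(`slots_digit`), and by memorylessness continues at the end of that record (`tsum_hitValue`). The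
expected number of hit records is at most `∑ (2p + 1/(M+1)) ≤ 2μ + 1`.

A changed weight is a splice of the slot string (`slots_update`), at a position given by a prefix
sum of the weights, which is a residue modulo `b - 1` (`pack_mod_pred`). If an insertion finds `n =
M`, everything is rebuilt with capacity `2n + 1`; a potential proportional to `2n - M`, truncated at
`0`, pays for this (`insertProgram_reaches`). Deletion moves the last record into the gap and keeps
the capacity.

Every operation leaves the registers and the memory in a state that does not depend on the random
numbers (`exists_represents`). Hence the answer to a query depends on the random numbers of its own
call only, and independence is that of a product measure. `Spec` records the expectation of a
function of the final state and is propagated through the random steps by `Spec.rand`, in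
`heavy_spec` and `light_spec`. For the indicator of an answer it yields the law (`query_answer`),
for the clock the expected time (`query_time`). -/

namespace RealRAM

/-! ### Runs from arbitrary configurations -/

/-- The configuration after `t` steps from configuration `c`. -/
noncomputable def runFrom (c : Config) (ω : ℕ → ℝ) : ℕ → Config
  | 0 => c
  | t + 1 => step (ω t) (runFrom c ω t)

theorem run_eq_runFrom (c : Program) (ω : ℕ → ℝ) (s : State) (t : ℕ) :
    run c ω s t = runFrom ([c], s) ω t := by
  induction t with
  | zero => rfl
  | succ t ih => simp [run, runFrom, ih]

theorem runFrom_add (c : Config) (ω : ℕ → ℝ) (m t : ℕ) :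
    runFrom c ω (m + t) = runFrom (runFrom c ω m) (fun i => ω (m + i)) t := by
  induction t with
  | zero => rfl
  | succ t ih => rw [← add_assoc]; simp [runFrom, ih]

theorem runFrom_halted (s : State) (ω : ℕ → ℝ) (t : ℕ) : runFrom ([], s) ω t = ([], s) := by
  induction t with
  | zero => rfl
  | succ t ih => simp [runFrom, ih, step]

/-- All memory cells except possibly the first `N` ones are blank. -/
def Blank (N : ℕ) (m : ℕ → ℝ) : Prop := ∀ a, N ≤ a → m a = 0

theorem Blank.mono {N N' : ℕ} {m : ℕ → ℝ} (h : Blank N m) (hN : N ≤ N') : Blank N' m :=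
  fun a ha => h a (hN.trans ha)

/-- Whatever the random numbers are, `c` becomes `c'` in `n` steps, in space `N`. -/
def Reduces (N n : ℕ) (c c' : Config) : Prop :=
  ∀ ω, runFrom c ω n = c' ∧ ∀ t < n, Blank N (runFrom c ω t).2.mem

theorem Reduces.trans {N m n : ℕ} {c c' c'' : Config} (h : Reduces N m c c')
    (h' : Reduces N n c' c'') : Reduces N (m + n) c c'' := by
  intro ω
  have h1 := h ω
  have h2 := h' fun i => ω (m + i)
  refine ⟨by rw [runFrom_add, h1.1, h2.1], fun t ht => ?_⟩
  rcases lt_or_ge t m with hm | hm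
  · exact h1.2 t hm
  · obtain ⟨d, rfl⟩ := Nat.exists_eq_add_of_le hm
    rw [runFrom_add, h1.1]
    exact h2.2 d (by omega)

theorem Reduces.single {N : ℕ} {c c' : Config} (hb : Blank N c.2.mem) (h : ∀ u, step u c = c') :
    Reduces N 1 c c' := by
  intro ω
  refine ⟨by simp [runFrom, h], fun t ht => ?_⟩
  obtain rfl : t = 0 := by omega
  exact hb

/-- Whatever the random numbers are, `c` becomes `c'`, in space `N`. -/
def Reaches (N : ℕ) (c c' : Config) : Prop := ∃ n, Reduces N n c c'

theorem Reaches.trans {N : ℕ} {c c' c'' : Config} (h : Reaches N c c') (h' : Reaches N c' c'') :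
    Reaches N c c'' := by
  obtain ⟨m, hm⟩ := h
  obtain ⟨n, hn⟩ := h'
  exact ⟨m + n, hm.trans hn⟩

theorem Reaches.single {N : ℕ} {c c' : Config} (hb : Blank N c.2.mem) (h : ∀ u, step u c = c') :
    Reaches N c c' := ⟨1, .single hb h⟩

/-! ### Straight-line programs -/

/-- Programs without random numbers, branches and loops. -/
def Program.Straight : Program → Prop
  | .rand _ => False
  | .ite _ _ _ => False
  | .while _ _ => False
  | .seq c c' => c.Straight ∧ c'.Straight
  | _ => True

/-- The number of steps of a straight-line program. -/
def Program.length : Program → ℕ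
  | .seq c c' => 1 + c.length + c'.length
  | _ => 1

/-- The time of a straight-line program. -/
def Program.cost : Program → ℕ
  | .assign _ e => 1 + e.cost
  | .load _ e => 1 + e.cost
  | .store e e' => 1 + e.cost + e'.cost
  | .write e => 1 + e.cost
  | .seq c c' => 1 + c.cost + c'.cost
  | _ => 1

/-- The effect of a straight-line program, except on the clock. -/
noncomputable def Program.effect : Program → State → State
  | .assign i e, s => s.setReg i (e.value s.reg)
  | .load i e, s => s.setReg i (s.mem ⌊e.value s.reg⌋₊)
  | .store e e', s => { s with mem := Function.update s.mem ⌊e.value s.reg⌋₊ (e'.value s.reg) }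
  | .read i, s => ({ s with input := s.input.tail } : State).setReg i (s.input.headD 0)
  | .write e, s => { s with output := e.value s.reg :: s.output }
  | .seq c c', s => c'.effect (c.effect s)
  | _, s => s

/-- Every memory cell that a straight-line program writes to is one of the first `N`. -/
def Program.Safe (N : ℕ) : Program → State → Prop
  | .store e _, s => ⌊e.value s.reg⌋₊ < N
  | .seq c c', s => c.Safe N s ∧ c'.Safe N (c.effect s)
  | _, _ => True

/-- No instruction reads the clock, so the effect of a program and its time can be tracked
separately. -/
theorem Program.effect_tick (c : Program) (s : State) (n : ℕ) :
    c.effect (s.tick n) = (c.effect s).tick n := by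
  induction c generalizing s with
  | seq c c' ih ih' => simp [effect, ih, ih']
  | _ => rfl

theorem Program.safe_tick {N : ℕ} (c : Program) (s : State) (n : ℕ) (h : c.Safe N s) :
    c.Safe N (s.tick n) := by
  induction c generalizing s with
  | seq c c' ih ih' => exact ⟨ih _ h.1, by rw [effect_tick]; exact ih' _ h.2⟩
  | _ => exact h

theorem Program.blank_effect {N : ℕ} (c : Program) (s : State) (hs : c.Safe N s)
    (hb : Blank N s.mem) : Blank N (c.effect s).mem := by
  induction c generalizing s with
  | seq c c' ih ih' => exact ih' _ hs.2 (ih _ hs.1 hb)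
  | store e e' =>
    intro a ha
    have : a ≠ ⌊e.value s.reg⌋₊ := by
      simp only [Safe] at hs
      omega
    simp [effect, this, hb a ha]
  | _ => exact hb

theorem State.tick_tick (s : State) (m n : ℕ) : (s.tick m).tick n = s.tick (m + n) := by
  simp [State.tick, add_assoc]

/-- This turns the verification of straight-line code into an evaluation of `effect`, `Safe` and
`cost`, without stepping through the machine. -/
theorem Program.reduces {N : ℕ} (c : Program) (hc : c.Straight) (k : List Program) (s : State)
    (hs : c.Safe N s) (hb : Blank N s.mem) :
    Reduces N c.length (c :: k, s) (k, (c.effect s).tick c.cost) := by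
  induction c generalizing s k with
  | seq c c' ih ih' =>
    have h1 : Reduces N 1 (.seq c c' :: k, s) (c :: c' :: k, s.tick 1) := .single hb fun _ => rfl
    have h2 := ih hc.1 (c' :: k) _ (safe_tick c s 1 hs.1) hb
    rw [effect_tick, State.tick_tick] at h2
    have h3 := ih' hc.2 k _ (safe_tick c' (c.effect s) (1 + c.cost) hs.2)
      (blank_effect c s hs.1 hb)
    rw [effect_tick, State.tick_tick] at h3
    exact (h1.trans h2).trans h3
  | rand | ite => exact hc.elim
  | assign | load | store | read | write | skip => exact .single hb fun _ => rfl
  | _ => exact hc.elim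

/-! ### Halting, with randomness -/

/-- Whatever the random numbers are, `c` halts in a state with property `R`, in space `N`. -/
def Halts (N : ℕ) (R : State → Prop) (c : Config) : Prop :=
  ∀ ω, ∃ t s, runFrom c ω t = ([], s) ∧ R s ∧ ∀ t', Blank N (runFrom c ω t').2.mem

theorem Halts.of_reduces {N n : ℕ} {R : State → Prop} {c c' : Config} (h : Reduces N n c c')
    (h' : Halts N R c') : Halts N R c := by
  intro ω
  obtain ⟨t, s, ht, hs, hb⟩ := h' fun i => ω (n + i)
  refine ⟨n + t, s, by rw [runFrom_add, (h ω).1, ht], hs, fun t' => ?_⟩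
  rcases lt_or_ge t' n with hn | hn
  · exact (h ω).2 t' hn
  · obtain ⟨d, rfl⟩ := Nat.exists_eq_add_of_le hn
    rw [runFrom_add, (h ω).1]
    exact hb d

theorem Halts.nil {N : ℕ} {R : State → Prop} {s : State} (hb : Blank N s.mem) (h : R s) :
    Halts N R ([], s) := fun ω => ⟨0, s, rfl, h, fun t' => by rw [runFrom_halted]; exact hb⟩

/-- Every configuration has the random number of the first step as its first random number. -/
theorem Halts.of_step {N : ℕ} {R : State → Prop} {c : Config} (hb : Blank N c.2.mem)
    (h : ∀ u, Halts N R (step u c)) : Halts N R c := by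
  intro ω
  obtain ⟨t, s, ht, hs, hb'⟩ := h (ω 0) fun i => ω (1 + i)
  refine ⟨1 + t, s, by rw [runFrom_add]; exact ht, hs, fun t' => ?_⟩
  rcases Nat.eq_zero_or_pos t' with rfl | hn
  · exact hb
  · obtain ⟨d, rfl⟩ := Nat.exists_eq_add_of_le (show 1 ≤ t' from hn)
    rw [runFrom_add]
    exact hb' d

/-! ### Results -/

open Classical in
/-- The state in which configuration `c` halts. -/
noncomputable def result (c : Config) (ω : ℕ → ℝ) : Option State :=
  if h : ∃ t, (runFrom c ω t).1 = [] then some (runFrom c ω (Nat.find h)).2 else none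

theorem exec_eq_result (c : Program) (ω : ℕ → ℝ) (s : State) :
    exec c ω s = result ([c], s) ω := by
  have h : ∀ t, run c ω s t = runFrom ([c], s) ω t := run_eq_runFrom c ω s
  unfold exec result
  rw [funext h]

theorem result_eq_of_runFrom {c : Config} {ω : ℕ → ℝ} {t : ℕ} {s : State}
    (h : runFrom c ω t = ([], s)) : result c ω = some s := by
  classical
  have hex : ∃ t, (runFrom c ω t).1 = [] := ⟨t, by rw [h]⟩
  rw [result, dif_pos hex]
  have h1 := Nat.find_spec hex
  have h2 : Nat.find hex ≤ t := Nat.find_min' hex (by rw [h])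
  obtain ⟨d, hd⟩ := Nat.exists_eq_add_of_le h2
  have h3 : runFrom c ω (Nat.find hex) = ([], (runFrom c ω (Nat.find hex)).2) :=
    Prod.ext h1 rfl
  rw [hd, runFrom_add, h3, runFrom_halted] at h
  rw [(Prod.ext_iff.1 h).2]

theorem result_runFrom {c : Config} {ω : ℕ → ℝ} {n t : ℕ} {s : State}
    (h : runFrom (runFrom c ω n) (fun i => ω (n + i)) t = ([], s)) :
    result c ω = result (runFrom c ω n) (fun i => ω (n + i)) := by
  rw [result_eq_of_runFrom h]
  exact result_eq_of_runFrom (t := n + t) (by rw [runFrom_add, h])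

/-- The value of `f` in the state in which `c` halts. -/
noncomputable def finalValue (f : State → ENNReal) (c : Config) (ω : ℕ → ℝ) : ENNReal :=
  (result c ω).elim ⊤ f

/-- The law of the random numbers of one call. -/
noncomputable abbrev stream : Measure (ℕ → ℝ) := Measure.infinitePi fun _ : ℕ => uniform01

/-- A cylinder factors into its condition at `0` and the remaining conditions shifted down by one.
This splits off the random number of the first step, so that expectations can be computed step by
step. -/
theorem measurePreserving_cons :
    MeasurePreserving (fun x : ℝ × (ℕ → ℝ) => (fun i => Nat.casesOn i x.1 x.2 : ℕ → ℝ))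
      (uniform01.prod stream) stream := by
  have hm : Measurable (fun x : ℝ × (ℕ → ℝ) => (fun i => Nat.casesOn i x.1 x.2 : ℕ → ℝ)) := by
    refine measurable_pi_lambda _ fun i => ?_
    cases i with
    | zero => exact measurable_fst
    | succ i => exact (measurable_pi_apply i).comp measurable_snd
  refine ⟨hm, Measure.eq_infinitePi _ fun s t ht => ?_⟩
  classical
  rw [Measure.map_apply hm (.pi s.countable_toSet fun i _ => ht i)]
  have hpre : (fun x : ℝ × (ℕ → ℝ) => (fun i => Nat.casesOn i x.1 x.2 : ℕ → ℝ)) ⁻¹'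
      (s : Set ℕ).pi t = (if 0 ∈ s then t 0 else Set.univ) ×ˢ
        (((s.erase 0).image Nat.pred : Finset ℕ) : Set ℕ).pi fun i => t (i + 1) := by
    ext ⟨u, ω⟩
    simp only [Set.mem_preimage, Set.mem_pi, Finset.mem_coe, Set.mem_prod, Finset.mem_image,
      Finset.mem_erase]
    constructor
    · intro h
      refine ⟨?_, ?_⟩
      · split_ifs with h0
        · exact h 0 h0
        · trivial
      · rintro _ ⟨i, ⟨hi, his⟩, rfl⟩
        obtain ⟨j, rfl⟩ := Nat.exists_eq_succ_of_ne_zero hi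
        exact h _ his
    · rintro ⟨h0, h1⟩ i hi
      cases i with
      | zero => simpa [hi] using h0
      | succ i => exact h1 i ⟨i + 1, ⟨by simp, hi⟩, rfl⟩
  have hinj : Set.InjOn Nat.pred (s.erase 0 : Finset ℕ) := by
    intro a ha b hb hab
    have ha' := (Finset.mem_erase.1 ha).1
    have hb' := (Finset.mem_erase.1 hb).1
    simp only [Nat.pred_eq_sub_one] at hab
    omega
  rw [hpre, Measure.prod_prod, Measure.infinitePi_pi _ fun i _ => ht _, Finset.prod_image hinj]
  have hrest : ∏ i ∈ s.erase 0, uniform01 (t (i.pred + 1)) = ∏ i ∈ s.erase 0, uniform01 (t i) := by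
    refine Finset.prod_congr rfl fun i hi => ?_
    rw [Nat.pred_eq_sub_one, Nat.sub_add_cancel (Nat.pos_of_ne_zero (Finset.mem_erase.1 hi).1)]
  rw [hrest]
  split_ifs with h0
  · exact Finset.mul_prod_erase s (fun i => uniform01 (t i)) h0
  · simp [Finset.erase_eq_of_notMem h0]

theorem measurePreserving_tail :
    MeasurePreserving (fun (ω : ℕ → ℝ) i => ω (1 + i)) stream stream := by
  have h := measurePreserving_cons
  have hm : Measurable fun (ω : ℕ → ℝ) i => ω (1 + i) :=
    measurable_pi_lambda _ fun i => measurable_pi_apply _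
  refine ⟨hm, ?_⟩
  conv_lhs => rw [← h.map_eq]
  rw [Measure.map_map hm h.measurable]
  have : ((fun (ω : ℕ → ℝ) i => ω (1 + i)) ∘
      fun x : ℝ × (ℕ → ℝ) => (fun i => Nat.casesOn i x.1 x.2 : ℕ → ℝ)) = Prod.snd := by
    ext x i
    simp [Nat.add_comm 1 i]
  rw [this]
  exact measurePreserving_snd.map_eq

/-- Deterministic steps use up entries of the stream too; what is left after them has the same law.
-/
theorem measurePreserving_drop (n : ℕ) :
    MeasurePreserving (fun (ω : ℕ → ℝ) i => ω (n + i)) stream stream := by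
  induction n with
  | zero =>
    simp only [zero_add]
    exact MeasurePreserving.id stream
  | succ n ih =>
    have := measurePreserving_tail.comp ih
    convert this using 2
    ext i
    simp [add_assoc]

/-! ### Expected results -/

/-- Configuration `c` always halts in a state with property `R`, in space `N`, and the expected
value of `f` in that state is `r`. -/
structure Spec (N : ℕ) (R : State → Prop) (f : State → ENNReal) (c : Config) (r : ENNReal) :
    Prop where
  halts : Halts N R c
  measurable : Measurable (finalValue f c)
  lintegral : ∫⁻ ω, finalValue f c ω ∂stream = r

theorem Spec.nil {N : ℕ} {R : State → Prop} (f : State → ENNReal) {s : State}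
    (hb : Blank N s.mem) (h : R s) : Spec N R f ([], s) (f s) := by
  have : finalValue f ([], s) = fun _ => f s := by
    ext ω
    rw [finalValue, result_eq_of_runFrom (runFrom_halted s ω 0)]
    rfl
  refine ⟨.nil hb h, ?_, ?_⟩ <;> rw [this]
  · exact measurable_const
  · simp

theorem Halts.finalValue_eq {N : ℕ} {R : State → Prop} {c c' : Config} {n : ℕ}
    (h' : Halts N R c') (f : State → ENNReal) (ω : ℕ → ℝ) (h : runFrom c ω n = c') :
    finalValue f c ω = finalValue f c' fun i => ω (n + i) := by
  subst h
  obtain ⟨t, s, ht, -⟩ := h' fun i => ω (n + i)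
  rw [finalValue, finalValue, result_runFrom ht]

theorem Spec.of_reduces {N n : ℕ} {R : State → Prop} {f : State → ENNReal} {c c' : Config}
    {r : ENNReal} (h : Reduces N n c c') (h' : Spec N R f c' r) : Spec N R f c r := by
  have hf : finalValue f c = fun ω => finalValue f c' fun i => ω (n + i) :=
    funext fun ω => h'.halts.finalValue_eq f ω (h ω).1
  refine ⟨h'.halts.of_reduces h, ?_, ?_⟩ <;> rw [hf]
  · exact h'.measurable.comp (measurePreserving_drop n).measurable
  · rw [← h'.lintegral]
    exact (measurePreserving_drop n).lintegral_comp h'.measurable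

/-- A random number that the following `n` steps turn into an index `j u` from a countable set. -/
theorem Spec.rand {N n : ℕ} {R : State → Prop} {f : State → ENNReal} {ι : Type} [Countable ι]
    [MeasurableSpace ι] [DiscreteMeasurableSpace ι] {j : ℝ → ι} (hj : Measurable j)
    {cfg : ι → Config} {r : ι → ENNReal} {i : ℕ} {k : List Program} {s : State}
    (hb : Blank N s.mem) (hred : ∀ u, Reduces N n (k, (s.setReg i u).tick 1) (cfg (j u)))
    (h : ∀ u, Spec N R f (cfg (j u)) (r (j u))) :
    Spec N R f (.rand i :: k, s) (∫⁻ u, r (j u) ∂uniform01) := by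
  classical
  have hhalts : Halts N R (.rand i :: k, s) :=
    .of_step hb fun u => (h u).halts.of_reduces (hred u)
  -- Nothing is known about indices outside the range of `j`. The value `0` there makes every
  -- section measurable, and countability of `ι` then gives joint measurability.
  let g : ι → (ℕ → ℝ) → ENNReal := fun i ω =>
    if ∃ u, j u = i then finalValue f (cfg i) fun t => ω (n + t) else 0
  have hg : ∀ i, Measurable (g i) := by
    intro i
    by_cases hi : ∃ u, j u = i
    · obtain ⟨u, rfl⟩ := hi
      simp only [g, exists_apply_eq_apply, if_true]
      exact (h u).measurable.comp (measurePreserving_drop n).measurable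
    · simp [g, hi]
  have hg2 : Measurable fun x : ι × (ℕ → ℝ) => g x.1 x.2 :=
    measurable_from_prod_countable_right hg
  have hF : finalValue f (.rand i :: k, s) = fun ω => g (j (ω 0)) fun t => ω (1 + t) := by
    ext ω
    have h1 : Halts N R (k, (s.setReg i (ω 0)).tick 1) :=
      (h (ω 0)).halts.of_reduces (hred (ω 0))
    rw [h1.finalValue_eq f ω (n := 1) rfl,
      (h (ω 0)).halts.finalValue_eq f _ (hred (ω 0) fun t => ω (1 + t)).1]
    simp [g]
  have hmeas : Measurable (finalValue f (.rand i :: k, s)) := by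
    rw [hF]
    exact hg2.comp ((hj.comp (measurable_pi_apply 0)).prodMk measurePreserving_tail.measurable)
  refine ⟨hhalts, hmeas, ?_⟩
  -- The first random number determines the index; the later ones are independent of it and keep
  -- their law after the `n` dropped steps.
  rw [← measurePreserving_cons.lintegral_comp hmeas, hF, lintegral_prod]
  · refine lintegral_congr fun u => ?_
    rw [← (h u).lintegral, ← (measurePreserving_drop n).lintegral_comp (h u).measurable]
    refine lintegral_congr fun ω => ?_
    simp [g, Nat.add_comm 1]
  · rw [← hF]
    exact (hmeas.comp measurePreserving_cons.measurable).aemeasurable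

end RealRAM

namespace SubsetSampling

/-! ### Sequences packed into numbers -/

/-- The number with the base `b` digits `w 0, …, w (K - 1)`. -/
def pack (b K : ℕ) (w : ℕ → ℕ) : ℕ := ∑ k ∈ Finset.range K, w k * b ^ k

theorem pack_succ (b K : ℕ) (w : ℕ → ℕ) : pack b (K + 1) w = pack b K w + w K * b ^ K :=
  Finset.sum_range_succ _ _

theorem pack_lt {b K : ℕ} {w : ℕ → ℕ} (hw : ∀ k < K, w k < b) : pack b K w < b ^ K := by
  induction K with
  | zero => simp [pack]
  | succ K ih =>
    have h1 := ih fun k hk => hw k (by omega)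
    have h2 : w K + 1 ≤ b := hw K (by omega)
    rw [pack_succ, pow_succ]
    nlinarith [Nat.mul_le_mul_right (b ^ K) h2]

theorem pack_split {b K k : ℕ} (w : ℕ → ℕ) (hk : k ≤ K) :
    ∃ high, pack b K w = pack b k w + b ^ k * high := by
  obtain ⟨d, rfl⟩ := Nat.exists_eq_add_of_le hk
  induction d with
  | zero => exact ⟨0, by simp⟩
  | succ d ih =>
    obtain ⟨high, h⟩ := ih (by omega)
    refine ⟨high + w (k + d) * b ^ d, ?_⟩
    rw [← add_assoc, pack_succ, h]
    ring

theorem pack_mod {b K k : ℕ} {w : ℕ → ℕ} (hw : ∀ k < K, w k < b) (hk : k ≤ K) :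
    pack b K w % b ^ k = pack b k w := by
  obtain ⟨high, h⟩ := pack_split (b := b) w hk
  rw [h, Nat.add_mul_mod_self_left, Nat.mod_eq_of_lt (pack_lt fun j hj => hw j (by omega))]

theorem pack_digit {b K k : ℕ} {w : ℕ → ℕ} (hw : ∀ k < K, w k < b) (hk : k < K) :
    pack b K w / b ^ k % b = w k := by
  have hb : 0 < b := (Nat.zero_le _).trans_lt (hw k hk)
  obtain ⟨high, h⟩ := pack_split (b := b) w (show k + 1 ≤ K from hk)
  have h1 : pack b k w < b ^ k := pack_lt fun j hj => hw j (by omega)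
  have h2 : pack b K w = pack b k w + b ^ k * (w k + b * high) := by
    rw [h, pack_succ, pow_succ]
    ring
  rw [h2, Nat.add_mul_div_left _ _ (pow_pos hb k), Nat.div_eq_of_lt h1, zero_add,
    Nat.add_mul_mod_self_left, Nat.mod_eq_of_lt (hw k hk)]

/-- Modulo `b - 1` all powers of `b` are `1`, so only the digit sum remains. This is how a sum of
many weights is computed in constant time. -/
theorem pack_mod_pred {b K : ℕ} {w : ℕ → ℕ} (hw : ∑ k ∈ Finset.range K, w k < b - 1) :
    pack b K w % (b - 1) = ∑ k ∈ Finset.range K, w k := by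
  have h : pack b K w ≡ ∑ k ∈ Finset.range K, w k [MOD b - 1] := by
    refine Nat.ModEq.sum fun k _ => ?_
    have hb : b ≡ 1 [MOD b - 1] :=
      ((Nat.modEq_iff_dvd' (by omega)).2 dvd_rfl).symm
    simpa using (hb.pow k).mul_left (w k)
  rw [h, Nat.mod_eq_of_lt hw]

theorem pack_update {b K k : ℕ} (w : ℕ → ℕ) (hk : k < K) (m : ℕ) :
    (pack b K (Function.update w k m) : ℝ) = pack b K w + ((m : ℝ) - w k) * b ^ k := by
  have hmem : k ∈ Finset.range K := Finset.mem_range.2 hk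
  have h : ∑ j ∈ (Finset.range K).erase k, Function.update w k m j * b ^ j =
      ∑ j ∈ (Finset.range K).erase k, w j * b ^ j :=
    Finset.sum_congr rfl fun j hj => by
      rw [Function.update_of_ne (Finset.ne_of_mem_erase hj)]
  unfold pack
  rw [← Finset.add_sum_erase _ _ hmem, ← Finset.add_sum_erase _ (fun j => w j * b ^ j) hmem, h]
  simp only [Function.update_self]
  push_cast
  ring

/-! ### Strings of runs of equal digits -/

/-- The number with `m` base `b` digits that are all `1`. -/
def repunit (b m : ℕ) : ℕ := ∑ i ∈ Finset.range m, b ^ i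

theorem repunit_succ (b m : ℕ) : repunit b (m + 1) = repunit b m + b ^ m :=
  Finset.sum_range_succ _ _

theorem repunit_add (b m n : ℕ) : repunit b (m + n) = repunit b m + b ^ m * repunit b n := by
  simp [repunit, Finset.sum_range_add, Finset.mul_sum, pow_add]

theorem repunit_mul {b : ℕ} (hb : 1 < b) (m : ℕ) : repunit b m * (b - 1) + 1 = b ^ m := by
  obtain ⟨c, rfl⟩ := Nat.exists_eq_add_of_le' hb.le
  induction m with
  | zero => simp [repunit]
  | succ m ih => rw [repunit_succ, pow_succ]; simp only [Nat.add_sub_cancel] at ih ⊢; nlinarith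

theorem repunit_cast {b : ℕ} (hb : 1 < b) (m : ℕ) :
    (repunit b m : ℝ) = ((b : ℝ) ^ m - 1) / (b - 1) := by
  have hb' : (b : ℝ) - 1 ≠ 0 := sub_ne_zero.2 (by exact_mod_cast hb.ne')
  have h : ((repunit b m * (b - 1) + 1 : ℕ) : ℝ) = (b ^ m : ℕ) := by rw [repunit_mul hb]
  rw [eq_div_iff hb']
  push_cast [Nat.cast_sub hb.le] at h
  linarith

/-- The total weight of the records before record `k`. -/
def start (w : ℕ → ℕ) (k : ℕ) : ℕ := ∑ j ∈ Finset.range k, w j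

theorem start_succ (w : ℕ → ℕ) (k : ℕ) : start w (k + 1) = start w k + w k :=
  Finset.sum_range_succ _ _

theorem start_mono (w : ℕ → ℕ) : Monotone (start w) :=
  monotone_nat_of_le_succ fun k => by rw [start_succ]; omega

/-- The string in which record `k < K` occupies `w k` consecutive slots. -/
def slots (b K : ℕ) (w : ℕ → ℕ) : ℕ :=
  ∑ k ∈ Finset.range K, k * repunit b (w k) * b ^ start w k

theorem slots_succ (b K : ℕ) (w : ℕ → ℕ) :
    slots b (K + 1) w = slots b K w + K * repunit b (w K) * b ^ start w K :=
  Finset.sum_range_succ _ _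

/-- Each digit is at most `b - 1`, so a run of length `w k` is at most `(b - 1) * repunit b (w k) =
b ^ w k - 1` and does not spill over into the next run. -/
theorem slots_lt {b K : ℕ} (w : ℕ → ℕ) (hb : 1 < b) (hK : K ≤ b) :
    slots b K w < b ^ start w K := by
  induction K with
  | zero => simp [slots, start]
  | succ K ih =>
    have h1 := ih (by omega)
    have h2 : K ≤ b - 1 := by omega
    rw [slots_succ, start_succ, pow_add, ← repunit_mul hb (w K)]
    have h3 : K * repunit b (w K) * b ^ start w K ≤ (b - 1) * repunit b (w K) * b ^ start w K := by
      gcongr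
    nlinarith

/-- The part of the string that is occupied by the `d` records after record `k`. -/
def slotsAfter (b k d : ℕ) (w : ℕ → ℕ) : ℕ :=
  ∑ j ∈ Finset.range d,
    (k + 1 + j) * repunit b (w (k + 1 + j)) * b ^ start (fun i => w (k + 1 + i)) j

theorem start_add (w : ℕ → ℕ) (k j : ℕ) : start w (k + j) = start w k + start (fun i => w (k + i)) j :=
  Finset.sum_range_add _ _ _

/-- The weight of record `k` enters the part above its run only through the shift. Both reading and
replacing a run rest on this form. -/
theorem slots_split (b k d : ℕ) (w : ℕ → ℕ) :
    slots b (k + 1 + d) w = slots b k w +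
      b ^ start w k * (k * repunit b (w k) + b ^ w k * slotsAfter b k d w) := by
  have h : ∑ j ∈ Finset.range d, (k + 1 + j) * repunit b (w (k + 1 + j)) *
      b ^ start w (k + 1 + j) = b ^ start w k * (b ^ w k * slotsAfter b k d w) := by
    rw [slotsAfter, Finset.mul_sum, Finset.mul_sum]
    refine Finset.sum_congr rfl fun j _ => ?_
    rw [start_add, start_succ]
    ring
  rw [slots, Finset.sum_range_add, h, Finset.sum_range_succ, slots]
  ring

theorem slots_digit {b K k : ℕ} {w : ℕ → ℕ} (hb : 1 < b) (hK : K ≤ b) (hk : k < K) {t : ℕ}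
    (ht : t < w k) : slots b K w / b ^ (start w k + t) % b = k := by
  obtain ⟨d, rfl⟩ := Nat.exists_eq_add_of_le (show k + 1 ≤ K from hk)
  obtain ⟨e, he⟩ := Nat.exists_eq_add_of_le (show t + 1 ≤ w k from ht)
  have hpos : ∀ i, 0 < b ^ i := fun i => pow_pos (by omega) i
  have h1 : k * repunit b t < b ^ t := by
    have h2 : k * repunit b t ≤ (b - 1) * repunit b t := by gcongr; omega
    rw [← repunit_mul hb t]
    nlinarith
  -- The run is cut at slot `t`: `t` equal digits below, the digit to be read, and `e = w k - t - 1`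
  -- equal digits above it.
  have h2 : k * repunit b (w k) + b ^ w k * slotsAfter b k d w =
      k * repunit b t + b ^ t * (k + b * (k * repunit b e + b ^ e * slotsAfter b k d w)) := by
    rw [he, repunit_add, repunit_succ]
    ring
  rw [slots_split, pow_add, ← Nat.div_div_eq_div_mul, Nat.add_mul_div_left _ _ (hpos _),
    Nat.div_eq_of_lt (slots_lt w hb (by omega)), zero_add, h2,
    Nat.add_mul_div_left _ _ (hpos _), Nat.div_eq_of_lt h1, zero_add, Nat.add_mul_mod_self_left,
    Nat.mod_eq_of_lt (by omega)]

/-- The digit `0` beyond the last run is the stop signal of the query, since the actual records are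
numbered from `1`. -/
theorem slots_digit_of_le {b K y : ℕ} {w : ℕ → ℕ} (hb : 1 < b) (hK : K ≤ b)
    (hy : start w K ≤ y) : slots b K w / b ^ y % b = 0 := by
  rw [Nat.div_eq_of_lt, Nat.zero_mod]
  exact (slots_lt w hb hK).trans_le (Nat.pow_le_pow_right (by omega) hy)

theorem start_update {w : ℕ → ℕ} {k m j : ℕ} (hj : j ≤ k) :
    start (Function.update w k m) j = start w j :=
  Finset.sum_congr rfl fun i hi => by
    rw [Function.update_of_ne (by have := Finset.mem_range.1 hi; omega)]

theorem slots_congr {b K : ℕ} {w w' : ℕ → ℕ} (h : ∀ k < K, w k = w' k) :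
    slots b K w = slots b K w' := by
  refine Finset.sum_congr rfl fun k hk => ?_
  have hk := Finset.mem_range.1 hk
  have : start w k = start w' k :=
    Finset.sum_congr rfl fun i hi => h i ((Finset.mem_range.1 hi).trans hk)
  rw [h k hk, this]

/-- The remainder keeps what lies below the run, and division at the old end of the run recovers
what lies above it; the new run is put between the two. -/
theorem slots_update {b K k : ℕ} {w : ℕ → ℕ} (hb : 1 < b) (hK : K ≤ b) (hk : k < K) (m : ℕ) :
    slots b K (Function.update w k m) = slots b K w % b ^ start w k +
      b ^ start w k * (k * repunit b m + b ^ m * (slots b K w / b ^ (start w k + w k))) := by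
  obtain ⟨d, rfl⟩ := Nat.exists_eq_add_of_le (show k + 1 ≤ K from hk)
  have hpos : ∀ i, 0 < b ^ i := fun i => pow_pos (by omega) i
  have hafter : slotsAfter b k d (Function.update w k m) = slotsAfter b k d w := by
    have hne : ∀ i, Function.update w k m (k + 1 + i) = w (k + 1 + i) := fun i =>
      Function.update_of_ne (by omega) _ _
    simp only [slotsAfter, hne]
  have hlow : slots b k (Function.update w k m) = slots b k w :=
    slots_congr fun j hj => Function.update_of_ne (by omega) _ _
  have h1 : k * repunit b (w k) < b ^ w k := by
    have h2 : k * repunit b (w k) ≤ (b - 1) * repunit b (w k) := by gcongr; omega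
    rw [← repunit_mul hb (w k)]
    nlinarith
  have hlt := slots_lt w hb (show k ≤ b by omega)
  rw [slots_split, slots_split, hafter, hlow, start_update le_rfl, Function.update_self,
    Nat.add_mul_mod_self_left, Nat.mod_eq_of_lt hlt, pow_add, ← Nat.div_div_eq_div_mul,
    Nat.add_mul_div_left _ _ (hpos _), Nat.div_eq_of_lt hlt, zero_add,
    Nat.add_mul_div_left _ _ (hpos _), Nat.div_eq_of_lt h1, zero_add]

/-- The top bit of a binary number. -/
theorem floor_logb_pack {w : ℕ → ℕ} {k : ℕ} (hw : ∀ j < k + 1, w j < 2) (hk : w k = 1) :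
    ⌊Real.log (pack 2 (k + 1) w) / Real.log 2⌋ = (k : ℤ) := by
  have hlow : pack 2 k w < 2 ^ k := pack_lt fun j hj => hw j (by omega)
  have hle : (2 : ℝ) ^ k ≤ pack 2 (k + 1) w := by
    rw [pack_succ, hk]
    push_cast
    have : (0 : ℝ) ≤ pack 2 k w := Nat.cast_nonneg _
    linarith
  have hlt : (pack 2 (k + 1) w : ℝ) < 2 ^ (k + 1) := by
    exact_mod_cast pack_lt hw
  have hpos : (0 : ℝ) < pack 2 (k + 1) w := lt_of_lt_of_le (by positivity) hle
  have h2 : 0 < Real.log 2 := Real.log_pos one_lt_two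
  rw [Int.floor_eq_iff]
  constructor
  · rw [le_div_iff₀ h2, Int.cast_natCast, ← Real.log_pow]
    exact Real.log_le_log (by positivity) hle
  · rw [div_lt_iff₀ h2]
    have := Real.log_lt_log hpos hlt
    rw [Real.log_pow] at this
    push_cast at this ⊢
    exact this

/-! ### Dictionaries -/

/-- The dictionary that maps `key k` to `k`, for the records `1, …, n`. -/
def dict (b n : ℕ) (key : ℕ → ℕ) : ℕ := ∑ k ∈ Finset.Icc 1 n, k * b ^ key k

/-- Distinct keys occupy distinct digit positions, so the sum is at most the number whose `e` digits
are all `b - 1`. -/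
theorem sum_mul_pow_lt {b e : ℕ} {key : ℕ → ℕ} {A : Finset ℕ} (hinj : Set.InjOn key A)
    (hA : ∀ k ∈ A, k < b) (he : ∀ k ∈ A, key k < e) (hb : 1 ≤ b) :
    ∑ k ∈ A, k * b ^ key k < b ^ e := by
  have h : ∑ v ∈ Finset.range e, (b - 1) * b ^ v < b ^ e :=
    pack_lt (w := fun _ => b - 1) fun k _ => by omega
  refine lt_of_le_of_lt ?_ h
  calc ∑ k ∈ A, k * b ^ key k ≤ ∑ k ∈ A, (b - 1) * b ^ key k :=
        Finset.sum_le_sum fun k hk => Nat.mul_le_mul_right _ (by have := hA k hk; omega)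
    _ = ∑ v ∈ A.image key, (b - 1) * b ^ v := (Finset.sum_image (f := fun v => (b - 1) * b ^ v) hinj).symm
    _ ≤ _ := by
      refine Finset.sum_le_sum_of_subset fun v hv => ?_
      obtain ⟨k, hk, rfl⟩ := Finset.mem_image.1 hv
      exact Finset.mem_range.2 (he k hk)

/-- Smaller keys contribute less than `b ^ key k` in total and larger keys a multiple of `b ^ (key k
+ 1)`, so no carry disturbs the digit at `key k`. -/
theorem dict_digit {b n k : ℕ} {key : ℕ → ℕ} (hinj : Set.InjOn key (Finset.Icc 1 n))
    (hn : n < b) (hk : k ∈ Finset.Icc 1 n) : dict b n key / b ^ key k % b = k := by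
  have hkb : k < b := (Finset.mem_Icc.1 hk).2.trans_lt hn
  have hb : 0 < b := by omega
  have hsplit : dict b n key = ∑ j ∈ Finset.Icc 1 n with key j < key k, j * b ^ key j +
      (k * b ^ key k + ∑ j ∈ Finset.Icc 1 n with key k < key j, j * b ^ key j) := by
    rw [dict, ← Finset.sum_filter_add_sum_filter_not _ (fun j => key j < key k)]
    congr 1
    have hmem : k ∈ (Finset.Icc 1 n).filter fun j => ¬ key j < key k := by simpa using hk
    rw [← Finset.add_sum_erase _ _ hmem]
    congr 1
    refine Finset.sum_congr ?_ fun _ _ => rfl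
    ext j
    simp only [Finset.mem_erase, Finset.mem_filter]
    constructor
    · rintro ⟨hne, hj, hlt⟩
      refine ⟨hj, lt_of_le_of_ne (not_lt.1 hlt) fun h => hne (hinj hj hk h.symm)⟩
    · rintro ⟨hj, hlt⟩
      exact ⟨fun h => by rw [h] at hlt; exact lt_irrefl _ hlt, hj, hlt.le.not_gt⟩
  have hlow : ∑ j ∈ Finset.Icc 1 n with key j < key k, j * b ^ key j < b ^ key k := by
    refine sum_mul_pow_lt ?_ ?_ ?_ hb
    · exact hinj.mono (by simp [Set.subset_def]; tauto)
    · intro j hj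
      simp only [Finset.mem_filter, Finset.mem_Icc] at hj
      omega
    · intro j hj
      exact (Finset.mem_filter.1 hj).2
  have hhigh : b ^ (key k + 1) ∣ ∑ j ∈ Finset.Icc 1 n with key k < key j, j * b ^ key j :=
    Finset.dvd_sum fun j hj => (pow_dvd_pow b (Finset.mem_filter.1 hj).2).mul_left j
  obtain ⟨c, hc⟩ := hhigh
  rw [hsplit, hc, show k * b ^ key k + b ^ (key k + 1) * c = b ^ key k * (k + b * c) by
    rw [pow_succ]; ring, Nat.add_mul_div_left _ _ (pow_pos hb _), Nat.div_eq_of_lt hlow, zero_add,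
    Nat.add_mul_mod_self_left, Nat.mod_eq_of_lt hkb]

open RealRAM

/-! ### Terms -/

/-- The register file that starts with the list `l`. -/
def regs (l : List ℝ) : ℕ → ℝ := fun i => l.getD i 0

theorem regs_zero (x : ℝ) (l : List ℝ) : regs (x :: l) 0 = x := rfl

theorem regs_succ (x : ℝ) (l : List ℝ) (i : ℕ) : regs (x :: l) (i + 1) = regs l i := rfl

theorem update_regs {l : List ℝ} {i : ℕ} (hi : i < l.length) (x : ℝ) :
    Function.update (regs l) i x = regs (l.set i x) := by
  ext j
  by_cases h : j = i
  · subst h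
    simp [regs, List.getD, hi]
  · simp [regs, List.getD, h, Ne.symm h]

/-- `b ^ e` -/
def powT (b e : Term) : Term := .exp (.mul e (.log b))

/-- `a mod b` -/
def modT (a b : Term) : Term := .sub a (.mul b (.floor (.div a b)))

/-- The digit number `e` of `a` in base `b`. -/
def digitT (a b e : Term) : Term := modT (.floor (.div a (powT b e))) b

/-- The base, computed from the capacity in register 1. -/
def baseT : Term := .mul (.add (.reg 1) (.const 2)) (.add (.reg 1) (.const 2))

/-- The total weight of the records up to record `k`, computed from the packed weights in
register 3. -/
def prefixT (k : Term) : Term :=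
  modT (modT (.reg 3) (powT baseT (.add k (.const 1)))) (.sub baseT (.const 1))

/-- The weight of a record with probability `x`. -/
def weightT (x : Term) : Term :=
  .mul (.le (.mul (.const 2) x) (.const 1))
    (.add (.floor (.mul (.mul (.const 2) (.add (.reg 1) (.const 1))) x)) (.const 1))

/-- Whether a record with probability `x` is heavy. -/
def heavyT (x : Term) : Term := .sub (.const 1) (.le (.mul (.const 2) x) (.const 1))

/-- These functions name the values of the terms above, so that programs are evaluated symbolically
before the identities for natural numbers are applied. -/
noncomputable def rpow (b e : ℝ) : ℝ := Real.exp (e * Real.log b)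

noncomputable def rmod (a b : ℝ) : ℝ := a - b * ⌊a / b⌋

noncomputable def rdigit (a b e : ℝ) : ℝ := rmod ⌊a / rpow b e⌋ b

noncomputable def rbase (M : ℝ) : ℝ := (M + 2) * (M + 2)

noncomputable def rprefix (M Q k : ℝ) : ℝ := rmod (rmod Q (rpow (rbase M) (k + 1))) (rbase M - 1)

noncomputable def rweight (M x : ℝ) : ℝ :=
  (if 2 * x ≤ 1 then 1 else 0) * (⌊2 * (M + 1) * x⌋ + 1)

noncomputable def rheavy (x : ℝ) : ℝ := 1 - if 2 * x ≤ 1 then 1 else 0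

theorem value_powT (r : ℕ → ℝ) (b e : Term) :
    (powT b e).value r = rpow (b.value r) (e.value r) := rfl

theorem value_modT (r : ℕ → ℝ) (a b : Term) :
    (modT a b).value r = rmod (a.value r) (b.value r) := rfl

theorem value_digitT (r : ℕ → ℝ) (a b e : Term) :
    (digitT a b e).value r = rdigit (a.value r) (b.value r) (e.value r) := rfl

theorem value_baseT (r : ℕ → ℝ) : baseT.value r = rbase (r 1) := by
  simp [baseT, rbase, Term.value]

theorem value_prefixT (r : ℕ → ℝ) (k : Term) :
    (prefixT k).value r = rprefix (r 1) (r 3) (k.value r) := by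
  simp [prefixT, rprefix, Term.value, value_modT, value_powT, value_baseT]

theorem value_weightT (r : ℕ → ℝ) (x : Term) :
    (weightT x).value r = rweight (r 1) (x.value r) := by
  simp [weightT, rweight, Term.value]

theorem value_heavyT (r : ℕ → ℝ) (x : Term) : (heavyT x).value r = rheavy (x.value r) := by
  simp [heavyT, rheavy, Term.value]

/-- The base for capacity `M`. -/
def base (M : ℕ) : ℕ := (M + 2) * (M + 2)

theorem one_lt_base (M : ℕ) : 1 < base M := by unfold base; nlinarith

theorem add_two_lt_base (M : ℕ) : M + 2 < base M := by unfold base; nlinarith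

theorem floor_natCast_div (a b : ℕ) : ⌊(a : ℝ) / b⌋ = ((a / b : ℕ) : ℤ) := by
  rw [Int.floor_div_natCast]
  simp

theorem rbase_natCast (M : ℕ) : rbase M = (base M : ℕ) := by
  simp [rbase, base]

theorem rpow_natCast {b : ℕ} (hb : 0 < b) (e : ℕ) : rpow b e = (b ^ e : ℕ) := by
  rw [rpow, Real.exp_nat_mul, Real.exp_log (by exact_mod_cast hb)]
  push_cast
  rfl

theorem rmod_natCast (a b : ℕ) : rmod a b = (a % b : ℕ) := by
  rw [rmod, floor_natCast_div, Int.cast_natCast, sub_eq_iff_eq_add]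
  exact_mod_cast (Nat.mod_add_div a b).symm

theorem rdigit_natCast {b : ℕ} (hb : 0 < b) (a e : ℕ) : rdigit a b e = (a / b ^ e % b : ℕ) := by
  rw [rdigit, rpow_natCast hb, floor_natCast_div, Int.cast_natCast, rmod_natCast]

theorem rprefix_natCast (M Q k : ℕ) :
    rprefix M Q k = (Q % base M ^ (k + 1) % (base M - 1) : ℕ) := by
  have h := one_lt_base M
  rw [rprefix, rbase_natCast, show (k : ℝ) + 1 = (k + 1 : ℕ) by push_cast; rfl,
    rpow_natCast (by omega), rmod_natCast,
    show (base M : ℝ) - 1 = (base M - 1 : ℕ) by push_cast [Nat.cast_sub h.le]; rfl, rmod_natCast]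

open Classical in
/-- The weight of a record with probability `x`, when the capacity is `M`. -/
noncomputable def weight (M : ℕ) (x : ℝ) : ℕ :=
  if 2 * x ≤ 1 then ⌊2 * ((M : ℝ) + 1) * x⌋₊ + 1 else 0

open Classical in
/-- `1` if a record with probability `x` is heavy, else `0`. -/
noncomputable def heavy (x : ℝ) : ℕ := if 2 * x ≤ 1 then 0 else 1

theorem rweight_natCast (M : ℕ) {x : ℝ} (hx : 0 ≤ x) : rweight M x = weight M x := by
  unfold rweight weight
  split_ifs
  · push_cast
    rw [one_mul, natCast_floor_eq_intCast_floor (by positivity)]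
  · simp

theorem rheavy_eq (x : ℝ) : rheavy x = heavy x := by
  unfold rheavy heavy
  split_ifs <;> simp

/-- Only light records have slots, and `2 * x ≤ 1` bounds the truncated product by `M + 1`. Hence a
weight fits into one digit of base `base M`. -/
theorem weight_le (M : ℕ) (x : ℝ) : weight M x ≤ M + 2 := by
  unfold weight
  split_ifs with h
  · have : ⌊2 * ((M : ℝ) + 1) * x⌋₊ ≤ M + 1 := by
      refine Nat.floor_le_of_le ?_
      push_cast
      nlinarith [Nat.cast_nonneg (α := ℝ) M]
    omega
  · omega

theorem heavy_le (x : ℝ) : heavy x ≤ 1 := by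
  unfold heavy
  split_ifs <;> omega

/-- The weights `w` and the heaviness `h` of the records up to `M`. -/
structure Weights (M : ℕ) (w h : ℕ → ℕ) : Prop where
  zero : w 0 = 0
  le : ∀ k, w k ≤ M + 2
  heavy_le : ∀ k, h k ≤ 1

namespace Weights

variable {M : ℕ} {w h : ℕ → ℕ}

theorem lt_base (H : Weights M w h) (k : ℕ) : w k < base M :=
  (H.le k).trans_lt (add_two_lt_base M)

/-- As `w 0 = 0`, at most `M` weights count, and their sum `M * (M + 2)` lies below `(M + 2) ^ 2 -
1`. The base is quadratic in `M` so that such sums can be recovered from their residues modulo `base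
M - 1`. -/
theorem start_lt (H : Weights M w h) {k : ℕ} (hk : k ≤ M + 1) : start w k < base M - 1 := by
  have h1 : start w (M + 1) ≤ M * (M + 2) := by
    rw [start, Finset.sum_range_succ', H.zero, add_zero]
    refine (Finset.sum_le_sum fun k _ => H.le (k + 1)).trans ?_
    simp
  have h2 := start_mono w hk
  have h3 : base M = M * (M + 2) + (2 * M + 4) := by unfold base; ring
  omega

theorem prefix_eq (H : Weights M w h) {k : ℕ} (hk : k ≤ M) :
    rprefix M (pack (base M) (M + 1) w) k = start w (k + 1) := by
  rw [rprefix_natCast, pack_mod (fun j _ => H.lt_base j) (by omega),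
    pack_mod_pred (H.start_lt (by omega))]
  rfl

theorem digit_eq (H : Weights M w h) {k : ℕ} (hk : k ≤ M) :
    rdigit (pack (base M) (M + 1) w) (rbase M) k = w k := by
  rw [rbase_natCast, rdigit_natCast (by have := one_lt_base M; omega),
    pack_digit (fun j _ => H.lt_base j) (by omega)]

theorem heavy_digit_eq (H : Weights M w h) {k : ℕ} (hk : k ≤ M) :
    rdigit (pack 2 (M + 1) h) 2 k = h k := by
  have := rdigit_natCast (b := 2) (by omega) (pack 2 (M + 1) h) k
  rw [pack_digit (fun j _ => by have := H.heavy_le j; omega) (by omega)] at this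
  exact_mod_cast this

end Weights

/-! ### Changing the weight of a record -/

/-- Record `k` (register 9) gets the weight in register 10 and the heaviness in register 11. -/
def setWeight : Program :=
  .seq (.assign 13 (digitT (.reg 3) baseT (.reg 9))) <|
  .seq (.assign 12 (.sub (prefixT (.reg 9)) (.reg 13))) <|
  .seq (.assign 4 (.add (modT (.reg 4) (powT baseT (.reg 12)))
    (.mul (powT baseT (.reg 12))
      (.add (.mul (.reg 9) (.div (.sub (powT baseT (.reg 10)) (.const 1)) (.sub baseT (.const 1))))
        (.mul (powT baseT (.reg 10))
          (.floor (.div (.reg 4) (powT baseT (.add (.reg 12) (.reg 13)))))))))) <|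
  .seq (.assign 3 (.add (.reg 3) (.mul (.sub (.reg 10) (.reg 13)) (powT baseT (.reg 9))))) <|
  .assign 5 (.add (.reg 5)
    (.mul (.sub (.reg 11) (digitT (.reg 5) (.const 2) (.reg 9))) (powT (.const 2) (.reg 9))))

theorem splice_eq {M : ℕ} {w : ℕ → ℕ} {k : ℕ} (hk : k ≤ M) (m : ℕ) :
    rmod (slots (base M) (M + 1) w) (rpow (rbase M) (start w k)) +
      rpow (rbase M) (start w k) *
        (k * ((rpow (rbase M) m - 1) / (rbase M - 1)) + rpow (rbase M) m *
          (⌊(slots (base M) (M + 1) w : ℝ) / rpow (rbase M) (start w k + w k)⌋ : ℝ)) =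
      slots (base M) (M + 1) (Function.update w k m) := by
  have hb := one_lt_base M
  rw [slots_update hb (by have := add_two_lt_base M; omega) (by omega), rbase_natCast,
    rpow_natCast (by omega), rpow_natCast (by omega), rmod_natCast,
    show (start w k : ℝ) + w k = (start w k + w k : ℕ) by push_cast; rfl,
    rpow_natCast (by omega), floor_natCast_div, Int.cast_natCast]
  push_cast
  rw [repunit_cast hb]

theorem put_eq {M : ℕ} {w : ℕ → ℕ} {k : ℕ} (hk : k ≤ M) (m : ℕ) :
    (pack (base M) (M + 1) w : ℝ) + ((m : ℝ) - w k) * rpow (rbase M) k =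
      pack (base M) (M + 1) (Function.update w k m) := by
  rw [pack_update w (by omega), rbase_natCast, rpow_natCast (by have := one_lt_base M; omega)]
  push_cast
  rfl

theorem Weights.put_heavy_eq {M : ℕ} {w h : ℕ → ℕ} (H : Weights M w h) {k : ℕ} (hk : k ≤ M)
    (b : ℕ) : (pack 2 (M + 1) h : ℝ) + ((b : ℝ) - rdigit (pack 2 (M + 1) h) 2 k) * rpow 2 k =
      pack 2 (M + 1) (Function.update h k b) := by
  have h2 := rpow_natCast (b := 2) (by omega) k
  rw [pack_update h (by omega), H.heavy_digit_eq hk]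
  push_cast at h2 ⊢
  rw [h2]

/-- The old weight and the start of the run are saved in registers 13 and 12 before the strings in
registers 4 and 3 change. -/
theorem setWeight_effect {M : ℕ} {w h : ℕ → ℕ} (H : Weights M w h) {k : ℕ} (hk : k ≤ M) (m b : ℕ)
    (n D r t7 t8 t12 t13 t14 : ℝ) (mem : ℕ → ℝ) (inp out : List ℝ) (c : ℕ) :
    setWeight.effect ⟨regs [n, M, D, pack (base M) (M + 1) w, slots (base M) (M + 1) w,
      pack 2 (M + 1) h, r, t7, t8, k, m, b, t12, t13, t14], mem, inp, out, c⟩ =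
    ⟨regs [n, M, D, pack (base M) (M + 1) (Function.update w k m),
      slots (base M) (M + 1) (Function.update w k m), pack 2 (M + 1) (Function.update h k b),
      r, t7, t8, k, m, b, start w k, w k, t14], mem, inp, out, c⟩ := by
  have hstart : (start w (k + 1) : ℝ) - w k = start w k := by
    rw [start_succ]; push_cast; ring
  simp only [setWeight, Program.effect, State.setReg, update_regs, List.length_cons,
    List.length_nil, Nat.reduceAdd, Nat.reduceLT, List.set_cons_succ, List.set_cons_zero,
    value_digitT, value_modT, value_powT, value_baseT, value_prefixT, Term.value,
    regs_succ, regs_zero, H.digit_eq hk, H.prefix_eq hk, hstart, Int.cast_one, Int.cast_ofNat,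
    splice_eq hk, put_eq hk, H.put_heavy_eq hk]

theorem setWeight_safe (N : ℕ) (s : State) : setWeight.Safe N s := by
  simp [setWeight, Program.Safe]

theorem setWeight_straight : setWeight.Straight := by
  simp [setWeight, Program.Straight]

/-! ### The memory -/

/-- Memory cells `2 k` and `2 k + 1` hold record number `k` and its probability. -/
noncomputable def memory (key : ℕ → ℕ) (pr : ℕ → ℝ) : ℕ → ℝ :=
  fun a => if a % 2 = 0 then key (a / 2) else pr (a / 2)

theorem memory_key (key : ℕ → ℕ) (pr : ℕ → ℝ) (k : ℕ) : memory key pr (2 * k) = key k := by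
  simp [memory]

theorem memory_prob (key : ℕ → ℕ) (pr : ℕ → ℝ) (k : ℕ) : memory key pr (2 * k + 1) = pr k := by
  have h : (2 * k + 1) / 2 = k := by omega
  simp [memory, h]

theorem update_memory_key (key : ℕ → ℕ) (pr : ℕ → ℝ) (k v : ℕ) :
    Function.update (memory key pr) (2 * k) v = memory (Function.update key k v) pr := by
  ext a
  rcases eq_or_ne a (2 * k) with rfl | ha
  · simp [memory]
  · rw [Function.update_of_ne ha]
    unfold memory
    split_ifs with h
    · rw [Function.update_of_ne (by omega)]
    · rfl

theorem update_memory_prob (key : ℕ → ℕ) (pr : ℕ → ℝ) (k : ℕ) (x : ℝ) :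
    Function.update (memory key pr) (2 * k + 1) x = memory key (Function.update pr k x) := by
  ext a
  rcases eq_or_ne a (2 * k + 1) with rfl | ha
  · rw [Function.update_self, memory_prob, Function.update_self]
  · rw [Function.update_of_ne ha]
    unfold memory
    split_ifs with h
    · rfl
    · rw [Function.update_of_ne (by omega)]

theorem floor_two_mul (k : ℕ) : ⌊(2 : ℝ) * k⌋₊ = 2 * k := by
  rw [show (2 : ℝ) * k = (2 * k : ℕ) by push_cast; rfl, Nat.floor_natCast]

theorem floor_two_mul_add_one (k : ℕ) : ⌊(2 : ℝ) * k + 1⌋₊ = 2 * k + 1 := by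
  rw [show (2 : ℝ) * k + 1 = (2 * k + 1 : ℕ) by push_cast; rfl, Nat.floor_natCast]

/-! ### The programs -/

/-- The cell with record number `k`. -/
def keyCell (k : Term) : Term := .mul (.const 2) k

/-- The cell with the probability of record number `k`. -/
def probCell (k : Term) : Term := .add (.mul (.const 2) k) (.const 1)

/-- Record `k` (register 9) gets the probability in register 8. -/
def setProb : Program :=
  .seq (.store (probCell (.reg 9)) (.reg 8)) <|
  .seq (.assign 10 (weightT (.reg 8))) <|
  .seq (.assign 11 (heavyT (.reg 8))) setWeight

/-- Blank the auxiliary registers. -/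
def clear : Program :=
  .seq (.assign 7 (.const 0)) <| .seq (.assign 8 (.const 0)) <| .seq (.assign 9 (.const 0)) <|
  .seq (.assign 10 (.const 0)) <| .seq (.assign 11 (.const 0)) <| .seq (.assign 12 (.const 0)) <|
  .seq (.assign 13 (.const 0)) (.assign 14 (.const 0))

/-- Put the record in memory after record `k` (register 9) into the dictionary and the strings. -/
def growStep : Program :=
  .seq (.assign 9 (.add (.reg 9) (.const 1))) <|
  .seq (.load 14 (keyCell (.reg 9))) <|
  .seq (.assign 2 (.add (.reg 2) (.mul (.reg 9) (powT baseT (.reg 14))))) <|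
  .seq (.load 14 (probCell (.reg 9))) <|
  .seq (.assign 10 (weightT (.reg 14))) <|
  .seq (.assign 11 (heavyT (.reg 14))) setWeight

/-- The capacity becomes `2 n + 1`. -/
def growStart : Program :=
  .seq (.assign 1 (.add (.mul (.const 2) (.reg 0)) (.const 1))) <|
  .seq (.assign 2 (.const 0)) <| .seq (.assign 3 (.const 0)) <| .seq (.assign 4 (.const 0)) <|
  .seq (.assign 5 (.const 0)) (.assign 9 (.const 0))

/-- The loop that puts all records into the dictionary and the strings. -/
def growLoop : Program := .while (.sub (.reg 0) (.reg 9)) growStep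

/-- Rebuild everything except the memory, with capacity `2 n + 1`. -/
def grow : Program := .seq growStart growLoop

/-- Add the record in register 7 with the probability in register 8, within the capacity. -/
def append : Program :=
  .seq (.assign 0 (.add (.reg 0) (.const 1))) <|
  .seq (.assign 9 (.reg 0)) <|
  .seq (.assign 2 (.add (.reg 2) (.mul (.reg 9) (powT baseT (.reg 7))))) <|
  .seq (.store (keyCell (.reg 9)) (.reg 7)) <|
  .seq setProb clear

def readRecord : Program := .seq (.read 7) (.read 8)

def insertProgram : Program :=
  .seq readRecord <| .seq (.ite (.le (.reg 1) (.reg 0)) grow .skip) append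

def updateProgram : Program :=
  .seq readRecord <| .seq (.assign 9 (digitT (.reg 2) baseT (.reg 7))) <| .seq setProb clear

/-- The last record takes the place of the record that is deleted. -/
def deleteProgram : Program :=
  .seq (.read 7) <|
  .seq (.assign 9 (digitT (.reg 2) baseT (.reg 7))) <|
  .seq (.load 14 (keyCell (.reg 0))) <|
  .seq (.load 8 (probCell (.reg 0))) <|
  .seq (.assign 2 (.sub (.add (.reg 2)
    (.mul (.sub (.reg 9) (.reg 0)) (powT baseT (.reg 14)))) (.mul (.reg 9) (powT baseT (.reg 7))))) <|
  .seq (.store (keyCell (.reg 9)) (.reg 14)) <|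
  .seq setProb <|
  .seq (.assign 9 (.reg 0)) <|
  .seq (.assign 10 (.const 0)) <|
  .seq (.assign 11 (.const 0)) <|
  .seq setWeight <|
  .seq (.store (keyCell (.reg 9)) (.const 0)) <|
  .seq (.store (probCell (.reg 9)) (.const 0)) <|
  .seq (.assign 0 (.sub (.reg 0) (.const 1))) clear

def buildLoop : Program :=
  .while (.reg 6) (.seq insertProgram (.assign 6 (.sub (.reg 6) (.const 1))))

def buildProgram : Program := .seq (.read 6) (.seq buildLoop (.seq grow clear))

theorem setProb_effect {M : ℕ} {w h : ℕ → ℕ} (H : Weights M w h) {k : ℕ} (hk : k ≤ M) {x : ℝ}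
    (hx : 0 ≤ x) (key : ℕ → ℕ) (pr : ℕ → ℝ) (n D r t7 t10 t11 t12 t13 t14 : ℝ)
    (inp out : List ℝ) (c : ℕ) :
    setProb.effect ⟨regs [n, M, D, pack (base M) (M + 1) w, slots (base M) (M + 1) w,
      pack 2 (M + 1) h, r, t7, x, k, t10, t11, t12, t13, t14], memory key pr, inp, out, c⟩ =
    ⟨regs [n, M, D, pack (base M) (M + 1) (Function.update w k (weight M x)),
      slots (base M) (M + 1) (Function.update w k (weight M x)),
      pack 2 (M + 1) (Function.update h k (heavy x)),
      r, t7, x, k, weight M x, heavy x, start w k, w k, t14],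
      memory key (Function.update pr k x), inp, out, c⟩ := by
  simp only [setProb, probCell, Program.effect, State.setReg, update_regs, List.length_cons,
    List.length_nil, Nat.reduceAdd, Nat.reduceLT, List.set_cons_succ, List.set_cons_zero,
    value_weightT, value_heavyT, Term.value, regs_succ, regs_zero, Int.cast_one, Int.cast_ofNat,
    floor_two_mul_add_one, update_memory_prob, rweight_natCast M hx, rheavy_eq,
    setWeight_effect H hk]

theorem setProb_safe {N k : ℕ} (hk : 2 * k + 1 < N) (n M D Q Z H r t7 t8 t10 t11 t12 t13 t14 : ℝ)
    (mem : ℕ → ℝ) (inp out : List ℝ) (c : ℕ) :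
    setProb.Safe N ⟨regs [n, M, D, Q, Z, H, r, t7, t8, k, t10, t11, t12, t13, t14],
      mem, inp, out, c⟩ := by
  simp only [setProb, probCell, Program.Safe, Term.value, regs_succ, regs_zero, Int.cast_one,
    Int.cast_ofNat, floor_two_mul_add_one, hk, setWeight_safe, and_self]

theorem clear_effect (a₀ a₁ a₂ a₃ a₄ a₅ a₆ t7 t8 t9 t10 t11 t12 t13 t14 : ℝ) (mem : ℕ → ℝ)
    (inp out : List ℝ) (c : ℕ) :
    clear.effect ⟨regs [a₀, a₁, a₂, a₃, a₄, a₅, a₆, t7, t8, t9, t10, t11, t12, t13, t14],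
      mem, inp, out, c⟩ =
    ⟨regs [a₀, a₁, a₂, a₃, a₄, a₅, a₆, 0, 0, 0, 0, 0, 0, 0, 0], mem, inp, out, c⟩ := by
  simp only [clear, Program.effect, State.setReg, update_regs, List.length_cons,
    List.length_nil, Nat.reduceAdd, Nat.reduceLT, List.set_cons_succ, List.set_cons_zero,
    Term.value, Int.cast_zero]

theorem clear_safe (N : ℕ) (s : State) : clear.Safe N s := by
  simp [clear, Program.Safe]

theorem clear_straight : clear.Straight := by
  simp [clear, Program.Straight]

theorem setProb_straight : setProb.Straight := by
  simp [setProb, Program.Straight, setWeight_straight]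

/-! ### The machine state for a table of records -/

/-- The weights of the records `1, …, n`. -/
noncomputable def weights (M n : ℕ) (pr : ℕ → ℝ) : ℕ → ℕ :=
  fun k => if 1 ≤ k ∧ k ≤ n then weight M (pr k) else 0

/-- The heaviness of the records `1, …, n`. -/
noncomputable def heavies (n : ℕ) (pr : ℕ → ℝ) : ℕ → ℕ :=
  fun k => if 1 ≤ k ∧ k ≤ n then heavy (pr k) else 0

theorem weights_spec (M n : ℕ) (pr : ℕ → ℝ) : Weights M (weights M n pr) (heavies n pr) where
  zero := by simp [weights]
  le k := by
    unfold weights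
    split_ifs
    · exact weight_le _ _
    · omega
  heavy_le k := by
    unfold heavies
    split_ifs
    · exact heavy_le _
    · omega

theorem update_weights {M n k : ℕ} (hk : 1 ≤ k) (hkn : k ≤ n) (pr : ℕ → ℝ) (x : ℝ) :
    Function.update (weights M n pr) k (weight M x) = weights M n (Function.update pr k x) := by
  ext j
  rcases eq_or_ne j k with rfl | hj
  · simp [weights, hk, hkn]
  · simp [weights, hj]

theorem update_heavies {n k : ℕ} (hk : 1 ≤ k) (hkn : k ≤ n) (pr : ℕ → ℝ) (x : ℝ) :
    Function.update (heavies n pr) k (heavy x) = heavies n (Function.update pr k x) := by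
  ext j
  rcases eq_or_ne j k with rfl | hj
  · simp [heavies, hk, hkn]
  · simp [heavies, hj]

theorem weights_succ (M n : ℕ) (pr : ℕ → ℝ) (x : ℝ) :
    Function.update (weights M n pr) (n + 1) (weight M x) =
      weights M (n + 1) (Function.update pr (n + 1) x) := by
  ext j
  rcases eq_or_ne j (n + 1) with rfl | hj
  · simp [weights]
  · have : j ≤ n + 1 ↔ j ≤ n := by omega
    simp [weights, hj, this]

theorem heavies_succ (n : ℕ) (pr : ℕ → ℝ) (x : ℝ) :
    Function.update (heavies n pr) (n + 1) (heavy x) =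
      heavies (n + 1) (Function.update pr (n + 1) x) := by
  ext j
  rcases eq_or_ne j (n + 1) with rfl | hj
  · simp [heavies]
  · have : j ≤ n + 1 ↔ j ≤ n := by omega
    simp [heavies, hj, this]

/-- Position `n + 1` no longer counts; `x` is there only to match what a deletion leaves in memory.
-/
theorem weights_pred (M n : ℕ) (pr : ℕ → ℝ) (x : ℝ) :
    Function.update (weights M (n + 1) pr) (n + 1) 0 =
      weights M n (Function.update pr (n + 1) x) := by
  ext j
  rcases eq_or_ne j (n + 1) with rfl | hj
  · simp [weights]
  · have : j ≤ n + 1 ↔ j ≤ n := by omega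
    simp [weights, hj, this]

theorem heavies_pred (n : ℕ) (pr : ℕ → ℝ) (x : ℝ) :
    Function.update (heavies (n + 1) pr) (n + 1) 0 =
      heavies n (Function.update pr (n + 1) x) := by
  ext j
  rcases eq_or_ne j (n + 1) with rfl | hj
  · simp [heavies]
  · have : j ≤ n + 1 ↔ j ≤ n := by omega
    simp [heavies, hj, this]

/-- The state for `n` records in memory, of which the first `i` have been put into the dictionary
and the strings, with capacity `M`. -/
noncomputable def stage (M n i : ℕ) (key : ℕ → ℕ) (pr : ℕ → ℝ)
    (r t7 t8 t9 t10 t11 t12 t13 t14 : ℝ) (inp out : List ℝ) (c : ℕ) : State :=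
  ⟨regs [n, M, dict (base M) i key, pack (base M) (M + 1) (weights M i pr),
    slots (base M) (M + 1) (weights M i pr), pack 2 (M + 1) (heavies i pr),
    r, t7, t8, t9, t10, t11, t12, t13, t14], memory key pr, inp, out, c⟩

theorem stage_tick (M n i : ℕ) (key : ℕ → ℕ) (pr : ℕ → ℝ)
    (r t7 t8 t9 t10 t11 t12 t13 t14 : ℝ) (inp out : List ℝ) (c m : ℕ) :
    (stage M n i key pr r t7 t8 t9 t10 t11 t12 t13 t14 inp out c).tick m =
      stage M n i key pr r t7 t8 t9 t10 t11 t12 t13 t14 inp out (c + m) := rfl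

/-- The state for `n` records, with blank auxiliary registers. -/
noncomputable def machine (M n : ℕ) (key : ℕ → ℕ) (pr : ℕ → ℝ) (r : ℝ) (inp out : List ℝ) (c : ℕ) :
    State :=
  stage M n n key pr r 0 0 0 0 0 0 0 0 inp out c

/-- Valid contents of the memory for capacity `M`. -/
structure Table (M n : ℕ) (key : ℕ → ℕ) (pr : ℕ → ℝ) : Prop where
  le : n ≤ M
  inj : Set.InjOn key (Finset.Icc 1 n)
  prob : ∀ k, pr k ∈ Set.Icc (0 : ℝ) 1
  key_zero : ∀ k, n < k → key k = 0
  prob_zero : ∀ k, n < k → pr k = 0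

/-- Cells `0` and `1` belong to no record, hence `2 * n + 2`. The capacity does not enter, so a
large `M` left behind by deletions costs no space. -/
theorem Table.blank {M n : ℕ} {key : ℕ → ℕ} {pr : ℕ → ℝ} (T : Table M n key pr) {N : ℕ}
    (hN : 2 * n + 2 ≤ N) : Blank N (memory key pr) := by
  intro a ha
  have h : n < a / 2 := by omega
  simp [memory, T.key_zero _ h, T.prob_zero _ h]

theorem Table.dict_digit {M n : ℕ} {key : ℕ → ℕ} {pr : ℕ → ℝ} (T : Table M n key pr) {k : ℕ}
    (hk : k ∈ Finset.Icc 1 n) : rdigit (dict (base M) n key) (rbase M) (key k) = k := by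
  have h1 := add_two_lt_base M
  have h2 := T.le
  rw [rbase_natCast, rdigit_natCast (by omega), SubsetSampling.dict_digit T.inj (by omega) hk]

theorem dict_put (M n : ℕ) (key : ℕ → ℕ) (v : ℕ) :
    (dict (base M) n key : ℝ) + (n + 1 : ℕ) * rpow (rbase M) v =
      dict (base M) (n + 1) (Function.update key (n + 1) v) := by
  have h : ∑ k ∈ Finset.Icc 1 n, k * base M ^ Function.update key (n + 1) v k =
      ∑ k ∈ Finset.Icc 1 n, k * base M ^ key k :=
    Finset.sum_congr rfl fun k hk => by
      rw [Function.update_of_ne (by have := (Finset.mem_Icc.1 hk).2; omega)]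
  rw [rbase_natCast, rpow_natCast (by have := one_lt_base M; omega), dict, dict,
    Finset.sum_Icc_succ_top (by omega), h, Function.update_self]
  push_cast
  rfl

theorem dict_congr {b n : ℕ} {key key' : ℕ → ℕ} (h : ∀ k ∈ Finset.Icc 1 n, key k = key' k) :
    dict b n key = dict b n key' :=
  Finset.sum_congr rfl fun k hk => by rw [h k hk]

/-- The first correction relabels the last record from `n + 1` to `k`, the second one erases the
digit at the deleted key. For `k = n + 1` the first correction vanishes, so the program needs no
case distinction. -/
theorem dict_remove (M n : ℕ) (key : ℕ → ℕ) {k : ℕ} (hk : k ∈ Finset.Icc 1 (n + 1)) (v : ℕ) :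
    (dict (base M) (n + 1) key : ℝ) +
      ((k : ℝ) - (n + 1 : ℕ)) * rpow (rbase M) (key (n + 1)) - k * rpow (rbase M) (key k) =
    dict (base M) n (Function.update (Function.update key k (key (n + 1))) (n + 1) v) := by
  have hb : 0 < base M := by have := one_lt_base M; omega
  rw [dict_congr (n := n) (key := Function.update (Function.update key k (key (n + 1))) (n + 1) v)
    (key' := Function.update key k (key (n + 1)))
    fun j hj => Function.update_of_ne (by have := (Finset.mem_Icc.1 hj).2; omega) _ _]
  rw [rbase_natCast, rpow_natCast hb, rpow_natCast hb, dict, dict,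
    Finset.sum_Icc_succ_top (by omega)]
  rw [Finset.mem_Icc] at hk
  rcases eq_or_ne k (n + 1) with rfl | hne
  · have h : ∑ j ∈ Finset.Icc 1 n, j * base M ^ Function.update key (n + 1) (key (n + 1)) j =
        ∑ j ∈ Finset.Icc 1 n, j * base M ^ key j := by rw [Function.update_eq_self]
    rw [h]
    push_cast
    ring
  · have hmem : k ∈ Finset.Icc 1 n := Finset.mem_Icc.2 (by omega)
    have h : ∑ j ∈ (Finset.Icc 1 n).erase k, j * base M ^ Function.update key k (key (n + 1)) j =
        ∑ j ∈ (Finset.Icc 1 n).erase k, j * base M ^ key j :=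
      Finset.sum_congr rfl fun j hj => by rw [Function.update_of_ne (Finset.ne_of_mem_erase hj)]
    rw [← Finset.add_sum_erase _ _ hmem, ← Finset.add_sum_erase _ (fun j => j * base M ^ _) hmem,
      h, Function.update_self]
    push_cast
    ring

theorem Table.update {M n : ℕ} {key : ℕ → ℕ} {pr : ℕ → ℝ} (T : Table M n key pr) {k : ℕ}
    (hk : k ≤ n) {x : ℝ} (hx : x ∈ Set.Icc (0 : ℝ) 1) :
    Table M n key (Function.update pr k x) where
  le := T.le
  inj := T.inj
  prob j := by
    rcases eq_or_ne j k with rfl | hj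
    · simpa using hx
    · rw [Function.update_of_ne hj]; exact T.prob j
  key_zero := T.key_zero
  prob_zero j hj := by rw [Function.update_of_ne (by omega)]; exact T.prob_zero j hj

/-! ### Update -/

theorem updateProgram_reaches {M n : ℕ} {key : ℕ → ℕ} {pr : ℕ → ℝ} (T : Table M n key pr) {k : ℕ}
    (hk : k ∈ Finset.Icc 1 n) {x : ℝ} (hx : x ∈ Set.Icc (0 : ℝ) 1) {N : ℕ} (hN : 2 * n + 2 ≤ N)
    (K : List Program) (r : ℝ) (inp out : List ℝ) (c : ℕ) :
    Reaches N (updateProgram :: K, machine M n key pr r ((key k : ℝ) :: x :: inp) out c)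
      (K, machine M n key (Function.update pr k x) r inp out (c + updateProgram.cost)) := by
  have hk' := Finset.mem_Icc.1 hk
  have hkM : k ≤ M := hk'.2.trans T.le
  refine ⟨updateProgram.length, ?_⟩
  have h := updateProgram.reduces (N := N)
    (by simp [updateProgram, readRecord, Program.Straight, setProb_straight, clear_straight]) K
    (machine M n key pr r ((key k : ℝ) :: x :: inp) out c) ?_ (T.blank hN)
  · convert h using 2
    rw [machine, ← stage_tick]
    congr 1
    simp only [updateProgram, readRecord, machine, stage, Program.effect, State.setReg, update_regs,
      List.length_cons, List.length_nil, Nat.reduceAdd, Nat.reduceLT, List.set_cons_succ,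
      List.set_cons_zero, value_digitT, value_baseT, Term.value, regs_succ, regs_zero,
      List.headD_cons, List.tail_cons, T.dict_digit hk,
      setProb_effect (weights_spec M n pr) hkM hx.1, clear_effect, update_weights hk'.1 hk'.2,
      update_heavies hk'.1 hk'.2]
  · simp only [updateProgram, readRecord, machine, stage, Program.effect, State.setReg, update_regs,
      List.length_cons, List.length_nil, Nat.reduceAdd, Nat.reduceLT, List.set_cons_succ,
      List.set_cons_zero, value_digitT, value_baseT, Term.value, regs_succ, regs_zero,
      List.headD_cons, List.tail_cons, T.dict_digit hk, Program.Safe, clear_safe,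
      setProb_safe (show 2 * k + 1 < N by omega), and_self]

/-! ### Growing -/

theorem whileTrue_reaches {N : ℕ} {e : Term} {b : Program} {K : List Program} {s : State}
    (hb : Blank N s.mem) (he : e.value s.reg ≠ 0) :
    Reaches N (.while e b :: K, s) (b :: .while e b :: K, s.tick (1 + e.cost)) :=
  .single hb fun _ => by simp [step, he]

theorem whileFalse_reaches {N : ℕ} {e : Term} {b : Program} {K : List Program} {s : State}
    (hb : Blank N s.mem) (he : e.value s.reg = 0) :
    Reaches N (.while e b :: K, s) (K, s.tick (1 + e.cost)) :=
  .single hb fun _ => by simp [step, he]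

theorem seq_reaches {N : ℕ} {a b : Program} {K : List Program} {s : State}
    (hb : Blank N s.mem) : Reaches N (.seq a b :: K, s) (a :: b :: K, s.tick 1) :=
  .single hb fun _ => rfl

theorem Program.reaches {N : ℕ} (a : Program) (ha : a.Straight) (K : List Program) {s s' : State}
    (hs : a.Safe N s) (hb : Blank N s.mem) (h : (a.effect s).tick a.cost = s') :
    Reaches N (a :: K, s) (K, s') := ⟨_, h ▸ a.reduces ha K s hs hb⟩

/-- The contents of the auxiliary registers 10 to 14 are left existential, because the code that
follows overwrites or clears them. -/
theorem growStep_effect {M n i : ℕ} (key : ℕ → ℕ) {pr : ℕ → ℝ} (hi : i < M)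
    (hpr : 0 ≤ pr (i + 1)) (r t7 t8 t10 t11 t12 t13 t14 : ℝ) (inp out : List ℝ) (c : ℕ) :
    ∃ u10 u11 u12 u13 u14 : ℝ,
      growStep.effect (stage M n i key pr r t7 t8 i t10 t11 t12 t13 t14 inp out c) =
        stage M n (i + 1) key pr r t7 t8 (i + 1 : ℕ) u10 u11 u12 u13 u14 inp out c := by
  have h1 := weights_succ M i pr (pr (i + 1))
  have h2 := heavies_succ i pr (pr (i + 1))
  have h3 := dict_put M i key (key (i + 1))
  -- The record is already in memory, so the updates by its own key and probability change nothing.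
  rw [Function.update_eq_self] at h1 h2 h3
  simp only [growStep, keyCell, probCell, stage, Program.effect, State.setReg, update_regs,
    List.length_cons, List.length_nil, Nat.reduceAdd, Nat.reduceLT, List.set_cons_succ,
    List.set_cons_zero, value_powT, value_baseT, value_weightT, value_heavyT, Term.value, regs_succ,
    regs_zero, Int.cast_one, Int.cast_ofNat, ← Nat.cast_add_one, floor_two_mul, floor_two_mul_add_one,
    memory_key, memory_prob, h3, rweight_natCast M hpr, rheavy_eq,
    setWeight_effect (weights_spec M i pr) (show i + 1 ≤ M from hi), h1, h2]
  exact ⟨_, _, _, _, _, rfl⟩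

/-- The time of `grow` apart from its loop. -/
def growBaseCost : ℕ := 2 + growStart.cost + (Term.sub (.reg 0) (.reg 9)).cost

/-- The time of one round of the loop of `grow`. -/
def growStepCost : ℕ := 1 + growStep.cost + (Term.sub (.reg 0) (.reg 9)).cost

theorem growLoop_reaches {M n : ℕ} {key : ℕ → ℕ} {pr : ℕ → ℝ} (T : Table M n key pr) {N : ℕ}
    (hN : 2 * n + 2 ≤ N) (K : List Program) (r t7 t8 : ℝ) (inp out : List ℝ) (d : ℕ) :
    ∀ (i c : ℕ) (t10 t11 t12 t13 t14 : ℝ), i + d = n → ∃ t9 u10 u11 u12 u13 u14 : ℝ,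
      Reaches N (growLoop :: K, stage M n i key pr r t7 t8 i t10 t11 t12 t13 t14 inp out c)
        (K, stage M n n key pr r t7 t8 t9 u10 u11 u12 u13 u14 inp out
          (c + growStepCost * d + (1 + (Term.sub (.reg 0) (.reg 9)).cost))) := by
  induction d with
  | zero =>
    rintro i c t10 t11 t12 t13 t14 rfl
    refine ⟨i, t10, t11, t12, t13, t14, whileFalse_reaches (T.blank hN) ?_⟩
    simp [Term.value, stage, regs]
  | succ d ih =>
    rintro i c t10 t11 t12 t13 t14 hi
    have hM := T.le
    obtain ⟨u10, u11, u12, u13, u14, h⟩ := growStep_effect (n := n) key (show i < M by omega)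
      (T.prob (i + 1)).1 r t7 t8 t10 t11 t12 t13 t14 inp out
      (c + (1 + (Term.sub (.reg 0) (.reg 9)).cost))
    obtain ⟨t9, v10, v11, v12, v13, v14, h'⟩ := ih (i + 1)
      (c + (1 + (Term.sub (.reg 0) (.reg 9)).cost) + growStep.cost) u10 u11 u12 u13 u14 (by omega)
    refine ⟨t9, v10, v11, v12, v13, v14, ?_⟩
    have h1 : Reaches N
        (growLoop :: K, stage M n i key pr r t7 t8 i t10 t11 t12 t13 t14 inp out c)
        (growStep :: growLoop :: K, stage M n i key pr r t7 t8 i t10 t11 t12 t13 t14 inp out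
          (c + (1 + (Term.sub (.reg 0) (.reg 9)).cost))) := by
      refine whileTrue_reaches (T.blank hN) ?_
      have : (n : ℝ) - i ≠ 0 := sub_ne_zero.2 (by exact_mod_cast (by omega : n ≠ i))
      simpa [Term.value, stage, regs] using this
    have h2 := Program.reaches (N := N) growStep
      (by simp [growStep, Program.Straight, setWeight_straight]) (growLoop :: K)
      (by simp [growStep, Program.Safe, setWeight_safe]) (T.blank hN)
      (by rw [h, stage_tick])
    have h3 := (h1.trans h2).trans h'
    convert h3 using 3
    unfold growStepCost
    ring

theorem grow_reaches {M n : ℕ} {key : ℕ → ℕ} {pr : ℕ → ℝ} (T : Table M n key pr) {N : ℕ}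
    (hN : 2 * n + 2 ≤ N) (K : List Program) (r t7 t8 t9 t10 t11 t12 t13 t14 : ℝ)
    (inp out : List ℝ) (c : ℕ) : ∃ u9 u10 u11 u12 u13 u14 : ℝ,
      Reaches N (grow :: K, stage M n n key pr r t7 t8 t9 t10 t11 t12 t13 t14 inp out c)
        (K, stage (2 * n + 1) n n key pr r t7 t8 u9 u10 u11 u12 u13 u14 inp out
          (c + growStepCost * n + growBaseCost)) := by
  have T' : Table (2 * n + 1) n key pr := ⟨by omega, T.inj, T.prob, T.key_zero, T.prob_zero⟩
  have hw : weights (2 * n + 1) 0 pr = fun _ => 0 := by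
    ext k; unfold weights; rw [if_neg (by omega)]
  have hh : heavies 0 pr = fun _ => 0 := by
    ext k; unfold heavies; rw [if_neg (by omega)]
  have hd : dict (base (2 * n + 1)) 0 key = 0 := by simp [dict]
  have hp : ∀ b K, pack b K (fun _ => 0) = 0 := fun b K => by simp [pack]
  have hs : ∀ b K, slots b K (fun _ => 0) = 0 := fun b K => by simp [slots, repunit]
  have heff : growStart.effect (stage M n n key pr r t7 t8 t9 t10 t11 t12 t13 t14 inp out
      (c + 1)) = stage (2 * n + 1) n 0 key pr r t7 t8 (0 : ℕ) t10 t11 t12 t13 t14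
        inp out (c + 1) := by
    simp only [growStart, stage, Program.effect, State.setReg, update_regs, List.length_cons,
      List.length_nil, Nat.reduceAdd, Nat.reduceLT, List.set_cons_succ, List.set_cons_zero,
      Term.value, regs_zero, hw, hh, hd, hp, hs, Int.cast_zero, Int.cast_one,
      Int.cast_ofNat, Nat.cast_zero, Nat.cast_add, Nat.cast_mul, Nat.cast_ofNat, Nat.cast_one]
  have h0 : Reaches N (grow :: K, stage M n n key pr r t7 t8 t9 t10 t11 t12 t13 t14 inp out c)
      (growStart :: growLoop :: K,
        stage M n n key pr r t7 t8 t9 t10 t11 t12 t13 t14 inp out (c + 1)) :=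
    seq_reaches (T.blank hN)
  have h1 : Reaches N (growStart :: growLoop :: K,
        stage M n n key pr r t7 t8 t9 t10 t11 t12 t13 t14 inp out (c + 1))
      (growLoop :: K, stage (2 * n + 1) n 0 key pr r t7 t8 (0 : ℕ) t10 t11 t12 t13 t14
        inp out (c + 1 + growStart.cost)) :=
    Program.reaches growStart (by simp [growStart, Program.Straight]) (growLoop :: K)
      (by simp [growStart, Program.Safe]) (T.blank hN) (by rw [heff, stage_tick])
  obtain ⟨u9, u10, u11, u12, u13, u14, h2⟩ := growLoop_reaches T' hN K r t7 t8 inp out n 0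
    (c + 1 + growStart.cost) t10 t11 t12 t13 t14 (by omega)
  refine ⟨u9, u10, u11, u12, u13, u14, ?_⟩
  have h3 := (h0.trans h1).trans h2
  convert h3 using 3
  unfold growBaseCost
  ring

/-! ### Insertion -/

theorem Table.insert {M n : ℕ} {key : ℕ → ℕ} {pr : ℕ → ℝ} (T : Table M n key pr) (hM : n < M)
    {v : ℕ} (hv : ∀ k ∈ Finset.Icc 1 n, key k ≠ v) {x : ℝ} (hx : x ∈ Set.Icc (0 : ℝ) 1) :
    Table M (n + 1) (Function.update key (n + 1) v) (Function.update pr (n + 1) x) where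
  le := hM
  inj := by
    intro i hi j hj hij
    simp only [Finset.coe_Icc, Set.mem_Icc] at hi hj
    rcases eq_or_ne i (n + 1) with rfl | hi' <;> rcases eq_or_ne j (n + 1) with rfl | hj'
    · rfl
    · rw [Function.update_self, Function.update_of_ne hj'] at hij
      exact absurd hij.symm (hv j (Finset.mem_Icc.2 (by omega)))
    · rw [Function.update_self, Function.update_of_ne hi'] at hij
      exact absurd hij (hv i (Finset.mem_Icc.2 (by omega)))
    · rw [Function.update_of_ne hi', Function.update_of_ne hj'] at hij
      exact T.inj (by simp; omega) (by simp; omega) hij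
  prob j := by
    rcases eq_or_ne j (n + 1) with rfl | hj
    · simpa using hx
    · rw [Function.update_of_ne hj]; exact T.prob j
  key_zero j hj := by rw [Function.update_of_ne (by omega)]; exact T.key_zero j (by omega)
  prob_zero j hj := by rw [Function.update_of_ne (by omega)]; exact T.prob_zero j (by omega)

theorem append_reaches {M n : ℕ} {key : ℕ → ℕ} {pr : ℕ → ℝ} (T : Table M n key pr) (hM : n < M)
    (v : ℕ) {x : ℝ} (hx : x ∈ Set.Icc (0 : ℝ) 1) {N : ℕ} (hN : 2 * (n + 1) + 2 ≤ N)
    (K : List Program) (r t9 t10 t11 t12 t13 t14 : ℝ) (inp out : List ℝ) (c : ℕ) :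
    Reaches N (append :: K, stage M n n key pr r v x t9 t10 t11 t12 t13 t14 inp out c)
      (K, machine M (n + 1) (Function.update key (n + 1) v) (Function.update pr (n + 1) x) r inp out
        (c + append.cost)) := by
  have hsimp : (append.effect (stage M n n key pr r v x t9 t10 t11 t12 t13 t14 inp out c)) =
      machine M (n + 1) (Function.update key (n + 1) v) (Function.update pr (n + 1) x) r
        inp out c := by
    simp only [append, keyCell, machine, stage, Program.effect, State.setReg, update_regs,
      List.length_cons, List.length_nil, Nat.reduceAdd, Nat.reduceLT, List.set_cons_succ,
      List.set_cons_zero, value_powT, value_baseT, Term.value, regs_succ, regs_zero,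
      Int.cast_one, Int.cast_ofNat, ← Nat.cast_add_one, floor_two_mul, update_memory_key, dict_put,
      setProb_effect (weights_spec M n pr) (show n + 1 ≤ M from hM) hx.1, weights_succ,
      heavies_succ, clear_effect]
  refine Program.reaches append (by simp [append, Program.Straight, setProb_straight,
    clear_straight]) K ?_ (T.blank (by omega)) (by rw [hsimp]; rfl)
  simp only [append, keyCell, stage, Program.effect, State.setReg, update_regs,
    List.length_cons, List.length_nil, Nat.reduceAdd, Nat.reduceLT, List.set_cons_succ,
    List.set_cons_zero, value_powT, value_baseT, Term.value, regs_succ, regs_zero,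
    Int.cast_one, Int.cast_ofNat, ← Nat.cast_add_one, floor_two_mul, Program.Safe, clear_safe,
    setProb_safe (show 2 * (n + 1) + 1 < N by omega), show 2 * (n + 1) < N by omega, and_self]

/-- The time of an insertion apart from the loop of `grow`. -/
def insertCost : ℕ :=
  4 + readRecord.cost + (Term.le (.reg 1) (.reg 0)).cost + growBaseCost + append.cost

/-- The potential is `growStepCost * (2 * n - M)`, with truncated subtraction. Without a rebuild it
rises by at most `2 * growStepCost`. A rebuild occurs only if `n = M`; then the potential is
`growStepCost * n`, which pays for the loop, and with the capacity `2 * n + 1` a single unit of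
`growStepCost` remains after the insertion. -/
theorem insertProgram_reaches {M n : ℕ} {key : ℕ → ℕ} {pr : ℕ → ℝ} (T : Table M n key pr)
    {v : ℕ} (hv : ∀ k ∈ Finset.Icc 1 n, key k ≠ v) {x : ℝ} (hx : x ∈ Set.Icc (0 : ℝ) 1)
    {N : ℕ} (hN : 2 * (n + 1) + 2 ≤ N) (K : List Program) (r : ℝ) (inp out : List ℝ) (c : ℕ) :
    ∃ M' t, Table M' (n + 1) (Function.update key (n + 1) v) (Function.update pr (n + 1) x) ∧
      t + growStepCost * (2 * (n + 1) - M') ≤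
        insertCost + 2 * growStepCost + growStepCost * (2 * n - M) ∧
      Reaches N (insertProgram :: K, machine M n key pr r ((v : ℝ) :: x :: inp) out c)
        (K, machine M' (n + 1) (Function.update key (n + 1) v) (Function.update pr (n + 1) x) r
          inp out (c + t)) := by
  have hb := T.blank (show 2 * n + 2 ≤ N by omega)
  have h1 : ∀ K' c', Reaches N (readRecord :: K', machine M n key pr r ((v : ℝ) :: x :: inp) out c')
      (K', stage M n n key pr r v x 0 0 0 0 0 0 inp out (c' + readRecord.cost)) := fun K' c' =>
    Program.reaches readRecord (by simp [readRecord, Program.Straight]) K'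
      (by simp [readRecord, Program.Safe]) hb (by
        rw [← stage_tick]
        congr 1
        simp only [readRecord, machine, stage, Program.effect, State.setReg, update_regs,
          List.length_cons, List.length_nil, Nat.reduceAdd, Nat.reduceLT, List.set_cons_succ,
          List.set_cons_zero, List.headD_cons, List.tail_cons])
  have h2 : Reaches N (insertProgram :: K, machine M n key pr r ((v : ℝ) :: x :: inp) out c)
      (.ite (.le (.reg 1) (.reg 0)) grow .skip :: append :: K,
        stage M n n key pr r v x 0 0 0 0 0 0 inp out (c + 1 + readRecord.cost + 1)) :=
    ((seq_reaches hb).trans (h1 _ (c + 1))).trans (seq_reaches hb)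
  have hval : (Term.le (.reg 1) (.reg 0)).value
      (stage M n n key pr r v x 0 0 0 0 0 0 inp out (c + 1 + readRecord.cost + 1)).reg =
      if (M : ℝ) ≤ n then 1 else 0 := by
    simp [Term.value, stage, regs]
  rcases lt_or_ge n M with hM | hM
  · have hval0 : ¬ (M : ℝ) ≤ n := by exact_mod_cast not_le.2 hM
    rw [if_neg hval0] at hval
    have h3 : Reaches N (.ite (.le (.reg 1) (.reg 0)) grow .skip :: append :: K,
        stage M n n key pr r v x 0 0 0 0 0 0 inp out (c + 1 + readRecord.cost + 1))
        (append :: K, stage M n n key pr r v x 0 0 0 0 0 0 inp out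
          (c + 1 + readRecord.cost + 1 + (1 + (Term.le (.reg 1) (.reg 0)).cost) + 1)) := by
      refine Reaches.trans (c' := (.skip :: append :: K,
        stage M n n key pr r v x 0 0 0 0 0 0 inp out
          (c + 1 + readRecord.cost + 1 + (1 + (Term.le (.reg 1) (.reg 0)).cost))))
        (.single hb fun _ => ?_) (.single hb fun _ => rfl)
      simp only [step, hval, ne_eq, not_true_eq_false, if_false]
      rfl
    have h4 := (h2.trans h3).trans (append_reaches T hM v hx hN K r 0 0 0 0 0 0 inp out _)
    refine ⟨M, 4 + readRecord.cost + (Term.le (.reg 1) (.reg 0)).cost + append.cost,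
      T.insert hM hv hx, ?_, ?_⟩
    · have : growStepCost * (2 * (n + 1) - M) ≤ growStepCost * ((2 * n - M) + 2) :=
        Nat.mul_le_mul_left _ (by omega)
      rw [show growStepCost * ((2 * n - M) + 2) =
        growStepCost * (2 * n - M) + 2 * growStepCost by ring] at this
      unfold insertCost
      omega
    · convert h4 using 3
      ring
  · have hnM : n = M := le_antisymm T.le hM
    have hval1 : (M : ℝ) ≤ n := by exact_mod_cast hM
    rw [if_pos hval1] at hval
    have T' : Table (2 * n + 1) n key pr := ⟨by omega, T.inj, T.prob, T.key_zero, T.prob_zero⟩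
    have h3 : Reaches N (.ite (.le (.reg 1) (.reg 0)) grow .skip :: append :: K,
        stage M n n key pr r v x 0 0 0 0 0 0 inp out (c + 1 + readRecord.cost + 1))
        (grow :: append :: K, stage M n n key pr r v x 0 0 0 0 0 0 inp out
          (c + 1 + readRecord.cost + 1 + (1 + (Term.le (.reg 1) (.reg 0)).cost))) := by
      refine .single hb fun _ => ?_
      simp only [step, hval, ne_eq, one_ne_zero, not_false_eq_true, if_true]
      rfl
    obtain ⟨u9, u10, u11, u12, u13, u14, hg⟩ := grow_reaches T (show 2 * n + 2 ≤ N by omega)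
      (append :: K) r v x 0 0 0 0 0 0 inp out
      (c + 1 + readRecord.cost + 1 + (1 + (Term.le (.reg 1) (.reg 0)).cost))
    have h4 := ((h2.trans h3).trans hg).trans
      (append_reaches T' (by omega) v hx hN K r u9 u10 u11 u12 u13 u14 inp out _)
    refine ⟨2 * n + 1, 3 + readRecord.cost + (Term.le (.reg 1) (.reg 0)).cost +
      growStepCost * n + growBaseCost + append.cost, T'.insert (by omega) hv hx, ?_, ?_⟩
    · rw [show 2 * (n + 1) - (2 * n + 1) = 1 by omega, show 2 * n - M = n by omega]
      unfold insertCost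
      omega
    · convert h4 using 3
      ring

/-! ### Deletion -/

theorem Table.delete {M n : ℕ} {key : ℕ → ℕ} {pr : ℕ → ℝ} (T : Table M (n + 1) key pr) {k : ℕ}
    (hk : k ∈ Finset.Icc 1 (n + 1)) :
    Table M n (Function.update (Function.update key k (key (n + 1))) (n + 1) 0)
      (Function.update (Function.update pr k (pr (n + 1))) (n + 1) 0) where
  le := by have := T.le; omega
  inj := by
    have hn : n + 1 ∈ (Finset.Icc 1 (n + 1) : Finset ℕ) := by simp
    intro i hi j hj hij
    simp only [Finset.coe_Icc, Set.mem_Icc] at hi hj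
    rw [Function.update_of_ne (show i ≠ n + 1 by omega),
      Function.update_of_ne (show j ≠ n + 1 by omega)] at hij
    have hi' : i ∈ (Finset.Icc 1 (n + 1) : Finset ℕ) := by simp; omega
    have hj' : j ∈ (Finset.Icc 1 (n + 1) : Finset ℕ) := by simp; omega
    rcases eq_or_ne i k with hik | hik <;> rcases eq_or_ne j k with hjk | hjk
    · omega
    · rw [hik, Function.update_self, Function.update_of_ne hjk] at hij
      have := T.inj hn hj' hij
      omega
    · rw [hjk, Function.update_self, Function.update_of_ne hik] at hij
      have := T.inj hi' hn hij
      omega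
    · rw [Function.update_of_ne hik, Function.update_of_ne hjk] at hij
      exact T.inj hi' hj' hij
  prob j := by
    rcases eq_or_ne j (n + 1) with rfl | hj
    · simp
    rw [Function.update_of_ne hj]
    rcases eq_or_ne j k with rfl | hj
    · simpa using T.prob _
    · rw [Function.update_of_ne hj]; exact T.prob j
  key_zero j hj := by
    rcases eq_or_ne j (n + 1) with rfl | hj'
    · simp
    · rw [Finset.mem_Icc] at hk
      rw [Function.update_of_ne hj', Function.update_of_ne (by omega)]
      exact T.key_zero j (by omega)
  prob_zero j hj := by
    rcases eq_or_ne j (n + 1) with rfl | hj'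
    · simp
    · rw [Finset.mem_Icc] at hk
      rw [Function.update_of_ne hj', Function.update_of_ne (by omega)]
      exact T.prob_zero j (by omega)

theorem setWeight_effect_zero {M : ℕ} {w h : ℕ → ℕ} (H : Weights M w h) {k : ℕ} (hk : k ≤ M)
    (n D r t7 t8 t12 t13 t14 : ℝ) (mem : ℕ → ℝ) (inp out : List ℝ) (c : ℕ) :
    setWeight.effect ⟨regs [n, M, D, pack (base M) (M + 1) w, slots (base M) (M + 1) w,
      pack 2 (M + 1) h, r, t7, t8, k, 0, 0, t12, t13, t14], mem, inp, out, c⟩ =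
    ⟨regs [n, M, D, pack (base M) (M + 1) (Function.update w k 0),
      slots (base M) (M + 1) (Function.update w k 0), pack 2 (M + 1) (Function.update h k 0),
      r, t7, t8, k, 0, 0, start w k, w k, t14], mem, inp, out, c⟩ := by
  simpa only [Nat.cast_zero] using setWeight_effect H hk 0 0 n D r t7 t8 t12 t13 t14 mem inp out c

theorem update_memory_key_zero (key : ℕ → ℕ) (pr : ℕ → ℝ) (k : ℕ) :
    Function.update (memory key pr) (2 * k) 0 = memory (Function.update key k 0) pr := by
  simpa only [Nat.cast_zero] using update_memory_key key pr k 0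

/-- Moving the last record to index `k` keeps the indices contiguous. If `k = n + 1`, the record is
first overwritten by itself and then blanked by the same instructions. -/
theorem deleteProgram_reaches {M n : ℕ} {key : ℕ → ℕ} {pr : ℕ → ℝ} (T : Table M (n + 1) key pr)
    {k : ℕ} (hk : k ∈ Finset.Icc 1 (n + 1)) {N : ℕ} (hN : 2 * (n + 1) + 2 ≤ N)
    (K : List Program) (r : ℝ) (inp out : List ℝ) (c : ℕ) :
    Reaches N (deleteProgram :: K, machine M (n + 1) key pr r ((key k : ℝ) :: inp) out c)
      (K, machine M n (Function.update (Function.update key k (key (n + 1))) (n + 1) 0)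
        (Function.update (Function.update pr k (pr (n + 1))) (n + 1) 0) r inp out
        (c + deleteProgram.cost)) := by
  have hk' := Finset.mem_Icc.1 hk
  have hM := T.le
  have hkM : k ≤ M := hk'.2.trans hM
  have hn : ((n + 1 : ℕ) : ℝ) - 1 = n := by push_cast; ring
  have hsimp : deleteProgram.effect (machine M (n + 1) key pr r ((key k : ℝ) :: inp) out c) =
      machine M n (Function.update (Function.update key k (key (n + 1))) (n + 1) 0)
        (Function.update (Function.update pr k (pr (n + 1))) (n + 1) 0) r inp out c := by
    simp only [deleteProgram, keyCell, probCell, machine, stage, Program.effect, State.setReg,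
      update_regs, List.length_cons, List.length_nil, Nat.reduceAdd, Nat.reduceLT,
      List.set_cons_succ, List.set_cons_zero, value_digitT, value_powT, value_baseT, Term.value,
      regs_succ, regs_zero, Int.cast_one, Int.cast_ofNat, Int.cast_zero, List.headD_cons,
      List.tail_cons, T.dict_digit hk, floor_two_mul, floor_two_mul_add_one, memory_key,
      memory_prob, update_memory_key, dict_remove M n key hk 0,
      setProb_effect (weights_spec M (n + 1) pr) hkM (T.prob (n + 1)).1,
      update_weights hk'.1 hk'.2, update_heavies hk'.1 hk'.2,
      setWeight_effect_zero (weights_spec M (n + 1) _) hM, weights_pred M n _ 0,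
      heavies_pred n _ 0, update_memory_key_zero, update_memory_prob, hn, clear_effect]
  refine Program.reaches deleteProgram (by simp [deleteProgram, Program.Straight, setProb_straight,
    setWeight_straight, clear_straight]) K ?_ (T.blank hN) (by rw [hsimp]; rfl)
  simp only [deleteProgram, keyCell, probCell, machine, stage, Program.effect, State.setReg,
      update_regs, List.length_cons, List.length_nil, Nat.reduceAdd, Nat.reduceLT,
      List.set_cons_succ, List.set_cons_zero, value_digitT, value_powT, value_baseT, Term.value,
      regs_succ, regs_zero, Int.cast_one, Int.cast_ofNat, Int.cast_zero, List.headD_cons,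
      List.tail_cons, T.dict_digit hk, floor_two_mul, floor_two_mul_add_one, memory_key,
      memory_prob, update_memory_key, dict_remove M n key hk 0,
      setProb_effect (weights_spec M (n + 1) pr) hkM (T.prob (n + 1)).1,
      update_weights hk'.1 hk'.2, update_heavies hk'.1 hk'.2,
      setWeight_effect_zero (weights_spec M (n + 1) _) hM, weights_pred M n _ 0,
      heavies_pred n _ 0, update_memory_key_zero, update_memory_prob, hn, Program.Safe,
      setProb_safe (show 2 * k + 1 < N by omega), setWeight_safe, clear_safe,
      show 2 * k < N by omega, show 2 * (n + 1) < N by omega, show 2 * (n + 1) + 1 < N by omega,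
      and_self]

/-! ### Tables that represent an instance -/

/-- The records in memory are those of the instance. -/
structure Represents (I : Instance) (M n : ℕ) (key : ℕ → ℕ) (pr : ℕ → ℝ) : Prop
    extends Table M n key pr where
  image : (Finset.Icc 1 n).image key = I.S
  prob_eq : ∀ k ∈ Finset.Icc 1 n, pr k = I.p (key k)

theorem Represents.card {I : Instance} {M n : ℕ} {key : ℕ → ℕ} {pr : ℕ → ℝ}
    (h : Represents I M n key pr) : I.S.card = n := by
  rw [← h.image, Finset.card_image_of_injOn h.inj, Nat.card_Icc]
  omega

theorem Represents.exists_index {I : Instance} {M n : ℕ} {key : ℕ → ℕ} {pr : ℕ → ℝ}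
    (h : Represents I M n key pr) {v : ℕ} (hv : v ∈ I.S) : ∃ k ∈ Finset.Icc 1 n, key k = v := by
  rw [← h.image] at hv
  exact Finset.mem_image.1 hv

theorem Represents.key_ne {I : Instance} {M n : ℕ} {key : ℕ → ℕ} {pr : ℕ → ℝ}
    (h : Represents I M n key pr) {v : ℕ} (hv : v ∉ I.S) : ∀ k ∈ Finset.Icc 1 n, key k ≠ v := by
  rintro k hk rfl
  exact hv (h.image ▸ Finset.mem_image_of_mem key hk)

theorem Represents.update {I : Instance} {M n : ℕ} {key : ℕ → ℕ} {pr : ℕ → ℝ}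
    (h : Represents I M n key pr) {k : ℕ} (hk : k ∈ Finset.Icc 1 n) {x : ℝ}
    (hx : x ∈ Set.Icc (0 : ℝ) 1) :
    Represents ((Op.update (key k) x).apply I) M n key (Function.update pr k x) where
  toTable := h.toTable.update (Finset.mem_Icc.1 hk).2 hx
  image := h.image
  prob_eq j hj := by
    rcases eq_or_ne j k with rfl | hne
    · simp [Op.apply]
    · have : key j ≠ key k := fun e => hne (h.inj hj hk e)
      simp [Op.apply, hne, this, h.prob_eq j hj]

theorem Represents.insert {I I' : Instance} {M M' n : ℕ} {key : ℕ → ℕ} {pr : ℕ → ℝ}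
    (h : Represents I M n key pr) {v : ℕ} {x : ℝ}
    (T : Table M' (n + 1) (Function.update key (n + 1) v) (Function.update pr (n + 1) x))
    (hS : I'.S = Insert.insert v I.S) (hv : I'.p v = x) (hp : ∀ w ∈ I.S, I'.p w = I.p w) :
    Represents I' M' (n + 1) (Function.update key (n + 1) v) (Function.update pr (n + 1) x) where
  toTable := T
  image := by
    have hcongr : (Finset.Icc 1 n).image (Function.update key (n + 1) v) =
        (Finset.Icc 1 n).image key :=
      Finset.image_congr fun k hk => Function.update_of_ne (by
        have := (Finset.mem_Icc.1 (Finset.mem_coe.1 hk)).2; omega) _ _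
    rw [← Finset.insert_Icc_right_eq_Icc_add_one (by omega), Finset.image_insert, hcongr,
      h.image, hS, Function.update_self]
  prob_eq j hj := by
    rcases eq_or_ne j (n + 1) with rfl | hne
    · simp [hv]
    · have hj' : j ∈ Finset.Icc 1 n := by
        rw [Finset.mem_Icc] at hj ⊢
        omega
      rw [Function.update_of_ne hne, Function.update_of_ne hne, h.prob_eq j hj', hp]
      exact h.image ▸ Finset.mem_image_of_mem key hj'

theorem Represents.delete {I : Instance} {M n : ℕ} {key : ℕ → ℕ} {pr : ℕ → ℝ}
    (h : Represents I M (n + 1) key pr) {k : ℕ} (hk : k ∈ Finset.Icc 1 (n + 1)) :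
    Represents ((Op.delete (key k)).apply I) M n
      (Function.update (Function.update key k (key (n + 1))) (n + 1) 0)
      (Function.update (Function.update pr k (pr (n + 1))) (n + 1) 0) where
  toTable := h.toTable.delete hk
  image := by
    have hk' := Finset.mem_Icc.1 hk
    have hn : n + 1 ∈ Finset.Icc 1 (n + 1) := by simp
    ext v
    simp only [Op.apply, Finset.mem_image, Finset.mem_erase, ← h.image]
    constructor
    · rintro ⟨j, hj, rfl⟩
      rw [Finset.mem_Icc] at hj
      have hj' : j ∈ Finset.Icc 1 (n + 1) := Finset.mem_Icc.2 (by omega)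
      rw [Function.update_of_ne (by omega)]
      rcases eq_or_ne j k with rfl | hne
      · rw [Function.update_self]
        refine ⟨fun e => ?_, n + 1, hn, rfl⟩
        have := h.inj hn hj' e
        omega
      · rw [Function.update_of_ne hne]
        exact ⟨fun e => hne (h.inj hj' hk e), j, hj', rfl⟩
    · rintro ⟨hne, j, hj, rfl⟩
      have hjk : j ≠ k := fun e => hne (e ▸ rfl)
      rw [Finset.mem_Icc] at hj
      rcases eq_or_ne j (n + 1) with rfl | hj'
      · refine ⟨k, Finset.mem_Icc.2 (by omega), ?_⟩
        rw [Function.update_of_ne (by omega), Function.update_self]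
      · refine ⟨j, Finset.mem_Icc.2 (by omega), ?_⟩
        rw [Function.update_of_ne hj', Function.update_of_ne hjk]
  prob_eq j hj := by
    have hn : n + 1 ∈ Finset.Icc 1 (n + 1) := by simp
    rw [Finset.mem_Icc] at hj
    rw [Function.update_of_ne (show j ≠ n + 1 by omega),
      Function.update_of_ne (show j ≠ n + 1 by omega)]
    rcases eq_or_ne j k with rfl | hne
    · simpa [Op.apply] using h.prob_eq _ hn
    · simpa [Op.apply, hne] using h.prob_eq j (Finset.mem_Icc.2 (by omega))

/-! ### Construction -/

/-- The input for the records in `l`. -/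
noncomputable def records (p : ℕ → ℝ) (l : List ℕ) : List ℝ := l.flatMap fun v : ℕ => [(v : ℝ), p v]

/-- The time of the last test of the construction loop. -/
def buildExitCost : ℕ := 1 + (Term.reg 6).cost

/-- The amortized time of one round of the construction loop. -/
def buildStepCost : ℕ :=
  insertCost + 2 * growStepCost + 2 + (Term.reg 6).cost + (Term.sub (.reg 6) (.const 1)).cost + 1

/-- The records are inserted one by one, and the potentials telescope. Register 6 can serve as the
counter because an insertion preserves it. -/
theorem buildLoop_reaches (p : ℕ → ℝ) (N : ℕ) (K : List Program) (l : List ℕ) :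
    ∀ (A : Finset ℕ) (M n : ℕ) (key : ℕ → ℕ) (pr : ℕ → ℝ) (c : ℕ),
      Represents ⟨A, p⟩ M n key pr → l.Nodup → (∀ v ∈ l, v ∉ A) →
      (∀ v ∈ l, p v ∈ Set.Icc (0 : ℝ) 1) → 2 * (n + l.length) + 2 ≤ N →
      ∃ M' n' key' pr' t, Represents ⟨A ∪ l.toFinset, p⟩ M' n' key' pr' ∧
        t + growStepCost * (2 * n' - M') ≤
          buildStepCost * l.length + buildExitCost + growStepCost * (2 * n - M) ∧
        Reaches N (buildLoop :: K, machine M n key pr l.length (records p l) [] c)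
          (K, machine M' n' key' pr' 0 [] [] (c + t)) := by
  induction l with
  | nil =>
    intro A M n key pr c h _ _ _ hN
    refine ⟨M, n, key, pr, buildExitCost, by simpa using h, by simp, ?_⟩
    have : Reaches N (buildLoop :: K, machine M n key pr 0 [] [] c)
        (K, (machine M n key pr 0 [] [] c).tick buildExitCost) :=
      whileFalse_reaches (h.blank (by simpa using hN)) (by simp [Term.value, machine, stage, regs])
    simpa [records, machine, stage_tick] using this
  | cons v l ih =>
    intro A M n key pr c h hl hA hp hN
    rw [List.length_cons] at hN
    have hv : v ∉ A := hA v (by simp)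
    have hlen : ((v :: l).length : ℝ) - 1 = l.length := by simp
    obtain ⟨M', t, T, ht, hins⟩ := insertProgram_reaches h.toTable (h.key_ne hv) (hp v (by simp))
      (N := N) (by omega) (.assign 6 (.sub (.reg 6) (.const 1)) :: buildLoop :: K)
      (v :: l).length (records p l) [] (c + (1 + (Term.reg 6).cost) + 1)
    have hrep : Represents ⟨Insert.insert v A, p⟩ M' (n + 1) (Function.update key (n + 1) v)
        (Function.update pr (n + 1) (p v)) := h.insert T rfl rfl fun _ _ => rfl
    obtain ⟨M'', n'', key'', pr'', t', h'', ht', hloop⟩ := ih (Insert.insert v A) M' (n + 1) _ _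
      (c + (1 + (Term.reg 6).cost) + 1 + t + (1 + (Term.sub (.reg 6) (.const 1)).cost)) hrep
      (List.nodup_cons.1 hl).2
      (by
        intro w hw
        rw [Finset.mem_insert, not_or]
        exact ⟨fun e => (List.nodup_cons.1 hl).1 (e ▸ hw), hA w (by simp [hw])⟩)
      (fun w hw => hp w (by simp [hw])) (by omega)
    have h1 : Reaches N
        (buildLoop :: K, machine M n key pr (v :: l).length (records p (v :: l)) [] c)
        (.seq insertProgram (.assign 6 (.sub (.reg 6) (.const 1))) :: buildLoop :: K,
          machine M n key pr (v :: l).length ((v : ℝ) :: p v :: records p l) []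
            (c + (1 + (Term.reg 6).cost))) := by
      refine whileTrue_reaches (h.blank (by omega)) ?_
      have : ((v :: l).length : ℝ) ≠ 0 := Nat.cast_ne_zero.2 (by simp)
      simpa only [Term.value, machine, stage, regs_succ, regs_zero] using this
    have h2 := (h1.trans (seq_reaches (h.blank (by omega)))).trans hins
    have h3 : Reaches N (.assign 6 (.sub (.reg 6) (.const 1)) :: buildLoop :: K,
        machine M' (n + 1) (Function.update key (n + 1) v) (Function.update pr (n + 1) (p v))
          (v :: l).length (records p l) [] (c + (1 + (Term.reg 6).cost) + 1 + t))
        (buildLoop :: K, machine M' (n + 1) (Function.update key (n + 1) v)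
          (Function.update pr (n + 1) (p v)) l.length (records p l) []
          (c + (1 + (Term.reg 6).cost) + 1 + t + (1 + (Term.sub (.reg 6) (.const 1)).cost))) := by
      refine .single (T.blank (by omega)) fun _ => ?_
      simp only [step, machine, stage, State.setReg, State.tick, update_regs, List.length_cons,
        List.length_nil, Nat.reduceAdd, Nat.reduceLT, List.set_cons_succ, List.set_cons_zero,
        Term.value, regs_succ, regs_zero, Int.cast_one]
      rw [← List.length_cons (a := v), hlen]
    refine ⟨M'', n'', key'', pr'', 1 + (Term.reg 6).cost + 1 + t +
      (1 + (Term.sub (.reg 6) (.const 1)).cost) + t', ?_, ?_, ?_⟩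
    · convert h'' using 2
      ext w
      simp
    · rw [List.length_cons, mul_add, mul_one]
      have hdef : buildStepCost = insertCost + 2 * growStepCost + 2 + (Term.reg 6).cost +
        (Term.sub (.reg 6) (.const 1)).cost + 1 := rfl
      omega
    · have h4 := (h2.trans h3).trans hloop
      convert h4 using 3
      ring

/-- The time of the construction for `n` records is at most `buildCost * (1 + n)`. -/
def buildCost : ℕ := buildStepCost + buildExitCost + growStepCost + growBaseCost + clear.cost + 5

/-- All strings of an empty table are the number `0`, so the blank machine already is a valid state
of capacity `0`; the first insertion then rebuilds it. -/
theorem blank_start (inp : List ℝ) :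
    State.blank.start inp = machine 0 0 (fun _ => 0) (fun _ => 0) 0 inp [] 0 := by
  have hr : regs [0, 0, 0, 0, 0, 0, 0, 0, 0, 0, 0, 0, 0, 0, 0] = fun _ => 0 := by
    ext i
    iterate 15
      cases i with
      | zero => rfl
      | succ i => ?_
    rfl
  have hw : weights 0 0 (fun _ => 0) = fun _ => 0 := by
    ext k; unfold weights; rw [if_neg (by omega)]
  have hh : heavies 0 (fun _ => 0) = fun _ => 0 := by
    ext k; unfold heavies; rw [if_neg (by omega)]
  have hm : memory (fun _ => 0) (fun _ => 0) = fun _ => 0 := by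
    ext a; simp [memory]
  simp [machine, stage, State.blank, State.start, hw, hh, hm, dict, pack, slots, hr]

/-- The final `grow` makes the capacity `2 * n + 1`, so that the operations start with potential `0`
and inherit no debt from the construction. -/
theorem buildProgram_reaches {l : List ℕ} (hl : l.Nodup) {p : ℕ → ℝ}
    (hp : ∀ v ∈ l, p v ∈ Set.Icc (0 : ℝ) 1) {N : ℕ} (hN : 2 * l.length + 2 ≤ N) :
    ∃ n key pr t, Represents ⟨l.toFinset, p⟩ (2 * n + 1) n key pr ∧
      t ≤ buildCost * (1 + l.length) ∧
      Reaches N ([buildProgram], State.blank.start ((l.length : ℝ) :: records p l))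
        ([], machine (2 * n + 1) n key pr 0 [] [] t) := by
  have h0 : Represents ⟨∅, p⟩ 0 0 (fun _ => 0) (fun _ => 0) :=
    { le := le_rfl
      inj := by simp
      prob := by simp
      key_zero := by simp
      prob_zero := by simp
      image := by simp
      prob_eq := by simp }
  have hb := h0.blank (show 2 * 0 + 2 ≤ N by omega)
  obtain ⟨M, n, key, pr, t, h, ht, hloop⟩ := buildLoop_reaches p N [.seq grow clear] l ∅ 0 0 _ _
    3 h0 hl (by simp) hp (by omega)
  rw [Finset.empty_union] at h
  have hn : n = l.length := by
    rw [← h.card]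
    exact List.toFinset_card_of_nodup hl
  obtain ⟨u9, u10, u11, u12, u13, u14, hg⟩ := grow_reaches h.toTable (N := N) (by omega) [clear]
    0 0 0 0 0 0 0 0 0 [] [] (3 + t + 1)
  have h1 : Reaches N ([buildProgram], State.blank.start ((l.length : ℝ) :: records p l))
      (buildLoop :: [.seq grow clear],
        machine 0 0 (fun _ => 0) (fun _ => 0) l.length (records p l) [] 3) := by
    rw [blank_start]
    refine ((seq_reaches hb).trans (Program.reaches (.read 6) trivial _ trivial hb rfl)).trans
      (.single hb fun _ => ?_)
    simp only [step, Program.effect, Program.cost, machine, stage, State.setReg, State.tick,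
      update_regs, List.length_cons, List.length_nil, Nat.reduceAdd, Nat.reduceLT,
      List.set_cons_succ, List.set_cons_zero, List.headD_cons, List.tail_cons]
  have h2 : Reaches N ([.seq grow clear], machine M n key pr 0 [] [] (3 + t))
      (grow :: [clear], stage M n n key pr 0 0 0 0 0 0 0 0 0 [] [] (3 + t + 1)) :=
    seq_reaches (h.blank (by omega))
  have h3 := Program.reaches clear clear_straight []
    (s := stage (2 * n + 1) n n key pr 0 0 0 u9 u10 u11 u12 u13 u14 [] []
      (3 + t + 1 + growStepCost * n + growBaseCost)) (clear_safe N _) (h.blank (by omega))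
    (by rw [stage, clear_effect])
  refine ⟨n, key, pr, 3 + t + 1 + growStepCost * n + growBaseCost + clear.cost,
    ⟨⟨by omega, h.inj, h.prob, h.key_zero, h.prob_zero⟩, h.image, h.prob_eq⟩, ?_,
    (((h1.trans hloop).trans h2).trans hg).trans h3⟩
  simp only [mul_zero, Nat.zero_sub, add_zero] at ht
  rw [← hn] at ht ⊢
  have : buildCost * (1 + n) = buildStepCost * n + growStepCost * n + (buildStepCost +
    buildExitCost + growStepCost + growBaseCost + clear.cost + 5) +
    (buildExitCost + growBaseCost + clear.cost + 5) * n := by unfold buildCost; ring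
  omega

/-! ### Modifications -/

/-- The data structure. -/
def dataStructure (query : Program) : DataStructure where
  build := buildProgram
  query := query
  update := updateProgram
  insert := insertProgram
  delete := deleteProgram

/-- The amortized time of a modification. -/
def modificationCost : ℕ :=
  insertCost + 2 * growStepCost + updateProgram.cost + deleteProgram.cost

/-- The space is measured by the set after the operation. A deletion that leaves `n` records starts
with the cells of `n + 1` records, and `2 * (n + 1) + 2 ≤ 4 * (1 + n)`. -/
theorem modification_reaches {I : Instance} {M n : ℕ} {key : ℕ → ℕ} {pr : ℕ → ℝ}
    (h : Represents I M n key pr) {op : Op} (hop : op.Valid I) (hq : ¬ op.IsQuery)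
    (query : Program) :
    ∃ M' n' key' pr' t, Represents (op.apply I) M' n' key' pr' ∧
      t + growStepCost * (2 * n' - M') ≤ modificationCost + growStepCost * (2 * n - M) ∧
      Reaches (4 * (1 + (op.apply I).S.card))
        ([((dataStructure query).opCall op).1],
          machine M n key pr 0 ((dataStructure query).opCall op).2 [] 0)
        ([], machine M' n' key' pr' 0 [] [] t) := by
  cases op with
  | query => exact absurd trivial hq
  | update v x =>
    obtain ⟨hv, hx⟩ := hop
    obtain ⟨k, hk, rfl⟩ := h.exists_index hv
    have h' := h.update hk hx
    have hr := updateProgram_reaches h.toTable hk hx (N := 4 * (1 + ((Op.update (key k) x).apply I).S.card))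
      (by rw [h'.card]; omega) [] 0 [] [] 0
    rw [zero_add] at hr
    exact ⟨M, n, key, _, updateProgram.cost, h', by unfold modificationCost; omega, hr⟩
  | insert v x =>
    obtain ⟨hv, hx⟩ := hop
    have hcard : ((Op.insert v x).apply I).S.card = n + 1 := by
      rw [← h.card]
      exact Finset.card_insert_of_notMem hv
    obtain ⟨M', t, T, ht, hr⟩ := insertProgram_reaches h.toTable (h.key_ne hv) hx
      (N := 4 * (1 + ((Op.insert v x).apply I).S.card)) (by rw [hcard]; omega) [] 0 [] [] 0
    rw [zero_add] at hr
    refine ⟨M', n + 1, _, _, t, h.insert T rfl (by simp [Op.apply]) ?_,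
      by unfold modificationCost; omega, hr⟩
    intro w hw
    have : w ≠ v := fun e => hv (e ▸ hw)
    simp [Op.apply, this]
  | delete v =>
    obtain ⟨k, hk, rfl⟩ := h.exists_index hop
    obtain ⟨n, rfl⟩ : ∃ m, n = m + 1 :=
      Nat.exists_eq_add_of_le' (by have := Finset.mem_Icc.1 hk; omega)
    have h' := h.delete hk
    have hr := deleteProgram_reaches h.toTable hk (N := 4 * (1 + ((Op.delete (key k)).apply I).S.card))
      (by rw [h'.card]; omega) [] 0 [] [] 0
    rw [zero_add] at hr
    refine ⟨M, n, _, _, deleteProgram.cost, h', ?_, hr⟩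
    have : growStepCost * (2 * n - M) ≤ growStepCost * (2 * (n + 1) - M) :=
      Nat.mul_le_mul_left _ (by omega)
    unfold modificationCost
    omega

end SubsetSampling

namespace RealRAM

/-! ### The uniform distribution -/

theorem uniform01_Iic {t : ℝ} (ht : t ∈ Set.Icc (0 : ℝ) 1) :
    uniform01 (Set.Iic t) = ENNReal.ofReal t := by
  rw [uniform01, Measure.restrict_apply measurableSet_Iic]
  have : Set.Iic t ∩ Set.Icc 0 1 = Set.Icc 0 t := by
    ext u
    simp only [Set.mem_inter_iff, Set.mem_Iic, Set.mem_Icc]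
    constructor
    · tauto
    · rintro ⟨h0, h1⟩
      exact ⟨h1, h0, h1.trans ht.2⟩
  rw [this, Real.volume_Icc, sub_zero]

theorem lintegral_coin {p a : ℝ} (hp : 0 ≤ p) (ha : 0 < a) (hpa : p ≤ a) (r : Bool → ENNReal) :
    ∫⁻ u, r (decide (u * a ≤ p)) ∂uniform01 =
      ENNReal.ofReal (p / a) * r true + ENNReal.ofReal (1 - p / a) * r false := by
  have ht : p / a ∈ Set.Icc (0 : ℝ) 1 := ⟨by positivity, (div_le_one ha).2 hpa⟩
  have h : ∀ u : ℝ, r (decide (u * a ≤ p)) =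
      (Set.Iic (p / a)).indicator (fun _ => r true) u +
        (Set.Iic (p / a))ᶜ.indicator (fun _ => r false) u := by
    intro u
    by_cases hu : u * a ≤ p
    · have : u ≤ p / a := (le_div_iff₀ ha).2 hu
      simp [hu, this]
    · have : ¬ u ≤ p / a := fun h => hu ((le_div_iff₀ ha).1 h)
      rw [Set.indicator_of_notMem (show u ∉ Set.Iic (p / a) from this),
        Set.indicator_of_mem (show u ∈ (Set.Iic (p / a))ᶜ from this), zero_add]
      simp [hu]
  have hc : uniform01 (Set.Iic (p / a))ᶜ = ENNReal.ofReal (1 - p / a) := by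
    rw [prob_compl_eq_one_sub measurableSet_Iic, uniform01_Iic ht, ENNReal.ofReal_sub _ ht.1,
      ENNReal.ofReal_one]
  simp only [h]
  rw [lintegral_add_left (measurable_const.indicator measurableSet_Iic),
    lintegral_indicator_const measurableSet_Iic, lintegral_indicator_const measurableSet_Iic.compl,
    hc, uniform01_Iic ht, mul_comm, mul_comm (r false)]

/-! ### Geometric jumps -/

/-- The number of slots that a jump skips, for the uniformly distributed number `u`. -/
noncomputable def skipped (K u : ℝ) : ℕ := ⌊K * (0 - Real.log u)⌋₊

theorem measurable_skipped (K : ℝ) : Measurable (skipped K) :=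
  Nat.measurable_floor.comp
    (measurable_const.mul (measurable_const.sub Real.measurable_log))

/-- For `0 < u ≤ 1`, at least `m` slots are skipped iff `u ≤ exp (-(m / K))`. The point `u = 0` has
to be excluded as a null set, since `Real.log 0 = 0`. -/
theorem uniform01_le_skipped {K : ℝ} (hK : 0 < K) (m : ℕ) :
    uniform01 {u | m ≤ skipped K u} = ENNReal.ofReal (Real.exp (-(1 / K)) ^ m) := by
  have hq : Real.exp (-(1 / K)) ^ m = Real.exp (-(m / K)) := by
    rw [← Real.exp_nat_mul]
    congr 1
    ring
  have hmem : Real.exp (-(m / K)) ∈ Set.Icc (0 : ℝ) 1 :=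
    ⟨(Real.exp_pos _).le, Real.exp_le_one_iff.2 (neg_nonpos.2 (by positivity))⟩
  rw [hq, ← uniform01_Iic hmem]
  refine measure_congr ?_
  have h0 : ∀ᵐ u ∂uniform01, u ≠ 0 := by
    rw [uniform01]
    exact ae_restrict_of_ae (by simp [ae_iff])
  have h1 : ∀ᵐ u ∂uniform01, u ∈ Set.Icc (0 : ℝ) 1 := ae_restrict_mem measurableSet_Icc
  filter_upwards [h0, h1] with u hu0 hu1
  refine propext ?_
  change m ≤ skipped K u ↔ u ≤ Real.exp (-(m / K))
  have hu : 0 < u := lt_of_le_of_ne hu1.1 (Ne.symm hu0)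
  have hlog : Real.log u ≤ 0 := Real.log_nonpos hu1.1 hu1.2
  rw [skipped, Nat.le_floor_iff (mul_nonneg hK.le (by linarith)), ← Real.log_le_iff_le_exp hu,
    le_neg, div_le_iff₀ hK]
  constructor <;> intro h <;> linarith

/-- The probability that a jump skips exactly `g` slots. -/
noncomputable def skipProb (q : ℝ) (g : ℕ) : ENNReal := ENNReal.ofReal (q ^ g * (1 - q))

theorem lintegral_skipped {K : ℝ} (hK : 0 < K) (φ : ℕ → ENNReal) :
    ∫⁻ u, φ (skipped K u) ∂uniform01 = ∑' g, skipProb (Real.exp (-(1 / K))) g * φ g := by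
  rw [← lintegral_map (f := φ) (measurable_of_countable φ) (measurable_skipped K),
    lintegral_countable']
  refine tsum_congr fun g => ?_
  rw [Measure.map_apply (measurable_skipped K) (measurableSet_singleton g), mul_comm]
  congr 1
  have h : skipped K ⁻¹' {g} = {u | g ≤ skipped K u} \ {u | g + 1 ≤ skipped K u} := by
    ext u
    change skipped K u = g ↔ g ≤ skipped K u ∧ ¬ g + 1 ≤ skipped K u
    omega
  have hm : MeasurableSet {u | g + 1 ≤ skipped K u} :=
    measurable_skipped K (measurableSet_Ici (a := g + 1))
  have hsub : {u | g + 1 ≤ skipped K u} ⊆ {u | g ≤ skipped K u} := fun u (hu : g + 1 ≤ _) =>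
    show g ≤ _ by omega
  rw [h, measure_sdiff hsub hm.nullMeasurableSet
    (measure_ne_top _ _), uniform01_le_skipped hK, uniform01_le_skipped hK,
    ← ENNReal.ofReal_sub _ (by positivity), skipProb]
  congr 1
  ring

theorem sum_skipProb {q : ℝ} (hq : q ∈ Set.Icc (0 : ℝ) 1) (m : ℕ) :
    ∑ g ∈ Finset.range m, skipProb q g = ENNReal.ofReal (1 - q ^ m) := by
  unfold skipProb
  rw [← ENNReal.ofReal_sum_of_nonneg fun g _ => mul_nonneg (pow_nonneg hq.1 g) (by linarith [hq.2]),
    ← Finset.sum_mul]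
  congr 1
  have := geom_sum_mul q m
  linarith

/-- Memorylessness: `skipProb q (m + g) = q ^ m * skipProb q g`, so given that the first `m` slots
are skipped, the jump starts afresh behind them. -/
theorem tsum_skipProb_split {q : ℝ} (hq : q ∈ Set.Icc (0 : ℝ) 1) (m : ℕ) (φ : ℕ → ENNReal)
    (r : ENNReal) (hr : ∀ g < m, φ g = r) :
    ∑' g, skipProb q g * φ g =
      ENNReal.ofReal (q ^ m) * ∑' g, skipProb q g * φ (m + g) + ENNReal.ofReal (1 - q ^ m) * r := by
  have hsplit := (ENNReal.summable (f := fun g => skipProb q (g + m) * φ (g + m))).sum_add_tsum_nat_add'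
    (f := fun g => skipProb q g * φ g)
  rw [← hsplit, add_comm]
  congr 1
  · rw [← ENNReal.tsum_mul_left]
    refine tsum_congr fun g => ?_
    rw [add_comm g m, skipProb, skipProb, ← mul_assoc, ← ENNReal.ofReal_mul (pow_nonneg hq.1 m),
      pow_add, mul_assoc (q ^ m)]
  · rw [← sum_skipProb hq, Finset.sum_mul]
    exact Finset.sum_congr rfl fun g hg => by rw [hr g (Finset.mem_range.1 hg)]

theorem tsum_skipProb {K : ℝ} (hK : 0 < K) : ∑' g, skipProb (Real.exp (-(1 / K))) g = 1 := by
  have := lintegral_skipped hK fun _ => 1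
  simpa using this.symm

theorem whileTrue_reduces {N : ℕ} {e : Term} {b : Program} {K : List Program} {s : State}
    (hb : Blank N s.mem) (he : e.value s.reg ≠ 0) :
    Reduces N 1 (.while e b :: K, s) (b :: .while e b :: K, s.tick (1 + e.cost)) :=
  .single hb fun _ => by simp [step, he]

theorem whileFalse_reduces {N : ℕ} {e : Term} {b : Program} {K : List Program} {s : State}
    (hb : Blank N s.mem) (he : e.value s.reg = 0) :
    Reduces N 1 (.while e b :: K, s) (K, s.tick (1 + e.cost)) :=
  .single hb fun _ => by simp [step, he]

theorem seq_reduces {N : ℕ} {a b : Program} {K : List Program} {s : State}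
    (hb : Blank N s.mem) : Reduces N 1 (.seq a b :: K, s) (a :: b :: K, s.tick 1) :=
  .single hb fun _ => rfl

end RealRAM

namespace SubsetSampling

open RealRAM

/-! ### Queries -/

/-- Load the record in register 9. -/
def loadRecord : Program := .seq (.load 8 (probCell (.reg 9))) (.load 7 (keyCell (.reg 9)))

/-- Report the key in register 7 or spend the same time otherwise. -/
def coin : Program :=
  .ite (.le (.mul (.reg 11) (.reg 13)) (.reg 8)) (.write (.reg 7)) (.assign 11 (.reg 7))

/-- Blank the registers used by `flip`. -/
def flipClear : Program :=
  .seq (.assign 7 (.const 0)) <| .seq (.assign 8 (.const 0)) <| .seq (.assign 11 (.const 0))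
    (.assign 13 (.const 0))

/-- Report the record in register 9, which has probability `p`, with probability `p / a`, where `a`
is in register 13. -/
def flip : Program := .seq loadRecord <| .seq (.rand 11) <| .seq coin flipClear

/-- The effect of the random number in register 11 on the position in register 10. -/
def land : Program :=
  .seq (.assign 11 (.floor (.mul (.add (.reg 1) (.const 1)) (.sub (.const 0) (.log (.reg 11)))))) <|
  .seq (.assign 9 (digitT (.reg 4) baseT
    (.add (.reg 10) (.mul (.le (.const 0) (.reg 11)) (.reg 11))))) <|
  .seq (.assign 11 (.const 0)) (.assign 10 (.const 0))

/-- Jump from the slot in register 10 to a random later slot, and put the record that occupies it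
into register 9. -/
def jump : Program := .seq (.rand 11) land

def lightStart : Program :=
  .seq (.assign 10 (prefixT (.reg 9))) (.assign 13 (.sub (.const 1)
    (.exp (.sub (.const 0) (.div (digitT (.reg 3) baseT (.reg 9)) (.add (.reg 1) (.const 1)))))))

def lightBody : Program := .seq lightStart (.seq flip jump)

def lightLoop : Program := .while (.reg 9) lightBody

def heavyStart : Program :=
  .seq (.assign 9 (.floor (.div (.log (.reg 12)) (.log (.const 2))))) (.assign 13 (.const 1))

def heavyEnd : Program :=
  .seq (.assign 12 (.sub (.reg 12) (powT (.const 2) (.reg 9)))) (.assign 9 (.const 0))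

def heavyBody : Program := .seq heavyStart (.seq flip heavyEnd)

def heavyLoop : Program := .while (.reg 12) heavyBody

def queryProgram : Program :=
  .seq (.assign 12 (.reg 5)) <| .seq heavyLoop <| .seq jump lightLoop

/-- The state during a query. -/
noncomputable def queryState (M n : ℕ) (key : ℕ → ℕ) (pr : ℕ → ℝ) (k x j a : ℝ) (out : List ℝ)
    (c : ℕ) : State :=
  stage M n n key pr 0 0 0 k x 0 j a 0 [] out c

/-- The time of `flip`. -/
def flipCost : ℕ :=
  loadRecord.cost + (Term.le (.mul (.reg 11) (.reg 13)) (.reg 8)).cost + (Term.reg 7).cost +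
    flipClear.cost + 6

theorem loadRecord_effect {M n k : ℕ} {key : ℕ → ℕ} {pr : ℕ → ℝ} (x j a : ℝ) (out : List ℝ)
    (c : ℕ) : loadRecord.effect (queryState M n key pr k x j a out c) =
      stage M n n key pr 0 (key k) (pr k) k x 0 j a 0 [] out c := by
  simp only [loadRecord, queryState, probCell, keyCell, stage, Program.effect, State.setReg,
    update_regs, List.length_cons, List.length_nil, Nat.reduceAdd, Nat.reduceLT,
    List.set_cons_succ, List.set_cons_zero, Term.value, regs_succ, regs_zero, Int.cast_one,
    Int.cast_ofNat, floor_two_mul, floor_two_mul_add_one, memory_key, memory_prob]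

/-- Both outcomes take equally many steps and equal time, thanks to the dummy assignment in `coin`;
`Spec.rand` requires a number of steps that is independent of `u`. -/
theorem flip_spec {M n k : ℕ} {key : ℕ → ℕ} {pr : ℕ → ℝ} (T : Table M n key pr) {N : ℕ}
    (hN : 2 * n + 2 ≤ N) {a : ℝ} (ha : 0 < a) (hpa : pr k ≤ a) {x j : ℝ} {R : State → Prop}
    {f : State → ENNReal} {K : List Program} {out : List ℝ} {c : ℕ} {r : Bool → ENNReal}
    (h : ∀ b : Bool, Spec N R f (K, queryState M n key pr k x j 0
      (if b then (key k : ℝ) :: out else out) (c + flipCost)) (r b)) :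
    Spec N R f (flip :: K, queryState M n key pr k x j a out c)
      (ENNReal.ofReal (pr k / a) * r true + ENNReal.ofReal (1 - pr k / a) * r false) := by
  have hb := T.blank hN
  have h1 : Reduces N 1 (flip :: K, queryState M n key pr k x j a out c)
      (loadRecord :: .seq (.rand 11) (.seq coin flipClear) :: K,
        queryState M n key pr k x j a out (c + 1)) := seq_reduces hb
  have h2 := loadRecord.reduces (N := N) (by simp [loadRecord, Program.Straight])
    (.seq (.rand 11) (.seq coin flipClear) :: K) (queryState M n key pr k x j a out (c + 1))
    (by simp [loadRecord, Program.Safe]) hb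
  rw [loadRecord_effect, stage_tick] at h2
  have h3 : Reduces N 1 (.seq (.rand 11) (.seq coin flipClear) :: K,
      stage M n n key pr 0 (key k) (pr k) k x 0 j a 0 [] out (c + 1 + loadRecord.cost))
      (.rand 11 :: .seq coin flipClear :: K,
      stage M n n key pr 0 (key k) (pr k) k x 0 j a 0 [] out (c + 1 + loadRecord.cost + 1)) :=
    seq_reduces hb
  refine Spec.of_reduces ((h1.trans h2).trans h3) ?_
  rw [← lintegral_coin (T.prob k).1 ha hpa]
  refine Spec.rand (j := fun u => decide (u * a ≤ pr k)) (n := 1 + 1 + 1 + flipClear.length)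
    (cfg := fun b => (K, queryState M n key pr k x j 0
      (if b then (key k : ℝ) :: out else out) (c + flipCost))) ?_ hb (fun u => ?_) fun u => h _
  · refine measurable_to_bool ?_
    have : (fun u : ℝ => decide (u * a ≤ pr k)) ⁻¹' {true} = {u | u * a ≤ pr k} := by
      ext u
      simp
    rw [this]
    exact measurableSet_le (measurable_id.mul_const a) measurable_const
  have hset : ((stage M n n key pr 0 (key k) (pr k) k x 0 j a 0 [] out
      (c + 1 + loadRecord.cost + 1)).setReg 11 u).tick 1 =
      stage M n n key pr 0 (key k) (pr k) k x u j a 0 [] out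
        (c + 1 + loadRecord.cost + 1 + 1) := by
    simp only [stage, State.setReg, State.tick, update_regs, List.length_cons, List.length_nil,
      Nat.reduceAdd, Nat.reduceLT, List.set_cons_succ, List.set_cons_zero]
  rw [hset]
  have h4 : Reduces N 1 (.seq coin flipClear :: K,
      stage M n n key pr 0 (key k) (pr k) k x u j a 0 [] out
        (c + 1 + loadRecord.cost + 1 + 1))
      (coin :: flipClear :: K, stage M n n key pr 0 (key k) (pr k) k x u j a 0 [] out
        (c + 1 + loadRecord.cost + 1 + 1 + 1)) := seq_reduces hb
  have h5 : Reduces N 1 (coin :: flipClear :: K,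
      stage M n n key pr 0 (key k) (pr k) k x u j a 0 [] out
        (c + 1 + loadRecord.cost + 1 + 1 + 1))
      ((if u * a ≤ pr k then .write (.reg 7) else .assign 11 (.reg 7)) :: flipClear :: K,
        stage M n n key pr 0 (key k) (pr k) k x u j a 0 [] out
        (c + 1 + loadRecord.cost + 1 + 1 + 1 +
          (1 + (Term.le (.mul (.reg 11) (.reg 13)) (.reg 8)).cost))) := by
    refine .single hb fun _ => ?_
    by_cases hu : u * a ≤ pr k <;>
      simp only [coin, step, stage, State.tick, Term.value, regs_succ, regs_zero, hu, if_true,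
        if_false, ne_eq, one_ne_zero, not_false_eq_true, not_true_eq_false]
  have hend : ∀ (out' : List ℝ) (u' : ℝ) (c' : ℕ), flipClear.effect
      (stage M n n key pr 0 (key k) (pr k) k x u' j a 0 [] out' c') =
      queryState M n key pr k x j 0 out' c' := by
    intro out' u' c'
    simp only [flipClear, queryState, stage, Program.effect, State.setReg,
      update_regs, List.length_cons, List.length_nil, Nat.reduceAdd, Nat.reduceLT,
      List.set_cons_succ, List.set_cons_zero, Term.value, Int.cast_zero]
  have h6 : ∃ u', Reduces N 1
      ((if u * a ≤ pr k then .write (.reg 7) else .assign 11 (.reg 7)) :: flipClear :: K,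
        stage M n n key pr 0 (key k) (pr k) k x u j a 0 [] out
        (c + 1 + loadRecord.cost + 1 + 1 + 1 +
          (1 + (Term.le (.mul (.reg 11) (.reg 13)) (.reg 8)).cost)))
      (flipClear :: K, stage M n n key pr 0 (key k) (pr k) k x u' j a 0 []
        (if decide (u * a ≤ pr k) = true then (key k : ℝ) :: out else out)
        (c + 1 + loadRecord.cost + 1 + 1 + 1 +
          (1 + (Term.le (.mul (.reg 11) (.reg 13)) (.reg 8)).cost) + (1 + (Term.reg 7).cost))) := by
    by_cases hu : u * a ≤ pr k
    · refine ⟨u, .single hb fun _ => ?_⟩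
      simp only [hu, if_true, decide_true, step, stage, State.tick, Term.value, regs_succ,
        regs_zero]
    · refine ⟨key k, .single hb fun _ => ?_⟩
      simp only [hu, if_false, decide_false, Bool.false_eq_true, step, stage, State.tick,
        State.setReg, Term.value, regs_succ, regs_zero, update_regs, List.length_cons,
        List.length_nil, Nat.reduceAdd, Nat.reduceLT, List.set_cons_succ, List.set_cons_zero]
  obtain ⟨u', h6⟩ := h6
  have h7 := flipClear.reduces (N := N) (by simp [flipClear, Program.Straight]) K
    (stage M n n key pr 0 (key k) (pr k) k x u' j a 0 []
        (if decide (u * a ≤ pr k) = true then (key k : ℝ) :: out else out)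
        (c + 1 + loadRecord.cost + 1 + 1 + 1 +
          (1 + (Term.le (.mul (.reg 11) (.reg 13)) (.reg 8)).cost) + (1 + (Term.reg 7).cost)))
    (by simp [flipClear, Program.Safe]) hb
  rw [hend] at h7
  have hcost : c + flipCost = c + 1 + loadRecord.cost + 1 + 1 + 1 +
      (1 + (Term.le (.mul (.reg 11) (.reg 13)) (.reg 8)).cost) + (1 + (Term.reg 7).cost) +
        flipClear.cost := by
    unfold flipCost
    ring
  rw [hcost]
  exact ((h4.trans h5).trans h6).trans h7

/-- The time of `jump`. -/
def jumpCost : ℕ := 2 + land.cost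

/-- The record that occupies slot `y`, and `0` if there is none. -/
noncomputable def occupant (M n : ℕ) (pr : ℕ → ℝ) (y : ℕ) : ℕ :=
  slots (base M) (M + 1) (weights M n pr) / base M ^ y % base M

theorem jump_spec {M n : ℕ} {key : ℕ → ℕ} {pr : ℕ → ℝ} (T : Table M n key pr) {N : ℕ}
    (hN : 2 * n + 2 ≤ N) {k : ℝ} {x : ℕ} {R : State → Prop}
    {f : State → ENNReal} {K : List Program} {out : List ℝ} {c : ℕ} {r : ℕ → ENNReal}
    (h : ∀ g : ℕ, Spec N R f (K, queryState M n key pr (occupant M n pr (x + g)) 0 0 0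
      out (c + jumpCost)) (r g)) :
    Spec N R f (jump :: K, queryState M n key pr k x 0 0 out c)
      (∑' g, skipProb (Real.exp (-(1 / ((M : ℝ) + 1)))) g * r g) := by
  have hb := T.blank hN
  have hM : (0 : ℝ) < M + 1 := by positivity
  have h1 : Reduces N 1 (jump :: K, queryState M n key pr k x 0 0 out c)
      (.rand 11 :: land :: K, queryState M n key pr k x 0 0 out (c + 1)) := seq_reduces hb
  refine Spec.of_reduces h1 ?_
  rw [← lintegral_skipped hM]
  refine Spec.rand (measurable_skipped ((M : ℝ) + 1)) (n := land.length)
    (cfg := fun g => (K, queryState M n key pr (occupant M n pr (x + g)) 0 0 0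
      out (c + jumpCost))) hb (fun u => ?_) fun u => h _
  have hset : ((queryState M n key pr k x 0 0 out (c + 1)).setReg 11 u).tick 1 =
      stage M n n key pr 0 0 0 k x u 0 0 0 [] out (c + 1 + 1) := by
    simp only [queryState, stage, State.setReg, State.tick, update_regs, List.length_cons,
      List.length_nil, Nat.reduceAdd, Nat.reduceLT, List.set_cons_succ, List.set_cons_zero]
  -- The specification covers every stream, also with `u` outside `[0, 1]`, where the truncated
  -- value may be negative. The comparison in `land` replaces it by `0`, as `Nat.floor` does in
  -- `skipped`.
  have hfloor : (if (0 : ℝ) ≤ ⌊((M : ℝ) + 1) * (0 - Real.log u)⌋ then (1 : ℝ) else 0) *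
      ⌊((M : ℝ) + 1) * (0 - Real.log u)⌋ = skipped ((M : ℝ) + 1) u := by
    unfold skipped
    split_ifs with h0
    · have h0' : 0 ≤ ⌊((M : ℝ) + 1) * (0 - Real.log u)⌋ := by exact_mod_cast h0
      rw [one_mul, natCast_floor_eq_intCast_floor (Int.floor_nonneg.1 h0')]
    · have h0' : ⌊((M : ℝ) + 1) * (0 - Real.log u)⌋ < 0 := by
        rw [not_le] at h0
        exact_mod_cast h0
      have h1 : ((M : ℝ) + 1) * (0 - Real.log u) < 0 := by
        by_contra hc
        exact absurd (Int.floor_nonneg.2 (not_lt.1 hc)) (not_le.2 h0')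
      rw [Nat.floor_of_nonpos h1.le]
      simp
  have hb0 : 0 < base M := by have := one_lt_base M; omega
  have h2 := land.reduces (N := N) (by simp [land, Program.Straight]) K
    (stage M n n key pr 0 0 0 k x u 0 0 0 [] out (c + 1 + 1)) (by simp [land, Program.Safe]) hb
  have heff : land.effect (stage M n n key pr 0 0 0 k x u 0 0 0 [] out (c + 1 + 1)) =
      queryState M n key pr (occupant M n pr (x + skipped (M + 1) u)) 0 0 0 out (c + 1 + 1) := by
    simp only [land, queryState, stage, Program.effect, State.setReg, update_regs,
      List.length_cons, List.length_nil, Nat.reduceAdd, Nat.reduceLT, List.set_cons_succ,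
      List.set_cons_zero, value_digitT, value_baseT, Term.value, regs_succ, regs_zero,
      Int.cast_zero, Int.cast_one, hfloor, ← Nat.cast_add, rbase_natCast, rdigit_natCast hb0,
      occupant]
  rw [heff] at h2
  rw [hset, show c + jumpCost = c + 1 + 1 + land.cost by unfold jumpCost; ring]
  exact h2

/-! ### The light records -/

/-- The probability that none of the slots of record `k` is hit. -/
noncomputable def missProb (M n : ℕ) (pr : ℕ → ℝ) (k : ℕ) : ℝ :=
  Real.exp (-(1 / ((M : ℝ) + 1))) ^ weights M n pr k

theorem missProb_eq (M n : ℕ) (pr : ℕ → ℝ) (k : ℕ) :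
    missProb M n pr k = Real.exp (-((weights M n pr k : ℝ) / ((M : ℝ) + 1))) := by
  rw [missProb, ← Real.exp_nat_mul]
  congr 1
  ring

theorem exp_slot_mem (M : ℕ) : Real.exp (-(1 / ((M : ℝ) + 1))) ∈ Set.Icc (0 : ℝ) 1 :=
  ⟨(Real.exp_pos _).le, Real.exp_le_one_iff.2 (neg_nonpos.2 (by positivity))⟩

theorem missProb_mem (M n : ℕ) (pr : ℕ → ℝ) (k : ℕ) : missProb M n pr k ∈ Set.Icc (0 : ℝ) 1 :=
  ⟨pow_nonneg (exp_slot_mem M).1 _, pow_le_one₀ (exp_slot_mem M).1 (exp_slot_mem M).2⟩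

theorem missProb_lt_one {M n : ℕ} {pr : ℕ → ℝ} {k : ℕ} (hk : 0 < weights M n pr k) :
    missProb M n pr k < 1 := by
  rw [missProb_eq, Real.exp_lt_one_iff, neg_lt_zero]
  have : (0 : ℝ) < weights M n pr k := by exact_mod_cast hk
  positivity

theorem weights_pos_iff {M n : ℕ} {pr : ℕ → ℝ} {k : ℕ} :
    0 < weights M n pr k ↔ (1 ≤ k ∧ k ≤ n) ∧ 2 * pr k ≤ 1 := by
  unfold weights weight
  split_ifs with h1 h2 <;> simp [*]

/-- Rounding up gives a weight of at least `2 (M + 1) p`, so the record is missed with probability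
at most `exp (-2p) ≤ 1 / (1 + 2p) ≤ 1 - p`, where the last inequality needs `2p ≤ 1`. Hence the
acceptance probability of a hit record is at most `1`. -/
theorem prob_le_hitProb {M n : ℕ} {pr : ℕ → ℝ} {k : ℕ} (hk : 0 < weights M n pr k)
    (hp : 0 ≤ pr k) : pr k ≤ 1 - missProb M n pr k := by
  obtain ⟨hkn, h2⟩ := weights_pos_iff.1 hk
  have hM : (0 : ℝ) < M + 1 := by positivity
  have hw : 2 * ((M : ℝ) + 1) * pr k ≤ weights M n pr k := by
    rw [weights, if_pos hkn, weight, if_pos h2]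
    push_cast
    exact (Nat.lt_floor_add_one _).le
  have h3 : 2 * pr k ≤ (weights M n pr k : ℝ) / (M + 1) := by
    rw [le_div_iff₀ hM]
    linarith
  have h4 : missProb M n pr k ≤ Real.exp (-(2 * pr k)) := by
    rw [missProb_eq]
    exact Real.exp_le_exp.2 (by linarith)
  have h5 : Real.exp (-(2 * pr k)) ≤ 1 - pr k := by
    rw [Real.exp_neg]
    have h6 : 1 + 2 * pr k ≤ Real.exp (2 * pr k) := by
      linarith [Real.add_one_le_exp (2 * pr k)]
    refine (inv_anti₀ (by linarith) h6).trans ?_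
    rw [inv_eq_one_div, div_le_iff₀ (by linarith)]
    nlinarith
  linarith

/-- This is `1 - exp (-x) ≤ x` for `x = w / (M + 1)`; rounding up the weight costs at most `1 / (M +
1)`. -/
theorem hitProb_le {M n : ℕ} {pr : ℕ → ℝ} {k : ℕ} (hp : 0 ≤ pr k) :
    1 - missProb M n pr k ≤ 2 * pr k + 1 / ((M : ℝ) + 1) := by
  have hM : (0 : ℝ) < M + 1 := by positivity
  have hw : (weights M n pr k : ℝ) ≤ 2 * ((M : ℝ) + 1) * pr k + 1 := by
    unfold weights weight
    split_ifs
    · push_cast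
      have := Nat.floor_le (show 0 ≤ 2 * ((M : ℝ) + 1) * pr k by positivity)
      linarith
    · simp only [Nat.cast_zero]
      positivity
    · simp only [Nat.cast_zero]
      positivity
  have h1 := Real.add_one_le_exp (-((weights M n pr k : ℝ) / (M + 1)))
  have h2 : (weights M n pr k : ℝ) / (M + 1) ≤ 2 * pr k + 1 / (M + 1) := by
    rw [div_le_iff₀ hM, add_mul, one_div, inv_mul_cancel₀ hM.ne']
    linarith
  rw [missProb_eq]
  linarith

theorem exists_start_le {w : ℕ → ℕ} {i y : ℕ} (hi : start w i ≤ y) (j : ℕ) (hj : y < start w j) :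
    ∃ k, i ≤ k ∧ k < j ∧ start w k ≤ y ∧ y < start w (k + 1) := by
  induction j with
  | zero => simp [start] at hj
  | succ j ih =>
    rcases lt_or_ge y (start w j) with h | h
    · obtain ⟨k, h1, h2, h3⟩ := ih h
      exact ⟨k, h1, by omega, h3⟩
    · refine ⟨j, ?_, by omega, h, hj⟩
      by_contra hlt
      have := start_mono w (show j + 1 ≤ i by omega)
      omega

section occupant

variable {M n : ℕ} {key : ℕ → ℕ} {pr : ℕ → ℝ}

theorem occupant_eq (hn : n ≤ M) {k t : ℕ} (hk : k ≤ n) (ht : t < weights M n pr k) :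
    occupant M n pr (start (weights M n pr) k + t) = k :=
  slots_digit (one_lt_base M) (by have := add_two_lt_base M; omega) (by omega) ht

theorem occupant_eq_zero (hn : n ≤ M) {y : ℕ} (hy : start (weights M n pr) (n + 1) ≤ y) :
    occupant M n pr y = 0 := by
  refine slots_digit_of_le (one_lt_base M) (by have := add_two_lt_base M; omega) ?_
  have h : start (weights M n pr) (M + 1) = start (weights M n pr) (n + 1) := by
    refine (Finset.sum_subset (fun k hk => ?_) fun k _ hk => ?_).symm
    · simp only [Finset.mem_range] at hk ⊢
      omega
    · simp only [Finset.mem_range, not_lt] at hk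
      rw [weights, if_neg (by omega)]
  rwa [h]

/-- This gives progress: a jump from the end of one record stops or hits a strictly later one, so a
query halts whatever its random numbers are. -/
theorem occupant_cases (hn : n ≤ M) {i y : ℕ} (hy : start (weights M n pr) i ≤ y) :
    occupant M n pr y = 0 ∨
      ∃ k, i ≤ k ∧ k ≤ n ∧ 0 < weights M n pr k ∧ occupant M n pr y = k := by
  rcases le_or_gt (start (weights M n pr) (n + 1)) y with h | h
  · exact .inl (occupant_eq_zero hn h)
  · obtain ⟨k, hik, hkn, h1, h2⟩ := exists_start_le hy _ h
    obtain ⟨t, rfl⟩ := Nat.exists_eq_add_of_le h1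
    rw [start_succ] at h2
    exact .inr ⟨k, hik, by omega, by omega, occupant_eq hn (by omega) (by omega)⟩

end occupant

/-- The expected final value when the last `d` records are still to be sampled, where `F` is the
value after that and every record that is hit takes time `cost`. -/
noncomputable def lightValue (M n : ℕ) (key : ℕ → ℕ) (pr : ℕ → ℝ) (F : List ℝ → ℕ → ENNReal)
    (cost : ℕ) : ℕ → List ℝ → ℕ → ENNReal
  | 0, out, c => F out c
  | d + 1, out, c =>
    ENNReal.ofReal (missProb M n pr (n - d)) * lightValue M n key pr F cost d out c +
      ENNReal.ofReal (1 - missProb M n pr (n - d)) *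
        (ENNReal.ofReal (pr (n - d) / (1 - missProb M n pr (n - d))) *
            lightValue M n key pr F cost d ((key (n - d) : ℝ) :: out) (c + cost) +
          ENNReal.ofReal (1 - pr (n - d) / (1 - missProb M n pr (n - d))) *
            lightValue M n key pr F cost d out (c + cost))

/-- The expected final value when record `k` has been hit, or no record if `k = 0`. -/
noncomputable def hitValue (M n : ℕ) (key : ℕ → ℕ) (pr : ℕ → ℝ) (F : List ℝ → ℕ → ENNReal)
    (cost k : ℕ) (out : List ℝ) (c : ℕ) : ENNReal :=
  if k = 0 then F out c else
    ENNReal.ofReal (pr k / (1 - missProb M n pr k)) *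
        lightValue M n key pr F cost (n - k) ((key k : ℝ) :: out) (c + cost) +
      ENNReal.ofReal (1 - pr k / (1 - missProb M n pr k)) *
        lightValue M n key pr F cost (n - k) out (c + cost)

/-- A single jump may pass over many records, while `lightValue` decides them one at a time. By
memorylessness, skipping all slots of record `n - d` leaves a fresh jump from the next record, and
any shorter jump hits record `n - d`. -/
theorem tsum_hitValue {M n : ℕ} (hn : n ≤ M) (key : ℕ → ℕ) (pr : ℕ → ℝ)
    (F : List ℝ → ℕ → ENNReal) (cost : ℕ) (out : List ℝ) (c d : ℕ) (hd : d ≤ n) :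
    ∑' g, skipProb (Real.exp (-(1 / ((M : ℝ) + 1)))) g *
      hitValue M n key pr F cost (occupant M n pr (start (weights M n pr) (n - d + 1) + g)) out c =
    lightValue M n key pr F cost d out c := by
  induction d with
  | zero =>
    have h : ∀ g, occupant M n pr (start (weights M n pr) (n - 0 + 1) + g) = 0 := fun g =>
      occupant_eq_zero hn (by rw [Nat.sub_zero]; omega)
    simp only [h, hitValue, if_true]
    rw [ENNReal.tsum_mul_right, tsum_skipProb (by positivity), one_mul, lightValue]
  | succ d ih =>
    have hk : n - (d + 1) + 1 = n - d := by omega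
    rw [hk, tsum_skipProb_split (exp_slot_mem M) (weights M n pr (n - d)) _
      (hitValue M n key pr F cost (n - d) out c) fun g hg => by rw [occupant_eq hn (by omega) hg]]
    simp only [← add_assoc, ← start_succ]
    rw [ih (by omega), hitValue, if_neg (by omega), lightValue, show n - (n - d) = d by omega]
    rfl

/-- The time of the last test of `lightLoop`. -/
def lightExitCost : ℕ := 1 + (Term.reg 9).cost

/-- The time that a record takes that is hit. -/
def lightCost : ℕ := jumpCost + (1 + (Term.reg 9).cost) + 1 + lightStart.cost + 1 + flipCost

theorem lightStart_effect {M n : ℕ} (key : ℕ → ℕ) (pr : ℕ → ℝ) {k : ℕ} (hk : k ≤ M)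
    (out : List ℝ) (c : ℕ) :
    lightStart.effect (queryState M n key pr k 0 0 0 out c) =
      queryState M n key pr k (start (weights M n pr) (k + 1) : ℕ) 0 (1 - missProb M n pr k)
        out c := by
  have H := weights_spec M n pr
  simp only [lightStart, queryState, stage, Program.effect, State.setReg, update_regs,
    List.length_cons, List.length_nil, Nat.reduceAdd, Nat.reduceLT, List.set_cons_succ,
    List.set_cons_zero, value_prefixT, value_digitT, value_baseT, Term.value, regs_succ, regs_zero,
    Int.cast_zero, Int.cast_one, H.prefix_eq hk, H.digit_eq hk, zero_sub, missProb_eq]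

/-- Strong induction is needed because a hit of record `k` leaves `n - k` records, possibly far
fewer than `d - 1`. The next jump starts at the end of record `k`, as its other slots no longer
matter. -/
theorem light_spec {M n : ℕ} {key : ℕ → ℕ} {pr : ℕ → ℝ} (T : Table M n key pr) {N : ℕ}
    (hN : 2 * n + 2 ≤ N) {R : State → Prop} {f : State → ENNReal} {K : List Program}
    {G : List ℝ → ℕ → ENNReal}
    (h : ∀ out c, Spec N R f (K, queryState M n key pr 0 0 0 0 out c) (G out c)) (d : ℕ) :
    ∀ (_ : d ≤ n) (k : ℝ) (out : List ℝ) (c : ℕ),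
    Spec N R f (jump :: lightLoop :: K,
      queryState M n key pr k (start (weights M n pr) (n - d + 1) : ℕ) 0 0 out c)
      (lightValue M n key pr (fun out c => G out (c + jumpCost + lightExitCost)) lightCost
        d out c) := by
  induction d using Nat.strong_induction_on with
  | _ d ih =>
  intro hd k out c
  have hb := T.blank hN
  have hM := T.le
  rw [← tsum_hitValue hM _ _ _ _ _ _ _ hd]
  refine jump_spec T hN fun g => ?_
  rcases occupant_cases (pr := pr) hM (show start (weights M n pr) (n - d + 1) ≤
    start (weights M n pr) (n - d + 1) + g by omega) with h0 | ⟨k, hdk, hkn, hw, h0⟩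
  · rw [h0, hitValue, if_pos rfl]
    refine Spec.of_reduces (whileFalse_reduces hb ?_) ?_
    · simp only [Term.value, queryState, stage, regs_succ, regs_zero, Nat.cast_zero]
    · have h' := h out (c + jumpCost + lightExitCost)
      simp only [State.tick, queryState, stage, Nat.cast_zero] at h' ⊢
      exact h'
  · have hk0 : k ≠ 0 := by omega
    rw [h0, hitValue, if_neg hk0]
    have h1 : Reduces N 1 (lightLoop :: K, queryState M n key pr k 0 0 0 out (c + jumpCost))
        (lightBody :: lightLoop :: K, queryState M n key pr k 0 0 0 out
          (c + jumpCost + (1 + (Term.reg 9).cost))) := by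
      refine whileTrue_reduces hb ?_
      have : (k : ℝ) ≠ 0 := Nat.cast_ne_zero.2 hk0
      simpa only [Term.value, queryState, stage, regs_succ, regs_zero] using this
    have h2 : Reduces N 1 (lightBody :: lightLoop :: K, queryState M n key pr k 0 0 0 out
          (c + jumpCost + (1 + (Term.reg 9).cost)))
        (lightStart :: .seq flip jump :: lightLoop :: K, queryState M n key pr k 0 0 0 out
          (c + jumpCost + (1 + (Term.reg 9).cost) + 1)) := seq_reduces hb
    have h3 := lightStart.reduces (N := N) (by simp [lightStart, Program.Straight])
      (.seq flip jump :: lightLoop :: K) (queryState M n key pr k 0 0 0 out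
          (c + jumpCost + (1 + (Term.reg 9).cost) + 1)) (by simp [lightStart, Program.Safe]) hb
    rw [lightStart_effect key pr (show k ≤ M by omega)] at h3
    have h4 : Reduces N 1 (.seq flip jump :: lightLoop :: K,
        queryState M n key pr k (start (weights M n pr) (k + 1) : ℕ) 0 (1 - missProb M n pr k) out
          (c + jumpCost + (1 + (Term.reg 9).cost) + 1 + lightStart.cost))
        (flip :: jump :: lightLoop :: K,
        queryState M n key pr k (start (weights M n pr) (k + 1) : ℕ) 0 (1 - missProb M n pr k) out
          (c + jumpCost + (1 + (Term.reg 9).cost) + 1 + lightStart.cost + 1)) := seq_reduces hb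
    refine Spec.of_reduces (((h1.trans h2).trans h3).trans h4) ?_
    refine flip_spec T hN (by linarith [missProb_lt_one hw]) (prob_le_hitProb hw (T.prob k).1)
      (r := fun b => lightValue M n key pr (fun out c => G out (c + jumpCost + lightExitCost))
        lightCost (n - k) (if b then (key k : ℝ) :: out else out) (c + lightCost)) fun b => ?_
    have := ih (n - k) (by omega) (by omega) k (if b then (key k : ℝ) :: out else out)
      (c + lightCost)
    rw [show n - (n - k) + 1 = k + 1 by omega] at this
    convert this using 3
    unfold lightCost
    ring

/-! ### The heavy records -/

/-- The expected final value when the heavy records among the first `i` are still to be sampled,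
where `F` is the value after that and every heavy record takes time `cost`. -/
noncomputable def heavyValue (n : ℕ) (key : ℕ → ℕ) (pr : ℕ → ℝ) (F : List ℝ → ℕ → ENNReal)
    (cost : ℕ) : ℕ → List ℝ → ℕ → ENNReal
  | 0, out, c => F out c
  | i + 1, out, c =>
    if heavies n pr (i + 1) = 0 then heavyValue n key pr F cost i out c else
      ENNReal.ofReal (pr (i + 1)) *
          heavyValue n key pr F cost i ((key (i + 1) : ℝ) :: out) (c + cost) +
        ENNReal.ofReal (1 - pr (i + 1)) * heavyValue n key pr F cost i out (c + cost)

/-- The time of the last test of `heavyLoop`. -/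
def heavyExitCost : ℕ := 1 + (Term.reg 12).cost

/-- The time that a heavy record takes. -/
def heavyCost : ℕ :=
  (1 + (Term.reg 12).cost) + 1 + heavyStart.cost + 1 + flipCost + heavyEnd.cost

theorem heavyStart_effect {M n : ℕ} (key : ℕ → ℕ) (pr : ℕ → ℝ) {i : ℕ}
    (hi : heavies n pr i = 1) (out : List ℝ) (c : ℕ) :
    heavyStart.effect (queryState M n key pr 0 0 (pack 2 (i + 1) (heavies n pr) : ℕ) 0 out c) =
      queryState M n key pr i 0 (pack 2 (i + 1) (heavies n pr) : ℕ) 1 out c := by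
  have h := floor_logb_pack (w := heavies n pr) (k := i)
    (fun j _ => by have := (weights_spec M n pr).heavy_le j; omega) hi
  simp only [heavyStart, queryState, stage, Program.effect, State.setReg, update_regs,
    List.length_cons, List.length_nil, Nat.reduceAdd, Nat.reduceLT, List.set_cons_succ,
    List.set_cons_zero, Term.value, regs_succ, regs_zero, Int.cast_one, Int.cast_ofNat, h,
    Int.cast_natCast]

theorem heavyEnd_effect {M n : ℕ} (key : ℕ → ℕ) (pr : ℕ → ℝ) {i : ℕ}
    (hi : heavies n pr i = 1) (out : List ℝ) (c : ℕ) :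
    heavyEnd.effect (queryState M n key pr i 0 (pack 2 (i + 1) (heavies n pr) : ℕ) 0 out c) =
      queryState M n key pr 0 0 (pack 2 i (heavies n pr) : ℕ) 0 out c := by
  have h : (pack 2 (i + 1) (heavies n pr) : ℝ) - rpow 2 i = pack 2 i (heavies n pr) := by
    have h2 := rpow_natCast (b := 2) (by omega) i
    push_cast at h2
    rw [pack_succ, hi, h2]
    push_cast
    ring
  simp only [heavyEnd, queryState, stage, Program.effect, State.setReg, update_regs,
    List.length_cons, List.length_nil, Nat.reduceAdd, Nat.reduceLT, List.set_cons_succ,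
    List.set_cons_zero, value_powT, Term.value, regs_succ, regs_zero, Int.cast_zero,
    Int.cast_ofNat, h]

/-- A vanishing bit `i + 1` does not change the number in register 12 and costs no time; otherwise
it is the top bit, which the logarithm finds. So only the heavy records take time. -/
theorem heavy_spec {M n : ℕ} {key : ℕ → ℕ} {pr : ℕ → ℝ} (T : Table M n key pr) {N : ℕ}
    (hN : 2 * n + 2 ≤ N) {R : State → Prop} {f : State → ENNReal} {K : List Program}
    {G : List ℝ → ℕ → ENNReal}
    (h : ∀ out c, Spec N R f (K, queryState M n key pr 0 0 0 0 out c) (G out c)) (i : ℕ) :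
    ∀ (out : List ℝ) (c : ℕ),
    Spec N R f (heavyLoop :: K,
      queryState M n key pr 0 0 (pack 2 (i + 1) (heavies n pr) : ℕ) 0 out c)
      (heavyValue n key pr (fun out c => G out (c + heavyExitCost)) heavyCost i out c) := by
  have hb := T.blank hN
  induction i with
  | zero =>
    intro out c
    have h0 : pack 2 (0 + 1) (heavies n pr) = 0 := by simp [pack, heavies]
    rw [h0, Nat.cast_zero]
    refine Spec.of_reduces (whileFalse_reduces hb ?_) (h out (c + heavyExitCost))
    simp only [Term.value, queryState, stage, regs_succ, regs_zero]
  | succ i ih =>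
    intro out c
    rw [heavyValue]
    by_cases hi : heavies n pr (i + 1) = 0
    · rw [if_pos hi, pack_succ, hi, zero_mul, add_zero]
      exact ih out c
    · rw [if_neg hi]
      have hi1 : heavies n pr (i + 1) = 1 := by
        have := (weights_spec M n pr).heavy_le (i + 1)
        omega
      have hp : pr (i + 1) ≤ 1 := (T.prob (i + 1)).2
      have h1 : Reduces N 1 (heavyLoop :: K,
            queryState M n key pr 0 0 (pack 2 (i + 1 + 1) (heavies n pr) : ℕ) 0 out c)
          (heavyBody :: heavyLoop :: K,
            queryState M n key pr 0 0 (pack 2 (i + 1 + 1) (heavies n pr) : ℕ) 0 out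
            (c + (1 + (Term.reg 12).cost))) := by
        refine whileTrue_reduces hb ?_
        have : (pack 2 (i + 1 + 1) (heavies n pr) : ℝ) ≠ 0 := by
          rw [pack_succ, hi1]
          exact Nat.cast_ne_zero.2 (by positivity)
        simpa only [Term.value, queryState, stage, regs_succ, regs_zero] using this
      have h2 : Reduces N 1 (heavyBody :: heavyLoop :: K,
            queryState M n key pr 0 0 (pack 2 (i + 1 + 1) (heavies n pr) : ℕ) 0 out
            (c + (1 + (Term.reg 12).cost)))
          (heavyStart :: .seq flip heavyEnd :: heavyLoop :: K,
            queryState M n key pr 0 0 (pack 2 (i + 1 + 1) (heavies n pr) : ℕ) 0 out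
            (c + (1 + (Term.reg 12).cost) + 1)) := seq_reduces hb
      have h3 := heavyStart.reduces (N := N) (by simp [heavyStart, Program.Straight])
        (.seq flip heavyEnd :: heavyLoop :: K)
        (queryState M n key pr 0 0 (pack 2 (i + 1 + 1) (heavies n pr) : ℕ) 0 out
            (c + (1 + (Term.reg 12).cost) + 1)) (by simp [heavyStart, Program.Safe]) hb
      rw [heavyStart_effect key pr hi1] at h3
      have h4 : Reduces N 1 (.seq flip heavyEnd :: heavyLoop :: K,
            queryState M n key pr (i + 1 : ℕ) 0 (pack 2 (i + 1 + 1) (heavies n pr) : ℕ) 1 out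
            (c + (1 + (Term.reg 12).cost) + 1 + heavyStart.cost))
          (flip :: heavyEnd :: heavyLoop :: K,
            queryState M n key pr (i + 1 : ℕ) 0 (pack 2 (i + 1 + 1) (heavies n pr) : ℕ) 1 out
            (c + (1 + (Term.reg 12).cost) + 1 + heavyStart.cost + 1)) := seq_reduces hb
      refine Spec.of_reduces (((h1.trans h2).trans h3).trans h4) ?_
      have h5 := flip_spec T hN (k := i + 1) one_pos hp (x := 0)
        (j := (pack 2 (i + 1 + 1) (heavies n pr) : ℕ)) (R := R) (f := f) (out := out)
        (c := c + (1 + (Term.reg 12).cost) + 1 + heavyStart.cost + 1)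
        (K := heavyEnd :: heavyLoop :: K)
        (r := fun b => heavyValue n key pr (fun out c => G out (c + heavyExitCost)) heavyCost i
          (if b then (key (i + 1) : ℝ) :: out else out) (c + heavyCost)) fun b => ?_
      · rw [div_one] at h5
        exact h5
      have h6 := heavyEnd.reduces (N := N) (by simp [heavyEnd, Program.Straight])
        (heavyLoop :: K) (queryState M n key pr (i + 1 : ℕ) 0
          (pack 2 (i + 1 + 1) (heavies n pr) : ℕ) 0 (if b then (key (i + 1) : ℝ) :: out else out)
          (c + (1 + (Term.reg 12).cost) + 1 + heavyStart.cost + 1 + flipCost))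
        (by simp [heavyEnd, Program.Safe]) hb
      rw [heavyEnd_effect key pr hi1] at h6
      exact Spec.of_reduces h6 (ih _ _)

/-! ### The whole query -/

/-- The time of a query before the first loop. -/
def queryStartCost : ℕ := 1 + (Program.assign 12 (.reg 5)).cost + 1

theorem query_spec {M n : ℕ} {key : ℕ → ℕ} {pr : ℕ → ℝ} (T : Table M n key pr) {N : ℕ}
    (hN : 2 * n + 2 ≤ N) (f : State → ENNReal) :
    Spec N (fun s => ∃ out c, s = machine M n key pr 0 [] out c) f
      ([queryProgram], machine M n key pr 0 [] [] 0)
      (heavyValue n key pr (fun out c =>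
        lightValue M n key pr (fun out c => f (machine M n key pr 0 [] out
          (c + jumpCost + lightExitCost))) lightCost n out (c + heavyExitCost + 1))
        heavyCost n [] queryStartCost) := by
  have hb := T.blank hN
  have hM := T.le
  have hpack : pack 2 (M + 1) (heavies n pr) = pack 2 (n + 1) (heavies n pr) := by
    refine (Finset.sum_subset (fun k hk => ?_) fun k _ hk => ?_).symm
    · simp only [Finset.mem_range] at hk ⊢
      omega
    · simp only [Finset.mem_range, not_lt] at hk
      rw [heavies, if_neg (by omega), zero_mul]
  have h1 : Reduces N 1 ([queryProgram], machine M n key pr 0 [] [] 0)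
      ([.assign 12 (.reg 5), .seq heavyLoop (.seq jump lightLoop)],
        machine M n key pr 0 [] [] 1) := seq_reduces hb
  have h2 : Reduces N 1 ([.assign 12 (.reg 5), .seq heavyLoop (.seq jump lightLoop)],
        machine M n key pr 0 [] [] 1)
      ([.seq heavyLoop (.seq jump lightLoop)],
        queryState M n key pr 0 0 (pack 2 (n + 1) (heavies n pr) : ℕ) 0 []
          (1 + (Program.assign 12 (.reg 5)).cost)) := by
    refine .single hb fun _ => ?_
    rw [← hpack]
    simp only [step, Program.cost, machine, queryState, stage, State.setReg, State.tick,
      update_regs, List.length_cons, List.length_nil, Nat.reduceAdd, Nat.reduceLT,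
      List.set_cons_succ, List.set_cons_zero, Term.value, regs_succ, regs_zero]
  have h3 : Reduces N 1 ([.seq heavyLoop (.seq jump lightLoop)],
        queryState M n key pr 0 0 (pack 2 (n + 1) (heavies n pr) : ℕ) 0 []
          (1 + (Program.assign 12 (.reg 5)).cost))
      (heavyLoop :: [.seq jump lightLoop],
        queryState M n key pr 0 0 (pack 2 (n + 1) (heavies n pr) : ℕ) 0 [] queryStartCost) :=
    seq_reduces hb
  refine Spec.of_reduces ((h1.trans h2).trans h3) ?_
  refine heavy_spec T hN (G := fun out c => lightValue M n key pr (fun out c =>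
    f (machine M n key pr 0 [] out (c + jumpCost + lightExitCost))) lightCost n out (c + 1))
    (fun out c => ?_) n [] queryStartCost
  have h4 : Reduces N 1 ([.seq jump lightLoop], queryState M n key pr 0 0 0 0 out c)
      (jump :: lightLoop :: [], queryState M n key pr 0 0 0 0 out (c + 1)) := seq_reduces hb
  refine Spec.of_reduces h4 ?_
  have h5 := light_spec T hN (R := fun s => ∃ out c, s = machine M n key pr 0 [] out c) (f := f)
    (K := []) (G := fun out c => f (machine M n key pr 0 [] out c))
    (fun out c => Spec.nil f hb ⟨out, c, rfl⟩) n le_rfl 0 out (c + 1)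
  -- Index `0` has no slots, so position `0` is where record `1` starts and all `n` records are
  -- still pending.
  have h0 : start (weights M n pr) (n - n + 1) = 0 := by
    simp [start, weights]
  rw [h0, Nat.cast_zero] at h5
  exact h5

/-! ### The distribution of the sample -/

/-- The probability that the records with the indices `A`, together with a random subset of those
with the indices `L`, are those with the indices `T`. -/
noncomputable def completionProb (pr : ℕ → ℝ) (T L A : Finset ℕ) : ENNReal :=
  if A = T \ L then ∏ k ∈ L, ENNReal.ofReal (if k ∈ T then pr k else 1 - pr k) else 0

/-- Only one decision about `k` is compatible with the answer: it is reported if `k ∈ T` and left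
out otherwise, and the other summand is `0`. -/
theorem completionProb_insert (pr : ℕ → ℝ) (T : Finset ℕ) {L A : Finset ℕ} {k : ℕ} (hL : k ∉ L)
    (hA : k ∉ A) :
    completionProb pr T (insert k L) A =
      ENNReal.ofReal (pr k) * completionProb pr T L (insert k A) +
        ENNReal.ofReal (1 - pr k) * completionProb pr T L A := by
  unfold completionProb
  rw [Finset.prod_insert hL]
  by_cases hT : k ∈ T
  · have h1 : insert k A = T \ L ↔ A = T \ insert k L := by
      constructor
      · intro h
        rw [Finset.sdiff_insert, ← h, Finset.erase_insert hA]
      · intro h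
        rw [h, Finset.sdiff_insert, Finset.insert_erase (by simp [hT, hL])]
    have h2 : A ≠ T \ L := fun h => hA (h ▸ by simp [hT, hL])
    simp only [hT, h1, h2, if_true, if_false, mul_zero, add_zero, mul_ite]
  · have h1 : T \ insert k L = T \ L := by
      rw [Finset.sdiff_insert, Finset.erase_eq_of_notMem (by simp [hT])]
    have h2 : insert k A ≠ T \ L := fun h => hT
      (Finset.mem_sdiff.1 (h ▸ Finset.mem_insert_self k A)).1
    simp only [hT, h1, h2, if_false, mul_zero, zero_add, mul_ite]

/-- The output consists of the keys of the records with the indices `A`. -/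
def Reports (key : ℕ → ℕ) (out : List ℝ) (A : Finset ℕ) : Prop :=
  (out : Multiset ℝ) = A.val.map fun k => (key k : ℝ)

theorem Reports.cons {key : ℕ → ℕ} {out : List ℝ} {A : Finset ℕ} (h : Reports key out A) {k : ℕ}
    (hk : k ∉ A) : Reports key ((key k : ℝ) :: out) (insert k A) := by
  unfold Reports at *
  rw [Finset.insert_val_of_notMem hk, Multiset.map_cons, ← h, Multiset.cons_coe]

/-- If it is not yet decided about the records with the indices `L`, then `F` is the probability of
the answer `T`. -/
def IsCompletion (key : ℕ → ℕ) (pr : ℕ → ℝ) (n : ℕ) (T L : Finset ℕ)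
    (F : List ℝ → ℕ → ENNReal) : Prop :=
  ∀ out c A, A ⊆ Finset.Icc 1 n → Disjoint A L → Reports key out A →
    F out c = completionProb pr T L A

/-- The probability `1 - pr k` comes in two parts, since a light record may be left out because it
is not hit or because it is hit and rejected. These differ in time, but the clock has no influence
on the answer. -/
theorem IsCompletion.extend {key : ℕ → ℕ} {pr : ℕ → ℝ} {n : ℕ} {T L : Finset ℕ}
    {F G : List ℝ → ℕ → ENNReal} (h : IsCompletion key pr n T L F) {k : ℕ}
    (hk : k ∈ Finset.Icc 1 n) (hL : k ∉ L)
    (hG : ∀ out c, ∃ c₁ c₂ c₃, ∃ x y : ENNReal, x + y = ENNReal.ofReal (1 - pr k) ∧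
      G out c = ENNReal.ofReal (pr k) * F ((key k : ℝ) :: out) c₁ + x * F out c₂ + y * F out c₃) :
    IsCompletion key pr n T (insert k L) G := by
  intro out c A hAn hAL hout
  rw [Finset.disjoint_insert_right] at hAL
  obtain ⟨c₁, c₂, c₃, x, y, hxy, hG⟩ := hG out c
  rw [hG, completionProb_insert pr T hL hAL.1, ← hxy,
    h _ c₁ (insert k A) (Finset.insert_subset hk hAn)
      (Finset.disjoint_insert_left.2 ⟨hL, hAL.2⟩) (hout.cons hAL.1),
    h _ c₂ A hAn hAL.2 hout, h _ c₃ A hAn hAL.2 hout, add_mul, add_assoc]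

/-- Without slots the miss probability is `1`; the branch with the division by zero has the factor
`0`. -/
theorem lightValue_of_weight_eq_zero {M n : ℕ} {key : ℕ → ℕ} {pr : ℕ → ℝ}
    {F : List ℝ → ℕ → ENNReal} {cost d : ℕ} (h : weights M n pr (n - d) = 0) :
    lightValue M n key pr F cost (d + 1) = lightValue M n key pr F cost d := by
  ext out c
  simp [lightValue, missProb, h]

theorem lightValue_isCompletion {M n : ℕ} {key : ℕ → ℕ} {pr : ℕ → ℝ}
    (hpr : ∀ k, pr k ∈ Set.Icc (0 : ℝ) 1) {T : Finset ℕ} {F : List ℝ → ℕ → ENNReal}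
    (h : IsCompletion key pr n T ∅ F) (cost d : ℕ) (hd : d ≤ n) :
    IsCompletion key pr n T {k ∈ Finset.Icc (n - d + 1) n | 0 < weights M n pr k}
      (lightValue M n key pr F cost d) := by
  induction d with
  | zero =>
    rw [Finset.Icc_eq_empty (by omega)]
    exact h
  | succ d ih =>
    have hI : Finset.Icc (n - (d + 1) + 1) n = insert (n - d) (Finset.Icc (n - d + 1) n) := by
      ext k
      simp only [Finset.mem_insert, Finset.mem_Icc]
      omega
    rw [hI, Finset.filter_insert]
    split_ifs with hw
    · refine (ih (by omega)).extend (by simp only [Finset.mem_Icc]; omega)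
        (by simp only [Finset.mem_filter, Finset.mem_Icc]; omega) fun out c => ?_
      have h1 := prob_le_hitProb hw (hpr _).1
      have h2 := missProb_mem M n pr (n - d)
      have h3 : 0 < 1 - missProb M n pr (n - d) := by linarith [missProb_lt_one hw]
      have h0 := (hpr (n - d)).1
      -- The two parts of `1 - p` are the miss probability `m` and `(1 - m) * (1 - p / (1 - m)) = 1
      -- - m - p`; only in the second case does time pass.
      refine ⟨c + cost, c, c + cost, ENNReal.ofReal (missProb M n pr (n - d)),
        ENNReal.ofReal (1 - missProb M n pr (n - d) - pr (n - d)), ?_, ?_⟩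
      · rw [← ENNReal.ofReal_add h2.1 (by linarith)]
        congr 1
        ring
      · rw [lightValue, mul_add, ← mul_assoc, ← mul_assoc, ← ENNReal.ofReal_mul h3.le,
          ← ENNReal.ofReal_mul h3.le, mul_sub, mul_one, mul_div_cancel₀ _ h3.ne']
        ring
    · rw [lightValue_of_weight_eq_zero (by omega)]
      exact ih (by omega)

theorem heavyValue_isCompletion {n : ℕ} {key : ℕ → ℕ} {pr : ℕ → ℝ} {T L : Finset ℕ}
    {F : List ℝ → ℕ → ENNReal} (h : IsCompletion key pr n T L F)
    (hL : ∀ k ∈ L, heavies n pr k = 0) (cost i : ℕ) (hi : i ≤ n) :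
    IsCompletion key pr n T ({k ∈ Finset.Icc 1 i | heavies n pr k ≠ 0} ∪ L)
      (heavyValue n key pr F cost i) := by
  induction i with
  | zero =>
    rw [Finset.Icc_eq_empty (by omega), Finset.filter_empty, Finset.empty_union]
    exact h
  | succ i ih =>
    rw [← Finset.insert_Icc_right_eq_Icc_add_one (by omega), Finset.filter_insert]
    split_ifs with hw
    · rw [Finset.insert_union]
      refine (ih (by omega)).extend (by simp only [Finset.mem_Icc]; omega) ?_ fun out c => ?_
      · simp only [Finset.mem_union, Finset.mem_filter, Finset.mem_Icc, not_or]
        exact ⟨by omega, fun hk => hw (hL _ hk)⟩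
      · refine ⟨c + cost, c + cost, c + cost, _, 0, add_zero _, ?_⟩
        rw [heavyValue, if_neg hw, zero_mul, add_zero]
    · rw [not_not] at hw
      have : heavyValue n key pr F cost (i + 1) = heavyValue n key pr F cost i := by
        ext out c
        rw [heavyValue, if_pos hw]
      rw [this]
      exact ih (by omega)

open Classical in
/-- Whether the output of a query is `T`. -/
noncomputable def answerIndicator (T : Finset ℕ) (s : State) : ENNReal :=
  if (s.output : Multiset ℝ) = T.val.map fun v : ℕ => (v : ℝ) then 1 else 0

theorem Represents.prod_eq {I : Instance} {M n : ℕ} {key : ℕ → ℕ} {pr : ℕ → ℝ}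
    (h : Represents I M n key pr) (f : ℕ → ℝ → ENNReal) :
    ∏ k ∈ Finset.Icc 1 n, f (key k) (pr k) = ∏ v ∈ I.S, f v (I.p v) := by
  rw [← h.image, Finset.prod_image h.inj]
  exact Finset.prod_congr rfl fun k hk => by rw [h.prob_eq k hk]

theorem Represents.sampleProb_eq {I : Instance} {M n : ℕ} {key : ℕ → ℕ} {pr : ℕ → ℝ}
    (h : Represents I M n key pr) {T : Finset ℕ} (hT : T ⊆ I.S) :
    completionProb pr {k ∈ Finset.Icc 1 n | key k ∈ T} (Finset.Icc 1 n) ∅ =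
      ENNReal.ofReal (I.sampleProb T) := by
  have hp : ∀ v ∈ I.S, I.p v ∈ Set.Icc (0 : ℝ) 1 := by
    intro v hv
    obtain ⟨k, hk, rfl⟩ := h.exists_index hv
    exact h.prob_eq k hk ▸ h.prob k
  rw [completionProb, if_pos (by rw [Finset.sdiff_eq_empty_iff_subset.2 (Finset.filter_subset _ _)])]
  have h1 := h.prod_eq fun v x => ENNReal.ofReal (if v ∈ T then x else 1 - x)
  have h2 : ∀ k ∈ Finset.Icc 1 n, ENNReal.ofReal
      (if k ∈ {k ∈ Finset.Icc 1 n | key k ∈ T} then pr k else 1 - pr k) =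
      ENNReal.ofReal (if key k ∈ T then pr k else 1 - pr k) := fun k hk => by
    simp only [Finset.mem_filter, hk, true_and]
  rw [Finset.prod_congr rfl h2, h1, Instance.sampleProb, ← ENNReal.ofReal_prod_of_nonneg]
  · congr 1
    rw [← Finset.prod_sdiff hT, mul_comm]
    congr 1
    · exact Finset.prod_congr rfl fun v hv => by rw [if_pos hv]
    · exact Finset.prod_congr rfl fun v hv => by rw [if_neg (Finset.mem_sdiff.1 hv).2]
  · intro v hv
    have := hp v hv
    split_ifs
    · exact this.1
    · linarith [this.2]

theorem Represents.reports_iff {I : Instance} {M n : ℕ} {key : ℕ → ℕ} {pr : ℕ → ℝ}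
    (h : Represents I M n key pr) {T : Finset ℕ} (hT : T ⊆ I.S) {out : List ℝ} {A : Finset ℕ}
    (hA : A ⊆ Finset.Icc 1 n) (hout : Reports key out A) :
    (out : Multiset ℝ) = T.val.map (fun v : ℕ => (v : ℝ)) ↔
      A = {k ∈ Finset.Icc 1 n | key k ∈ T} := by
  have h1 : (out : Multiset ℝ) = (A.image key).val.map fun v : ℕ => (v : ℝ) := by
    rw [hout, Finset.image_val_of_injOn (h.inj.mono (Finset.coe_subset.2 hA)), Multiset.map_map]
    rfl
  rw [h1, (Multiset.map_injective Nat.cast_injective).eq_iff, Finset.val_inj]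
  constructor
  · rintro rfl
    ext k
    simp only [Finset.mem_filter]
    refine ⟨fun hk => ⟨hA hk, Finset.mem_image_of_mem key hk⟩, fun ⟨hk, hk'⟩ => ?_⟩
    obtain ⟨j, hj, hjk⟩ := Finset.mem_image.1 hk'
    exact h.inj (hA hj) hk hjk ▸ hj
  · rintro rfl
    ext v
    simp only [Finset.mem_image, Finset.mem_filter]
    constructor
    · rintro ⟨k, ⟨-, hk⟩, rfl⟩
      exact hk
    · intro hv
      obtain ⟨k, hk, rfl⟩ := h.exists_index (hT hv)
      exact ⟨k, ⟨hk, hv⟩, rfl⟩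

theorem query_answer {I : Instance} {M n : ℕ} {key : ℕ → ℕ} {pr : ℕ → ℝ}
    (h : Represents I M n key pr) {T : Finset ℕ} (hT : T ⊆ I.S) {N : ℕ} (hN : 2 * n + 2 ≤ N) :
    Spec N (fun s => ∃ out c, s = machine M n key pr 0 [] out c) (answerIndicator T)
      ([queryProgram], machine M n key pr 0 [] [] 0) (ENNReal.ofReal (I.sampleProb T)) := by
  have hq := query_spec h.toTable hN (answerIndicator T)
  have h0 : IsCompletion key pr n {k ∈ Finset.Icc 1 n | key k ∈ T} ∅ fun out c =>
      answerIndicator T (machine M n key pr 0 [] out (c + jumpCost + lightExitCost)) := by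
    intro out c A hA _ hout
    have := h.reports_iff hT hA hout
    simp only [answerIndicator, machine, stage, this, completionProb, Finset.sdiff_empty,
      Finset.prod_empty]
  have h1 := lightValue_isCompletion (M := M) h.prob h0 lightCost n le_rfl
  have h2 : IsCompletion key pr n {k ∈ Finset.Icc 1 n | key k ∈ T}
      {k ∈ Finset.Icc (n - n + 1) n | 0 < weights M n pr k} fun out c => lightValue M n key pr
        (fun out c => answerIndicator T (machine M n key pr 0 [] out
          (c + jumpCost + lightExitCost))) lightCost n out (c + heavyExitCost + 1) :=
    fun out c => h1 out _
  have h3 := heavyValue_isCompletion h2 (fun k hk => by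
    have := (weights_pos_iff.1 (Finset.mem_filter.1 hk).2)
    rw [heavies, if_pos this.1, heavy, if_pos this.2]) heavyCost n le_rfl
  -- A record that is not heavy has at least one slot, even if its probability is `0`, so each
  -- record is decided in one of the two phases.
  have h4 : {k ∈ Finset.Icc 1 n | heavies n pr k ≠ 0} ∪
      {k ∈ Finset.Icc (n - n + 1) n | 0 < weights M n pr k} = Finset.Icc 1 n := by
    rw [Nat.sub_self, zero_add, ← Finset.filter_or, Finset.filter_eq_self]
    intro k hk
    have hk' := Finset.mem_Icc.1 hk
    by_cases hp : 2 * pr k ≤ 1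
    · exact .inr (weights_pos_iff.2 ⟨hk', hp⟩)
    · refine .inl ?_
      rw [heavies, if_pos hk', heavy, if_neg hp]
      exact one_ne_zero
  rw [h4] at h3
  rw [h3 [] queryStartCost ∅ (Finset.empty_subset _) (Finset.disjoint_empty_left _) rfl,
    h.sampleProb_eq hT] at hq
  exact hq

/-! ### The expected time of a query -/

theorem mix_le {x y a : ENNReal} {q : ℝ} (hq : q ∈ Set.Icc (0 : ℝ) 1) (hx : x ≤ a) (hy : y ≤ a) :
    ENNReal.ofReal q * x + ENNReal.ofReal (1 - q) * y ≤ a := by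
  calc ENNReal.ofReal q * x + ENNReal.ofReal (1 - q) * y
      ≤ ENNReal.ofReal q * a + ENNReal.ofReal (1 - q) * a := by gcongr
    _ = a := by
      rw [← add_mul, ← ENNReal.ofReal_add hq.1 (by linarith [hq.2]), add_sub_cancel,
        ENNReal.ofReal_one, one_mul]

/-- All continuations obey the same bound up to `cost`, so each record adds `cost` times its hit
probability, whatever has been reported before. -/
theorem lightValue_le {M n : ℕ} {key : ℕ → ℕ} {pr : ℕ → ℝ} (hpr : ∀ k, pr k ∈ Set.Icc (0 : ℝ) 1)
    {F : List ℝ → ℕ → ENNReal} {A : ENNReal} (hF : ∀ out c, F out c ≤ c + A) (cost d : ℕ)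
    (hd : d ≤ n) (out : List ℝ) (c : ℕ) :
    lightValue M n key pr F cost d out c ≤
      c + A + cost * ∑ k ∈ Finset.Icc (n - d + 1) n, ENNReal.ofReal (1 - missProb M n pr k) := by
  induction d generalizing out c with
  | zero => exact (hF out c).trans le_self_add
  | succ d ih =>
    have hI : Finset.Icc (n - (d + 1) + 1) n = insert (n - d) (Finset.Icc (n - d + 1) n) := by
      ext k
      simp only [Finset.mem_insert, Finset.mem_Icc]
      omega
    rw [hI, Finset.sum_insert (by simp only [Finset.mem_Icc]; omega)]
    set S := ∑ k ∈ Finset.Icc (n - d + 1) n, ENNReal.ofReal (1 - missProb M n pr k)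
    have ih := fun out c => ih (by omega) out c
    rcases Nat.eq_zero_or_pos (weights M n pr (n - d)) with hw | hw
    · rw [lightValue_of_weight_eq_zero hw]
      refine (ih out c).trans ?_
      gcongr
      exact le_add_self
    · have h1 := prob_le_hitProb hw (hpr _).1
      have h2 := missProb_mem M n pr (n - d)
      have h3 : 0 < 1 - missProb M n pr (n - d) := by linarith [missProb_lt_one hw]
      have hq : pr (n - d) / (1 - missProb M n pr (n - d)) ∈ Set.Icc (0 : ℝ) 1 :=
        ⟨div_nonneg (hpr _).1 h3.le, (div_le_one h3).2 h1⟩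
      have h4 := mix_le hq (ih ((key (n - d) : ℝ) :: out) (c + cost)) (ih out (c + cost))
      have h5 : (((c + cost : ℕ) : ENNReal) + A + cost * S) = cost + (c + A + cost * S) := by
        push_cast
        ring
      rw [h5] at h4
      rw [lightValue]
      calc _ ≤ ENNReal.ofReal (missProb M n pr (n - d)) * (c + A + cost * S) +
            ENNReal.ofReal (1 - missProb M n pr (n - d)) * (cost + (c + A + cost * S)) := by
              gcongr
              exact ih out c
        _ = (ENNReal.ofReal (missProb M n pr (n - d)) * (c + A + cost * S) +
              ENNReal.ofReal (1 - missProb M n pr (n - d)) * (c + A + cost * S)) +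
            cost * ENNReal.ofReal (1 - missProb M n pr (n - d)) := by ring
        _ ≤ (c + A + cost * S) + cost * ENNReal.ofReal (1 - missProb M n pr (n - d)) := by
              exact add_le_add (mix_le h2 le_rfl le_rfl) le_rfl
        _ = _ := by ring

theorem heavyValue_le {n : ℕ} {key : ℕ → ℕ} {pr : ℕ → ℝ} (hpr : ∀ k, pr k ∈ Set.Icc (0 : ℝ) 1)
    {F : List ℝ → ℕ → ENNReal} {A : ENNReal} (hF : ∀ out c, F out c ≤ c + A) (cost i : ℕ)
    (out : List ℝ) (c : ℕ) :
    heavyValue n key pr F cost i out c ≤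
      c + A + cost * ∑ k ∈ Finset.Icc 1 i, (heavies n pr k : ENNReal) := by
  induction i generalizing out c with
  | zero => exact (hF out c).trans le_self_add
  | succ i ih =>
    rw [Finset.sum_Icc_succ_top (by omega), heavyValue]
    split_ifs with h
    · refine (ih out c).trans ?_
      rw [h, Nat.cast_zero, add_zero]
    · have h1 : heavies n pr (i + 1) = 1 := by
        have := (weights_spec 0 n pr).heavy_le (i + 1)
        omega
      refine (mix_le (hpr _) (ih _ _) (ih _ _)).trans (le_of_eq ?_)
      rw [h1]
      push_cast
      ring

/-- The `n` rounding errors of `1 / (M + 1)` add up to at most `1` because `n ≤ M`; no upper bound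
on `M` is needed. -/
theorem sum_hitProb_le {M n : ℕ} (hn : n ≤ M) {pr : ℕ → ℝ} (hpr : ∀ k, 0 ≤ pr k) :
    ∑ k ∈ Finset.Icc 1 n, (1 - missProb M n pr k) ≤ 2 * ∑ k ∈ Finset.Icc 1 n, pr k + 1 := by
  calc ∑ k ∈ Finset.Icc 1 n, (1 - missProb M n pr k)
      ≤ ∑ k ∈ Finset.Icc 1 n, (2 * pr k + 1 / ((M : ℝ) + 1)) :=
        Finset.sum_le_sum fun k _ => hitProb_le (hpr k)
    _ = 2 * ∑ k ∈ Finset.Icc 1 n, pr k + n / ((M : ℝ) + 1) := by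
        rw [Finset.sum_add_distrib, Finset.mul_sum, Finset.sum_const, Nat.card_Icc, nsmul_eq_mul,
          Nat.add_sub_cancel]
        ring
    _ ≤ _ := by
        gcongr
        rw [div_le_one (by positivity)]
        have : (n : ℝ) ≤ M := by exact_mod_cast hn
        linarith

theorem sum_heavies_le {n : ℕ} {pr : ℕ → ℝ} (hpr : ∀ k, 0 ≤ pr k) :
    ∑ k ∈ Finset.Icc 1 n, (heavies n pr k : ℝ) ≤ 2 * ∑ k ∈ Finset.Icc 1 n, pr k := by
  rw [Finset.mul_sum]
  refine Finset.sum_le_sum fun k _ => ?_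
  have := hpr k
  unfold heavies heavy
  split_ifs <;> push_cast <;> linarith

/-- The time of a query per unit of the expected size of the sample. -/
def queryCost : ℕ :=
  queryStartCost + heavyExitCost + 1 + jumpCost + lightExitCost + 2 * lightCost + 2 * heavyCost

theorem query_time {I : Instance} {M n : ℕ} {key : ℕ → ℕ} {pr : ℕ → ℝ}
    (h : Represents I M n key pr) {N : ℕ} (hN : 2 * n + 2 ≤ N) :
    ∃ r ≤ ENNReal.ofReal (queryCost * (1 + I.mu)),
      Spec N (fun s => ∃ out c, s = machine M n key pr 0 [] out c) (fun s => s.clock)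
        ([queryProgram], machine M n key pr 0 [] [] 0) r := by
  refine ⟨_, ?_, query_spec h.toTable hN _⟩
  have hmu : I.mu = ∑ k ∈ Finset.Icc 1 n, pr k := by
    rw [Instance.mu, ← h.image, Finset.sum_image h.inj]
    exact Finset.sum_congr rfl fun k hk => (h.prob_eq k hk).symm
  have hpr : ∀ k, 0 ≤ pr k := fun k => (h.prob k).1
  have hmu0 : 0 ≤ I.mu := hmu ▸ Finset.sum_nonneg fun k _ => hpr k
  have h1 := fun out c => lightValue_le (M := M) (key := key) h.prob
    (F := fun out c => ((machine M n key pr 0 [] out (c + jumpCost + lightExitCost)).clock : ENNReal))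
    (A := (jumpCost + lightExitCost : ℕ)) (fun out c => by
      simp only [machine, stage]
      push_cast
      rw [add_assoc]) lightCost n le_rfl out (c + heavyExitCost + 1)
  rw [Nat.sub_self, zero_add, ← ENNReal.ofReal_sum_of_nonneg fun k _ =>
    by linarith [(missProb_mem M n pr k).2]] at h1
  have h2 := heavyValue_le (n := n) (key := key) h.prob (F := fun out c =>
        lightValue M n key pr (fun out c => ((machine M n key pr 0 [] out
          (c + jumpCost + lightExitCost)).clock : ENNReal)) lightCost n out (c + heavyExitCost + 1))
    (A := (heavyExitCost + 1 + jumpCost + lightExitCost : ℕ) + lightCost *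
      ENNReal.ofReal (∑ k ∈ Finset.Icc 1 n, (1 - missProb M n pr k))) (fun out c => by
      refine (h1 out c).trans (le_of_eq ?_)
      push_cast
      ring) heavyCost n [] queryStartCost
  refine h2.trans ?_
  have h3 : ∑ k ∈ Finset.Icc 1 n, (heavies n pr k : ENNReal) =
      ENNReal.ofReal (∑ k ∈ Finset.Icc 1 n, (heavies n pr k : ℝ)) := by
    rw [ENNReal.ofReal_sum_of_nonneg fun k _ => Nat.cast_nonneg _]
    simp
  have h4 := sum_hitProb_le h.le hpr
  have h5 := sum_heavies_le (n := n) hpr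
  rw [← hmu] at h4 h5
  have h6 : 0 ≤ ∑ k ∈ Finset.Icc 1 n, (1 - missProb M n pr k) :=
    Finset.sum_nonneg fun k _ => by linarith [(missProb_mem M n pr k).2]
  rw [h3, ← ENNReal.ofReal_natCast queryStartCost, ← ENNReal.ofReal_natCast lightCost,
    ← ENNReal.ofReal_natCast heavyCost, ← ENNReal.ofReal_natCast (_ + lightExitCost),
    ← ENNReal.ofReal_mul (by positivity), ← ENNReal.ofReal_mul (by positivity),
    ← ENNReal.ofReal_add (by positivity) (by positivity),
    ← ENNReal.ofReal_add (by positivity) (by positivity),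
    ← ENNReal.ofReal_add (by positivity) (by positivity)]
  refine ENNReal.ofReal_le_ofReal ?_
  have h7 := mul_le_mul_of_nonneg_left h4 (Nat.cast_nonneg (α := ℝ) lightCost)
  have h8 := mul_le_mul_of_nonneg_left h5 (Nat.cast_nonneg (α := ℝ) heavyCost)
  unfold queryCost
  push_cast
  have h9 : (0 : ℝ) ≤ (queryStartCost + heavyExitCost + 1 + jumpCost + lightExitCost) * I.mu :=
    mul_nonneg (by positivity) hmu0
  nlinarith [Nat.cast_nonneg (α := ℝ) lightCost, Nat.cast_nonneg (α := ℝ) heavyCost]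

end SubsetSampling

namespace RealRAM

/-! ### Sequences of calls -/

/-- Whatever the random numbers are, call number `k` starts in configuration `c`. -/
def StartsIn (calls : ℕ → Call) (k : ℕ) (c : Config) : Prop :=
  ∀ ω, ∃ s, stateBefore calls ω k = some s ∧ ([(calls k).1], s.start (calls k).2) = c

namespace StartsIn

variable {calls : ℕ → Call} {k : ℕ} {c : Config}

theorem stateBefore_succ (h : StartsIn calls k c) (ω : ℕ → ℕ → ℝ) :
    stateBefore calls ω (k + 1) = result c (ω k) := by
  obtain ⟨s, hs, rfl⟩ := h ω
  rw [stateBefore, hs, Option.bind_some, exec_eq_result]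

theorem time_eq (h : StartsIn calls k c) (ω : ℕ → ℕ → ℝ) :
    time calls ω k = finalValue (fun s => s.clock) c (ω k) := by
  rw [time, h.stateBefore_succ, finalValue]
  cases result c (ω k) <;> rfl

theorem exists_result {N : ℕ} {R : State → Prop} (hc : Halts N R c) (ω : ℕ → ℝ) :
    ∃ s, result c ω = some s ∧ R s := by
  obtain ⟨t, s, ht, hs, -⟩ := hc ω
  exact ⟨s, result_eq_of_runFrom ht, hs⟩

theorem haltsInSpace {N N' : ℕ} {R : State → Prop} (h : StartsIn calls k c) (hc : Halts N R c)
    (hN : N ≤ N') (ω : ℕ → ℕ → ℝ) : HaltsInSpace calls ω k N' := by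
  obtain ⟨s, hs, -⟩ := exists_result hc (ω k)
  refine ⟨by rw [h.stateBefore_succ, hs]; rfl, ?_⟩
  obtain ⟨s', hs', rfl⟩ := h ω
  obtain ⟨-, -, -, -, hb⟩ := hc (ω k)
  refine ⟨s', hs', fun t => ?_⟩
  rw [run_eq_runFrom]
  exact (hb t).mono hN

theorem lintegral_time {N : ℕ} {R : State → Prop} {r : ENNReal} (h : StartsIn calls k c)
    (hc : Spec N R (fun s => s.clock) c r) : ∫⁻ ω, time calls ω k ∂randomness = r := by
  simp only [h.time_eq]
  rw [← hc.lintegral]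
  exact (measurePreserving_eval_infinitePi (fun _ : ℕ => stream) k).lintegral_comp hc.measurable

/-- The predicate `R` need not fix output and clock, which `State.start` resets. So the next call
starts in a fixed configuration even after a query with a random answer. -/
theorem succ {N : ℕ} {R : State → Prop} {c' : Config} (h : StartsIn calls k c) (hc : Halts N R c)
    (hR : ∀ s, R s → ([(calls (k + 1)).1], s.start (calls (k + 1)).2) = c') :
    StartsIn calls (k + 1) c' := by
  intro ω
  obtain ⟨s, hs, hs'⟩ := exists_result hc (ω k)
  exact ⟨s, by rw [h.stateBefore_succ, hs], hR s hs'⟩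

end StartsIn

theorem Reaches.spec {N : ℕ} {c : Config} {s : State} (h : Reaches N c ([], s))
    (hb : Blank N s.mem) (f : State → ENNReal) : Spec N (· = s) f c (f s) := by
  obtain ⟨n, hn⟩ := h
  exact .of_reduces hn (.nil f hb rfl)

end RealRAM

/-! ### The data structure under a sequence of operations -/

namespace SubsetSampling

open RealRAM

theorem outputs_iff {calls : ℕ → Call} {k : ℕ} {c : Config} (h : StartsIn calls k c)
    (ω : ℕ → ℕ → ℝ) (T : Finset ℕ) :
    Outputs calls ω k T ↔ finalValue (answerIndicator T) c (ω k) = 1 := by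
  -- In `Outputs` the cast is elaborated as a monadic coercion of `T.val`, which agrees with mapping
  -- the cast over `T.val`.
  have hT : (Multiset.map (fun v => v) do
      let a ← T.val
      pure (a : ℝ)) = T.val.map fun v : ℕ => (v : ℝ) := by
    simp [Multiset.bind_def, Multiset.pure_def]
  rw [Outputs, h.stateBefore_succ, finalValue, hT]
  cases result c (ω k) with
  | none => simp
  | some s => simp [answerIndicator]

/-- The final value is `0` or `1`, so its expectation is a probability. -/
theorem measure_answer {N : ℕ} {R : State → Prop} {c : Config} {r : ENNReal} {T : Finset ℕ}
    (h : Spec N R (answerIndicator T) c r) :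
    stream {ω | finalValue (answerIndicator T) c ω = 1} = r := by
  rw [← h.lintegral, ← lintegral_indicator_one (measurableSet_eq_fun h.measurable measurable_const)]
  refine lintegral_congr fun ω => ?_
  obtain ⟨s, hs, -⟩ := StartsIn.exists_result h.halts ω
  rw [Set.indicator_apply]
  simp only [finalValue, hs, Option.elim_some, answerIndicator, Set.mem_ofPred_eq, Pi.one_apply]
  split_ifs <;> simp_all

theorem Represents.sampleProb_nonneg {I : Instance} {M n : ℕ} {key : ℕ → ℕ} {pr : ℕ → ℝ}
    (h : Represents I M n key pr) {T : Finset ℕ} (hT : T ⊆ I.S) : 0 ≤ I.sampleProb T := by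
  have hp : ∀ v ∈ I.S, I.p v ∈ Set.Icc (0 : ℝ) 1 := by
    intro v hv
    obtain ⟨k, hk, rfl⟩ := h.exists_index hv
    exact h.prob_eq k hk ▸ h.prob k
  exact mul_nonneg (Finset.prod_nonneg fun v hv => (hp v (hT hv)).1)
    (Finset.prod_nonneg fun v hv => by linarith [(hp v (Finset.mem_sdiff.1 hv).1).2])

section calls

variable {l : List ℕ} {p : ℕ → ℝ} {ops : ℕ → Op}

theorem startsIn_zero : StartsIn ((dataStructure queryProgram).calls l p ops) 0
    ([buildProgram], State.blank.start ((l.length : ℝ) :: records p l)) :=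
  fun _ => ⟨_, rfl, rfl⟩

theorem exists_build_spec (hl : l.Nodup) (hp : ∀ v ∈ l, p v ∈ Set.Icc (0 : ℝ) 1) :
    ∃ n key pr t, Represents ⟨l.toFinset, p⟩ (2 * n + 1) n key pr ∧
      t ≤ buildCost * (1 + l.length) ∧
      ∀ f, Spec (4 * (1 + l.toFinset.card)) (· = machine (2 * n + 1) n key pr 0 [] [] t) f
        ([buildProgram], State.blank.start ((l.length : ℝ) :: records p l))
        (f (machine (2 * n + 1) n key pr 0 [] [] t)) := by
  have hc := List.toFinset_card_of_nodup hl
  obtain ⟨n, key, pr, t, h, ht, hr⟩ :=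
    buildProgram_reaches hl hp (N := 4 * (1 + l.toFinset.card)) (by omega)
  have hn : l.toFinset.card = n := h.card
  exact ⟨n, key, pr, t, h, ht, hr.spec (h.blank (by omega))⟩

/-- The state after `k` operations, and a bound for the total time of the modifications. -/
theorem exists_represents (hl : l.Nodup) (hp : ∀ v ∈ l, p v ∈ Set.Icc (0 : ℝ) 1)
    (hops : ∀ k, (ops k).Valid (instanceAfter ⟨l.toFinset, p⟩ ops k)) (k : ℕ) :
    ∃ M n key pr, Represents (instanceAfter ⟨l.toFinset, p⟩ ops k) M n key pr ∧
      StartsIn ((dataStructure queryProgram).calls l p ops) (k + 1)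
        ([((dataStructure queryProgram).opCall (ops k)).1],
          machine M n key pr 0 ((dataStructure queryProgram).opCall (ops k)).2 [] 0) ∧
      ∑ j ∈ Finset.range k with ¬ (ops j).IsQuery,
          ∫⁻ ω, time ((dataStructure queryProgram).calls l p ops) ω (j + 1) ∂randomness +
        (growStepCost * (2 * n - M) : ℕ) ≤
          modificationCost * ((Finset.range k).filter fun j => ¬ (ops j).IsQuery).card := by
  induction k with
  | zero =>
    obtain ⟨n, key, pr, t, h, -, hr⟩ := exists_build_spec hl hp
    refine ⟨2 * n + 1, n, key, pr, h, startsIn_zero.succ (hr 0).halts ?_, ?_⟩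
    · rintro s rfl
      rfl
    -- The construction ends with capacity `2 * n + 1`, hence with potential `0`.
    · simp [show 2 * n - (2 * n + 1) = 0 by omega]
  | succ k ih =>
    obtain ⟨M, n, key, pr, h, hs, ht⟩ := ih
    have hcard := h.card
    by_cases hq : (ops k).IsQuery
    · have hk : ops k = .query := by
        cases hk : ops k <;> simp_all [Op.IsQuery]
      have hI : instanceAfter ⟨l.toFinset, p⟩ ops (k + 1) = instanceAfter ⟨l.toFinset, p⟩ ops k := by
        rw [instanceAfter, hk, Op.apply]
      rw [hk] at hs
      obtain ⟨r, -, hr⟩ := query_time h le_rfl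
      refine ⟨M, n, key, pr, by rwa [hI], hs.succ hr.halts ?_, ?_⟩
      · rintro s ⟨out, c, rfl⟩
        rfl
      · rw [Finset.range_add_one, Finset.filter_insert, if_neg (not_not.2 hq)]
        exact ht
    · obtain ⟨M', n', key', pr', t, h', ht', hr⟩ := modification_reaches h (hops k) hq queryProgram
      have hcard' := h'.card
      have hr := fun f => hr.spec (h'.blank (by omega)) f
      refine ⟨M', n', key', pr', h', hs.succ (hr 0).halts ?_, ?_⟩
      · rintro s rfl
        rfl
      · rw [Finset.range_add_one, Finset.filter_insert, if_pos hq,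
          Finset.sum_insert (by simp), Finset.card_insert_of_notMem (by simp),
          hs.lintegral_time (hr _)]
        have h1 : ((t : ENNReal) + (growStepCost * (2 * n' - M') : ℕ)) ≤
            modificationCost + (growStepCost * (2 * n - M) : ℕ) := by exact_mod_cast ht'
        calc _ = (∑ j ∈ Finset.range k with ¬ (ops j).IsQuery, ∫⁻ ω, time
                ((dataStructure queryProgram).calls l p ops) ω (j + 1) ∂randomness) +
              ((t : ENNReal) + (growStepCost * (2 * n' - M') : ℕ)) := by
                simp only [machine, stage]
                ring
          _ ≤ _ := add_le_add_right h1 _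
          _ = _ + modificationCost := by rw [add_left_comm, add_comm]
          _ ≤ _ := add_le_add_left ht _
          _ = _ := by push_cast; ring

end calls

end SubsetSampling

open RealRAM SubsetSampling in
theorem theorem1 :
    ∃ (D : DataStructure) (C : ℕ),
      ∀ (l : List ℕ) (p : ℕ → ℝ) (ops : ℕ → Op),
        l.Nodup → (∀ v ∈ l, p v ∈ Set.Icc (0 : ℝ) 1) →
        (∀ k, (ops k).Valid (instanceAfter ⟨l.toFinset, p⟩ ops k)) →
        -- space
        (∀ᵐ ω ∂randomness, ∀ k, HaltsInSpace (D.calls l p ops) ω k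
          (C * (1 + (instanceAfter ⟨l.toFinset, p⟩ ops k).S.card))) ∧
        -- expected construction time
        (∫⁻ ω, time (D.calls l p ops) ω 0 ∂randomness ≤ C * (1 + l.length)) ∧
        -- expected time of each query
        (∀ k, (ops k).IsQuery →
          ∫⁻ ω, time (D.calls l p ops) ω (k + 1) ∂randomness ≤
            ENNReal.ofReal (C * (1 + (instanceAfter ⟨l.toFinset, p⟩ ops k).mu))) ∧
        -- amortized expected time of the modifications
        (∀ n, ∑ k ∈ Finset.range n with ¬ (ops k).IsQuery,
            ∫⁻ ω, time (D.calls l p ops) ω (k + 1) ∂randomness ≤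
          C * ((Finset.range n).filter fun k => ¬ (ops k).IsQuery).card) ∧
        -- joint distribution of the answers to the queries
        (∀ (n : ℕ) (T : ℕ → Finset ℕ),
          (∀ k < n, (ops k).IsQuery → T k ⊆ (instanceAfter ⟨l.toFinset, p⟩ ops k).S) →
          randomness {ω | ∀ k < n, (ops k).IsQuery →
              Outputs (D.calls l p ops) ω (k + 1) (T k)} =
            ENNReal.ofReal (∏ k ∈ Finset.range n with (ops k).IsQuery,
              (instanceAfter ⟨l.toFinset, p⟩ ops k).sampleProb (T k))) := by
  -- The summand `4` is for the space; each of the others covers one of the time bounds.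
  refine ⟨dataStructure queryProgram, 4 + buildCost + queryCost + modificationCost,
    fun l p ops hl hp hops => ?_⟩
  have H := exists_represents hl hp hops
  obtain ⟨n, key, pr, t, h0, ht, hr0⟩ := exists_build_spec hl hp
  have hquery : ∀ k, (ops k).IsQuery → ops k = .query := fun k hq => by
    cases hk : ops k <;> simp_all [Op.IsQuery]
  refine ⟨ae_of_all _ fun ω k => ?_, ?_, fun k hq => ?_, fun m => ?_, fun m T hT => ?_⟩
  · cases k with
    | zero => exact startsIn_zero.haltsInSpace (hr0 0).halts (Nat.mul_le_mul_right _ (by omega)) ω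
    | succ k =>
      obtain ⟨M, n, key, pr, h, hs, -⟩ := H k
      have hN : 4 * (1 + (instanceAfter ⟨l.toFinset, p⟩ ops (k + 1)).S.card) ≤
          (4 + buildCost + queryCost + modificationCost) *
            (1 + (instanceAfter ⟨l.toFinset, p⟩ ops (k + 1)).S.card) :=
        Nat.mul_le_mul_right _ (by omega)
      by_cases hq : (ops k).IsQuery
      · have hI : (instanceAfter ⟨l.toFinset, p⟩ ops (k + 1)).S.card = n := by
          rw [instanceAfter, hquery k hq, Op.apply, h.card]
        rw [hquery k hq] at hs
        obtain ⟨r, -, hr⟩ := query_time h le_rfl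
        exact hs.haltsInSpace hr.halts (by omega) ω
      · obtain ⟨M', n', key', pr', t, h', -, hr⟩ :=
          modification_reaches h (hops k) hq queryProgram
        have hcard : ((ops k).apply (instanceAfter ⟨l.toFinset, p⟩ ops k)).S.card = n' := h'.card
        exact hs.haltsInSpace (hr.spec (h'.blank (by omega)) 0).halts hN ω
  · rw [startsIn_zero.lintegral_time (hr0 _)]
    have : t ≤ (4 + buildCost + queryCost + modificationCost) * (1 + l.length) :=
      ht.trans (Nat.mul_le_mul_right _ (by omega))
    exact_mod_cast this
  · obtain ⟨M, n, key, pr, h, hs, -⟩ := H k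
    rw [hquery k hq] at hs
    obtain ⟨r, hr, hspec⟩ := query_time h le_rfl
    rw [hs.lintegral_time hspec]
    refine hr.trans (ENNReal.ofReal_le_ofReal ?_)
    have hmu : 0 ≤ (instanceAfter ⟨l.toFinset, p⟩ ops k).mu := by
      refine Finset.sum_nonneg fun v hv => ?_
      obtain ⟨j, hj, rfl⟩ := h.exists_index hv
      exact h.prob_eq j hj ▸ (h.prob j).1
    refine mul_le_mul_of_nonneg_right ?_ (by linarith)
    exact_mod_cast (by omega : queryCost ≤ 4 + buildCost + queryCost + modificationCost)
  · obtain ⟨M, n, key, pr, -, -, hsum⟩ := H m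
    refine (le_self_add.trans hsum).trans (mul_le_mul_left ?_ _)
    exact_mod_cast (by omega : modificationCost ≤ 4 + buildCost + queryCost + modificationCost)
  -- The answer of operation `k` is determined by the random numbers of call `k + 1` alone. The
  -- joint event is therefore a box, and its measure is a product. Indices that are not queries
  -- before `m` get a dummy set.
  · have hB : ∀ k, ∃ B : Set (ℕ → ℝ), MeasurableSet B ∧ (k < m → (ops k).IsQuery →
        (∀ ω, Outputs ((dataStructure queryProgram).calls l p ops) ω (k + 1) (T k) ↔
          ω (k + 1) ∈ B) ∧
        stream B = ENNReal.ofReal ((instanceAfter ⟨l.toFinset, p⟩ ops k).sampleProb (T k)) ∧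
        0 ≤ (instanceAfter ⟨l.toFinset, p⟩ ops k).sampleProb (T k)) := by
      intro k
      by_cases hk : k < m ∧ (ops k).IsQuery
      · obtain ⟨hkm, hq⟩ := hk
        obtain ⟨M, n, key, pr, h, hs, -⟩ := H k
        rw [hquery k hq] at hs
        have ha := query_answer h (hT k hkm hq) le_rfl
        exact ⟨_, measurableSet_eq_fun ha.measurable measurable_const, fun _ _ =>
          ⟨fun ω => outputs_iff hs ω (T k), measure_answer ha, h.sampleProb_nonneg (hT k hkm hq)⟩⟩
      · exact ⟨∅, .empty, fun h1 h2 => absurd ⟨h1, h2⟩ hk⟩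
    choose B hBm hB using hB
    have hset : {ω | ∀ k < m, (ops k).IsQuery →
        Outputs ((dataStructure queryProgram).calls l p ops) ω (k + 1) (T k)} =
        (((Finset.range m).filter fun k => (ops k).IsQuery).map (addRightEmbedding 1) : Set ℕ).pi
          fun j => B (j - 1) := by
      ext ω
      simp only [Set.mem_ofPred_eq, Set.mem_pi, Finset.mem_coe, Finset.mem_map, Finset.mem_filter,
        Finset.mem_range, addRightEmbedding_apply]
      constructor
      · rintro h _ ⟨k, ⟨hk, hq⟩, rfl⟩
        exact ((hB k hk hq).1 ω).1 (h k hk hq)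
      · intro h k hk hq
        exact ((hB k hk hq).1 ω).2 (h _ ⟨k, ⟨hk, hq⟩, rfl⟩)
    rw [hset, randomness, Measure.infinitePi_pi _ fun j _ => hBm _, Finset.prod_map,
      ENNReal.ofReal_prod_of_nonneg]
    · refine Finset.prod_congr rfl fun k hk => ?_
      obtain ⟨hk, hq⟩ := Finset.mem_filter.1 hk
      exact (hB k (Finset.mem_range.1 hk) hq).2.1
    · intro k hk
      obtain ⟨hk, hq⟩ := Finset.mem_filter.1 hk
      exact (hB k (Finset.mem_range.1 hk) hq).2.2
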